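/- Let $d\ge 2$ and $1/2<\alpha<(d+1)/2$. Write $\hat f(\xi)=\int_{\mathbb R^d} e^{-2\pi i x\cdot\xi}f(x)\,dx$, let $f\mapsto f^\vee$ be the inverse transform (extended to tempered distributions by duality), and put $\Lambda^{s}\varphi=((2\pi|\cdot|)^{s}\hat\varphi)^\vee$ (componentwise for vector fields). Consider the fractional Stokes system $$\Lambda^{2\alpha}u+\nabla p=\operatorname{div}F,\qquad \operatorname{div}u=0\quad\text{in }\mathbb R^d,\qquad (\operatorname{div}F)^j=\sum_{k=1}^d D_kF^{jk},$$ where $F=[F^{jk}]:\mathbb R^d\to\mathbb R^{d\times d}$ is integrable. A vector field $u:\mathbb R^d\to\mathbb R^d$ in $L^1+L^\infty$ is called a very weak solution if $$\int_{\mathbb R^d}u\cdot(\Lambda^{2\alpha}\Phi+\nabla\psi)\,dx=-\int_{\mathbb R^d}\sum_{j,k=1}^d F^{jk}\,D_k\Phi^j\,dx$$ for all smooth compactly supported divergence-free vector fields $\Phi$ and all smooth compactly supported functions $\psi$. For $1<q<\infty$, $L^{q,\infty}$ is the space of measurable $f$ on $\mathbb R^d$ with $\|f\|_{q,\infty}=\sup_{t>0}t^{1/q}f^*(t)<\infty$,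 where $f^*(t)=\inf\{s>0:|\{|f|>s\}|\le t\}$. Functions that agree almost everywhere are identified. For $1\le j,k,l\le d$ let $$U_{\alpha,j}^{kl}(x)=\frac{\Gamma(1+d/2-\alpha)}{2^{2\alpha}\pi^{d/2}\,\Gamma(1+\alpha)}\left[D_l\!\left(\frac{x_jx_k}{|x|^{d+2-2\alpha}}\right)-\frac{(2\alpha-1)\,\delta_{jk}\,x_l}{|x|^{d+2-2\alpha}}\right]\qquad(x\neq0).$$ (i) The functions $U_{\alpha,j}^{kl}$ and $$m_j^{kl}(\xi)=\frac{2\pi i\,\xi_l}{(2\pi|\xi|)^{2\alpha}}\left(\delta_{jk}-\frac{\xi_j\xi_k}{|\xi|^2}\right)$$ are locally integrable, and $U_{\alpha,j}^{kl}$ is the inverse Fourier transform of $m_j^{kl}$ in the sense of tempered distributions: for every Schwartz function $\varphi$ the functions $U_{\alpha,j}^{kl}\varphi$ and $m_j^{kl}\varphi^\vee$ are integrable and $\int U_{\alpha,j}^{kl}\,\varphi\,dx=\int m_j^{kl}\,\varphi^\vee\,d\xi$. (ii) For each $F\in L^1$ there exists a unique very weak solution $u\in L^{d/(d+1-2\alpha),\infty}$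 of the fractional Stokes system. It is given by $u=\mathbf U_\alpha*F$, that is, $u^j=\sum_{k,l=1}^d U_{\alpha,j}^{kl}*F^{kl}$ for $1\le j\le d$, where the convolution integrals converge absolutely almost everywhere, and it satisfies $$\|u\|_{d/(d+1-2\alpha),\infty}\le C\,\|F\|_{1}$$ with a constant $C$ that depends only on $d$ and $\alpha$. -/

import Mathlib

open MeasureTheory
open scoped ENNReal NNReal FourierTransform ContDiff SchwartzMap

noncomputable section

namespace FracStokes

/-- `ℝᵈ` with the Euclidean norm. -/
abbrev Vec (d : ℕ) : Type := EuclideanSpace ℝ (Fin d)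

/-- Real `d × d` matrices with the norm `|F| = (F : F) ^ (1 / 2)`; the `(j, k)` entry is `F (j, k)`. -/
abbrev Tensor (d : ℕ) : Type := EuclideanSpace ℝ (Fin d × Fin d)

/-- The partial derivative `D_j f (x)` of a real function on `ℝᵈ`. -/
def pderiv {d : ℕ} (j : Fin d) (f : Vec d → ℝ) (x : Vec d) : ℝ :=
  fderiv ℝ f x (EuclideanSpace.single j 1)

/-- The divergence of a vector field. -/
def divergence {d : ℕ} (Φ : Vec d → Vec d) (x : Vec d) : ℝ :=
  ∑ j, pderiv j (fun y => Φ y j) x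

/-- The Kronecker delta. -/
def kron {d : ℕ} (j k : Fin d) : ℝ := if j = k then 1 else 0

/-! ### The weak Lorentz spaces -/

/-- The distribution function `d_f(s) = |{x : |f(x)| > s}|`. -/
def distrib {d : ℕ} {E : Type*} [NormedAddCommGroup E] (f : Vec d → E) (s : ℝ≥0) : ℝ≥0∞ :=
  volume {x | (s : ℝ) < ‖f x‖}

/-- The decreasing rearrangement `f*(t) = inf {s > 0 : d_f(s) ≤ t}` (with `inf ∅ = ∞`). -/
def rearrangement {d : ℕ} {E : Type*} [NormedAddCommGroup E] (f : Vec d → E) (t : ℝ≥0) : ℝ≥0∞ :=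
  ⨅ (s : ℝ≥0) (_ : 0 < s ∧ distrib f s ≤ t), (s : ℝ≥0∞)

/-- The quasi-norm `sup_{t > 0} t^{1/p} f*(t)` of the Lorentz space `L^{p,∞}(ℝᵈ)`. -/
def weakNorm {d : ℕ} {E : Type*} [NormedAddCommGroup E] (p : ℝ) (f : Vec d → E) : ℝ≥0∞ :=
  ⨆ (t : ℝ≥0) (_ : 0 < t), (t : ℝ≥0∞) ^ (1 / p) * rearrangement f t

/-- Membership in the Lorentz space `L^{p,∞}(ℝᵈ)`. -/
def MemWeakLp {d : ℕ} {E : Type*} [NormedAddCommGroup E] (p : ℝ) (f : Vec d → E) : Prop :=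
  AEStronglyMeasurable f volume ∧ weakNorm p f < ⊤

/-! ### Very weak solutions -/

/-- The fractional Laplacian `Λ^s φ = ((2π|ξ|)^s φ̂)^∨`, for `s ≥ 0` and test functions `φ`. -/
def fracLaplacian {d : ℕ} (s : ℝ) (φ : Vec d → ℂ) : Vec d → ℂ :=
  𝓕⁻ (fun ξ : Vec d => (((2 * Real.pi * ‖ξ‖) ^ s : ℝ) : ℂ) * 𝓕 φ ξ)

/-- Membership in `L¹ + L^∞`. -/
def MemL1AddLinfty {d : ℕ} (u : Vec d → Vec d) : Prop :=
  ∃ g h : Vec d → Vec d, MemLp g 1 volume ∧ MemLp h ⊤ volume ∧ u = g + h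

/-- `u ∈ L¹ + L^∞` is a very weak solution of `Λ^{2α} u + ∇p = div F`, `div u = 0` in `ℝᵈ`,
where `(div F)^j = ∑ k, D_k F^{jk}`:
`∫ u · (Λ^{2α} Φ + ∇ψ) = - ∫ F : ∇Φ` for all smooth compactly supported `Φ`, `ψ` with `div Φ = 0`.
(`Λ^{2α}` is computed componentwise; the identity is read in `ℂ`.) -/
def IsVeryWeakSolution {d : ℕ} (α : ℝ) (F : Vec d → Tensor d) (u : Vec d → Vec d) : Prop :=
  MemL1AddLinfty u ∧
  ∀ (Φ : Vec d → Vec d) (ψ : Vec d → ℝ),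
    ContDiff ℝ ∞ Φ → HasCompactSupport Φ → (∀ x, divergence Φ x = 0) →
    ContDiff ℝ ∞ ψ → HasCompactSupport ψ →
    ∫ x, ∑ j, (u x j : ℂ) *
        (fracLaplacian (2 * α) (fun y => (Φ y j : ℂ)) x + (pderiv j ψ x : ℂ)) =
      -((∫ x, ∑ j, ∑ k, F x (j, k) * pderiv k (fun y => Φ y j) x : ℝ) : ℂ)

/-! ### The fundamental tensor `U_α` -/

/-- The Fourier symbol `(2πi ξ_l) (2π|ξ|)^{-2α} (δ_{jk} - ξ_j ξ_k / |ξ|²)`. -/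
def symbol {d : ℕ} (α : ℝ) (j k l : Fin d) (ξ : Vec d) : ℂ :=
  (2 * Real.pi * Complex.I * (ξ l : ℂ)) / (((2 * Real.pi * ‖ξ‖) ^ (2 * α) : ℝ) : ℂ) *
    ((kron j k - ξ j * ξ k / ‖ξ‖ ^ 2 : ℝ) : ℂ)

/-- The kernel `U_{α,j}^{kl}(x) = Γ(1+d/2-α) / (2^{2α} π^{d/2} Γ(1+α)) *
[D_l (x_j x_k / |x|^{d+2-2α}) - (2α-1) δ_{jk} x_l / |x|^{d+2-2α}]`. -/
def kernel {d : ℕ} (α : ℝ) (j k l : Fin d) (x : Vec d) : ℝ :=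
  Real.Gamma (1 + d / 2 - α) /
      ((2 : ℝ) ^ (2 * α) * Real.pi ^ ((d : ℝ) / 2) * Real.Gamma (1 + α)) *
    (pderiv l (fun y => y j * y k / ‖y‖ ^ ((d : ℝ) + 2 - 2 * α)) x -
      kron j k * (2 * α - 1) * x l / ‖x‖ ^ ((d : ℝ) + 2 - 2 * α))

/-- The inverse Fourier transform, in the sense of tempered distributions, of the locally integrable
function `m` is the locally integrable function `K`: `∫ K φ = ∫ m φ^∨` for all Schwartz `φ`. -/
def IsInverseFourier {d : ℕ} (m : Vec d → ℂ) (K : Vec d → ℝ) : Prop :=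
  LocallyIntegrable m volume ∧ LocallyIntegrable K volume ∧
  ∀ φ : 𝓢(Vec d, ℂ),
    Integrable (fun x => (K x : ℂ) * φ x) volume ∧
    Integrable (fun ξ => m ξ * 𝓕⁻ (φ : Vec d → ℂ) ξ) volume ∧
    ∫ x, (K x : ℂ) * φ x = ∫ ξ, m ξ * 𝓕⁻ (φ : Vec d → ℂ) ξ

/-- The integral `∫ U_{α,j}^{kl}(y) F^{kl}(x - y) dy` converges absolutely for all `j, k, l`. -/
def KernelConvExistsAt {d : ℕ} (α : ℝ) (F : Vec d → Tensor d) (x : Vec d) : Prop :=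
  ∀ j k l : Fin d, ConvolutionExistsAt (kernel α j k l) (fun y => F y (k, l)) x
    (ContinuousLinearMap.mul ℝ ℝ) volume

/-- `U_α * F`, with components `∑ k l, U_{α,j}^{kl} * F^{kl}`. -/
def kernelConv {d : ℕ} (α : ℝ) (F : Vec d → Tensor d) (x : Vec d) : Vec d :=
  WithLp.toLp 2 fun j => ∑ k, ∑ l,
    convolution (kernel α j k l) (fun y => F y (k, l)) (ContinuousLinearMap.mul ℝ ℝ) volume x

end FracStokes

end

noncomputable section

namespace FracStokes

section

open Filter Topology

/-! ### The binomial series at the endpoint -/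

/-! Part (i). Up to the constant (2π)^(1-2α) i the symbol is |ξ|^(-2(α+1)) times the cubic
polynomial ξ_l (δ_jk |ξ|² - ξ_j ξ_k). A negative power of |ξ| is a superposition of Gaussians
(`gauss_subordination`). For one Gaussian the pairing can be computed: the polynomial becomes a
third order differential operator on φ, and integration by parts against the transformed Gaussian
leaves the same cubic polynomial and a linear one (`integral_gauss_cubicDeriv`). Integrating over
the scale turns these two terms into the two homogeneous terms of the kernel, and Γ(x + 1) = x Γ(x)
reconciles the constants (`isInverseFourier_kernel`).

The technical obstacle in part (ii) is that Λ^(2α)Φ is in general not a Schwartz function, because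
its symbol is not smooth at 0. The remedy is the binomial expansion (r|ξ|²)^a = ∑ c_n (1 + r|ξ|²)^(a
- n), whose coefficients are absolutely summable for a > 0. Since (1 + r|ξ|²)⁻¹ is the transform of
a probability measure, lowering the order of a Bessel potential by one increases neither its sup
norm nor its L¹ norm. Hence Λ^(2α)Φ is a series of Schwartz functions that converges in L¹ and
uniformly, and it may be paired termwise with any function in L¹ + L^∞ (`PairBound.hasSum_fracPow`).

Existence. The kernel is O(|x|^(-β)) with β = d + 1 - 2α in (0, d), so the convolution is dominated
by a Riesz type potential of |F|, which is of weak type (1, d/β)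
(`exists_weakNorm_le_of_potential`). Fubini moves the convolution onto the test field. By part (i),
the sum over j of the pairings of the kernel with Λ^(2α)Φ^j + D_jψ, translated by y, is -D_lΦ^k(y):
on the Fourier side the powers of |ξ| cancel, the projection fixes divergence-free fields and it
kills gradients (`sum_integral_kernel_shift`).

Uniqueness. The difference w of two solutions is divergence-free in the weak sense. Testing with the
columns of (Δ - ∇ div)χ shows that each component of w annihilates Λ^(2α)Δχ for every Schwartz χ. A
function that is integrable plus an arbitrarily small bounded one, as in L^(p,∞) with p > 1, must
then vanish (`integral_mul_eq_zero_of_fracPow`): in the expansion with large r every term after the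
first is nearly invisible to w. -/

lemma hasSum_of_eq {ι β : Type*} [AddCommMonoid β] [TopologicalSpace β] {f g : ι → β} {s : β}
    (h : HasSum f s) (e : ∀ n, g n = f n) : HasSum g s := (funext e : g = f) ▸ h

/-- The coefficients of the binomial series of `(1 - x) ^ a`. -/
def binomCoeff (a : ℝ) (n : ℕ) : ℝ := (-1) ^ n * Ring.choose a n

lemma binomCoeff_zero (a : ℝ) : binomCoeff a 0 = 1 := by simp [binomCoeff]

lemma binomCoeff_succ (a : ℝ) (n : ℕ) :
    binomCoeff a (n + 1) = binomCoeff a n * ((n - a) / (n + 1)) := by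
  have h := Ring.choose_eq_smul (R := ℝ) (a := a) (n := n)
  have h' := Ring.choose_eq_smul (R := ℝ) (a := a) (n := n + 1)
  simp only [binomCoeff, h, h', descPochhammer_succ_right, pow_succ, Nat.factorial_succ]
  have : (n.factorial : ℝ) ≠ 0 := by positivity
  have : (n : ℝ) + 1 ≠ 0 := by positivity
  have e : (descPochhammer ℤ n * (Polynomial.X - (n : Polynomial ℤ))).smeval a =
      (descPochhammer ℤ n).smeval a * (a - n) := by
    rw [Polynomial.smeval_mul, Polynomial.smeval_sub, Polynomial.smeval_natCast]
    simp
  simp only [e, smul_eq_mul, Nat.cast_mul, Nat.cast_succ]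
  field_simp
  ring

lemma hasSum_binomCoeff (a : ℝ) {x : ℝ} (hx : 0 ≤ x) (hx' : x < 1) :
    HasSum (fun n => binomCoeff a n * x ^ n) ((1 - x) ^ a) := by
  have h := (Real.one_add_rpow_hasFPowerSeriesOnBall_zero (a := a)).hasSum (y := -x)
    (by rw [← ENNReal.ofReal_one, Metric.eball_ofReal]; simp [hx', abs_of_nonneg hx])
  simp only [zero_add] at h
  rw [sub_eq_add_neg]
  refine hasSum_of_eq h fun n => ?_
  simp [binomCoeff, neg_pow x, binomialSeries, FormalMultilinearSeries.ofScalars,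
    List.ofFn_const, List.prod_replicate]
  ring

/-- From an index N > a on, the ratios (n - a)/(n + 1) are nonnegative, so the coefficients keep one
sign. For 0 ≤ x < 1 the tail of absolute values is therefore, up to that sign, (1 - x)^a minus
finitely many terms. This is bounded uniformly in x because a > 0, and the bound survives x → 1 in
every finite sum. -/
lemma summable_abs_binomCoeff {a : ℝ} (ha : 0 < a) : Summable fun n => |binomCoeff a n| := by
  obtain ⟨N, hN⟩ := exists_nat_gt a
  obtain ⟨s, hs, hsN⟩ : ∃ s : ℝ, |s| = 1 ∧ ∀ n, N ≤ n → |binomCoeff a n| = s * binomCoeff a n := by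
    obtain ⟨s, hs, h0⟩ : ∃ s : ℝ, |s| = 1 ∧ |binomCoeff a N| = s * binomCoeff a N := by
      rcases le_total 0 (binomCoeff a N) with h | h
      · exact ⟨1, by simp, by simp [abs_of_nonneg h]⟩
      · exact ⟨-1, by simp, by simp [abs_of_nonpos h]⟩
    refine ⟨s, hs, fun n hn => ?_⟩
    induction n, hn using Nat.le_induction with
    | base => exact h0
    | succ n hn ih =>
      have h1 : (0 : ℝ) ≤ (n - a) / (n + 1) := by
        have : (N : ℝ) ≤ n := by exact_mod_cast hn
        apply div_nonneg <;> linarith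
      rw [binomCoeff_succ, abs_mul, ih, abs_of_nonneg h1]; ring
  rw [← summable_nat_add_iff N]
  set B : ℝ := ∑ n ∈ Finset.range N, |binomCoeff a n| + 1
  refine summable_of_sum_range_le (c := B) (fun n => abs_nonneg _) fun M => ?_
  have key : ∀ x ∈ Set.Ico (0 : ℝ) 1,
      ∑ n ∈ Finset.range M, |binomCoeff a (n + N)| * x ^ (n + N) ≤ B := by
    intro x ⟨hx, hx'⟩
    have h := hasSum_binomCoeff a hx hx'
    have h2 := (hasSum_nat_add_iff' N).2 h
    have h3 : HasSum (fun n => |binomCoeff a (n + N)| * x ^ (n + N))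
        (s * ((1 - x) ^ a - ∑ n ∈ Finset.range N, binomCoeff a n * x ^ n)) := by
      refine hasSum_of_eq (h2.mul_left s) fun n => ?_
      rw [hsN _ (Nat.le_add_left _ _)]; ring
    refine (sum_le_hasSum _ (fun n _ => by positivity) h3).trans ?_
    refine (le_abs_self _).trans ?_
    rw [abs_mul, hs, one_mul]
    refine (abs_sub _ _).trans ?_
    rw [add_comm]
    have h5 : |(1 - x) ^ a| ≤ 1 := by
      rw [abs_of_nonneg (Real.rpow_nonneg (by linarith) _)]
      exact Real.rpow_le_one (by linarith) (by linarith) ha.le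
    have h6 : |∑ n ∈ Finset.range N, binomCoeff a n * x ^ n| ≤
        ∑ n ∈ Finset.range N, |binomCoeff a n| := by
      refine (Finset.abs_sum_le_sum_abs _ _).trans (Finset.sum_le_sum fun n _ => ?_)
      rw [abs_mul, abs_of_nonneg (pow_nonneg hx n)]
      exact mul_le_of_le_one_right (abs_nonneg _) (pow_le_one₀ hx hx'.le)
    linarith
  have hc : Continuous fun x : ℝ => ∑ n ∈ Finset.range M, |binomCoeff a (n + N)| * x ^ (n + N) := by
    fun_prop
  have h1 : (1 : ℝ) ∈ closure (Set.Ico (0 : ℝ) 1) := by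
    rw [closure_Ico (by norm_num)]; simp
  have := closure_minimal (s := Set.Ico (0 : ℝ) 1)
    (t := {x | ∑ n ∈ Finset.range M, |binomCoeff a (n + N)| * x ^ (n + N) ≤ B})
    key (isClosed_le hc continuous_const) h1
  simpa using this

/-! ### Bessel potentials -/

/-- The symbol `(1 + r|ξ|²) ^ a`. -/
def bes {d : ℕ} (r a : ℝ) (ξ : Vec d) : ℝ := (1 + r * ‖ξ‖ ^ 2) ^ a

variable {d : ℕ}

lemma one_le_bes_base {r : ℝ} (hr : 0 ≤ r) (ξ : Vec d) : 1 ≤ 1 + r * ‖ξ‖ ^ 2 := by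
  have : 0 ≤ r * ‖ξ‖ ^ 2 := by positivity
  linarith

lemma bes_pos {r : ℝ} (hr : 0 ≤ r) (a : ℝ) (ξ : Vec d) : 0 < bes r a ξ :=
  Real.rpow_pos_of_pos (by linarith [one_le_bes_base hr ξ]) a

lemma bes_add {r : ℝ} (hr : 0 ≤ r) (a b : ℝ) (ξ : Vec d) :
    bes r (a + b) ξ = bes r a ξ * bes r b ξ :=
  Real.rpow_add (by linarith [one_le_bes_base hr ξ]) a b

lemma bes_zero (r : ℝ) (ξ : Vec d) : bes r 0 ξ = 1 := by simp [bes]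

lemma bes_neg (r a : ℝ) (ξ : Vec d) : bes r a (-ξ) = bes r a ξ := by simp [bes]

lemma bes_sub_nat {r : ℝ} (hr : 0 ≤ r) (a : ℝ) (n : ℕ) (ξ : Vec d) :
    bes r (a - n) ξ = bes r a ξ * bes r (-1) ξ ^ n := by
  rw [sub_eq_add_neg, bes_add hr]
  congr 1
  simp only [bes]
  rw [← Real.rpow_mul_natCast (by linarith [one_le_bes_base hr ξ])]
  simp

lemma bes_neg_one_le {r : ℝ} (hr : 0 ≤ r) (ξ : Vec d) : bes r (-1) ξ ≤ 1 :=
  Real.rpow_le_one_of_one_le_of_nonpos (one_le_bes_base hr ξ) (by norm_num)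

lemma bes_sub_nat_le {r : ℝ} (hr : 0 ≤ r) (a : ℝ) (n : ℕ) (ξ : Vec d) :
    bes r (a - n) ξ ≤ bes r a ξ := by
  rw [bes_sub_nat hr]
  exact mul_le_of_le_one_right (bes_pos hr _ _).le
    (pow_le_one₀ (bes_pos hr _ _).le (bes_neg_one_le hr ξ))

lemma hasTemperateGrowth_bes {r : ℝ} (hr : 0 < r) (a : ℝ) :
    Function.HasTemperateGrowth (bes (d := d) r a) := by
  have h := (Function.hasTemperateGrowth_one_add_norm_sq_rpow (H := Vec d) a).comp
    ((Real.sqrt r • ContinuousLinearMap.id ℝ (Vec d)).hasTemperateGrowth)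
  have e : bes (d := d) r a = (fun x : Vec d => (1 + ‖x‖ ^ 2) ^ a) ∘
      (Real.sqrt r • ContinuousLinearMap.id ℝ (Vec d)) := by
    ext ξ
    simp [bes, norm_smul, mul_pow, Real.sq_sqrt hr.le]
  rw [e]
  exact h

lemma hasTemperateGrowth_bes_complex {r : ℝ} (hr : 0 < r) (a : ℝ) :
    Function.HasTemperateGrowth (fun ξ : Vec d => (bes r a ξ : ℂ)) :=
  Function.HasTemperateGrowth.comp Function.Complex.hasTemperateGrowth_ofReal (hasTemperateGrowth_bes hr a)

/-- Factor (r|ξ|²)^a = (1 + r|ξ|²)^a (1 - (1 + r|ξ|²)⁻¹)^a and expand the second factor. For ξ ≠ 0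
the variable of the binomial series is strictly below 1. -/
lemma hasSum_bes {r : ℝ} (hr : 0 < r) {a : ℝ} {ξ : Vec d} (hξ : ξ ≠ 0) :
    HasSum (fun n : ℕ => binomCoeff a n * bes r (a - n) ξ) ((r * ‖ξ‖ ^ 2) ^ a) := by
  have hp : 0 < r * ‖ξ‖ ^ 2 := by positivity
  have h1 : bes r (-1) ξ < 1 :=
    Real.rpow_lt_one_of_one_lt_of_neg (by linarith) (by norm_num)
  have h := (hasSum_binomCoeff a (bes_pos hr.le (-1) ξ).le h1).mul_left (bes r a ξ)
  have e : (r * ‖ξ‖ ^ 2) ^ a = bes r a ξ * (1 - bes r (-1) ξ) ^ a := by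
    simp only [bes, Real.rpow_neg_one]
    rw [← Real.mul_rpow (by linarith)]
    · congr 1
      field_simp
      ring
    · rw [sub_nonneg]; exact inv_le_one_of_one_le₀ (by linarith)
  rw [e]
  refine hasSum_of_eq h fun n => ?_
  rw [bes_sub_nat hr.le]; ring

end

/-! ### The probability measure with Fourier transform (1 + r|ξ|²)⁻¹ -/

section

open Filter Topology ProbabilityTheory

variable {d : ℕ}

/-- Integration of `exp (-c t)` against the exponential distribution. -/
lemma integral_exp_expMeasure {c : ℝ} (hc : 0 ≤ c) :
    ∫ t, Complex.exp ((-(c * t) : ℝ) : ℂ) ∂(expMeasure 1) = (((1 + c)⁻¹ : ℝ) : ℂ) := by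
  simp_rw [← Complex.ofReal_exp]
  rw [integral_complex_ofReal]
  congr 1
  rw [expMeasure, gammaMeasure, integral_withDensity_eq_integral_toReal_smul
    (by exact measurable_gammaPDFReal 1 1 |>.ennreal_ofReal) (by simp [gammaPDF])]
  have h : ∀ t : ℝ, (gammaPDF 1 1 t).toReal • Real.exp (-(c * t)) =
      Set.indicator (Set.Ici 0) (fun t => Real.exp (-(1 + c) * t)) t := by
    intro t
    by_cases ht : 0 ≤ t
    · rw [Set.indicator_of_mem (by exact ht), gammaPDF_of_nonneg ht]
      simp only [Real.one_rpow, Real.Gamma_one, sub_self, Real.rpow_zero]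
      rw [ENNReal.toReal_ofReal (by positivity)]
      simp only [smul_eq_mul, div_one, one_mul, mul_one, ← Real.exp_add]
      congr 1; ring
    · rw [Set.indicator_of_notMem (by exact ht), gammaPDF_of_neg (by linarith)]
      simp
  simp_rw [h]
  rw [integral_indicator measurableSet_Ici, integral_Ici_eq_integral_Ioi,
    integral_exp_mul_Ioi (by linarith)]
  rw [mul_zero, Real.exp_zero, neg_div_neg_eq, one_div]

instance : IsProbabilityMeasure (expMeasure 1) := isProbabilityMeasure_expMeasure one_pos

/-- The law of an exponential variable and an independent standard Gaussian vector. -/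
def besselMeasure (d : ℕ) : Measure (ℝ × Vec d) := (expMeasure 1).prod (stdGaussian (Vec d))

instance : IsProbabilityMeasure (besselMeasure d) := by
  unfold besselMeasure; infer_instance

/-- The random vector whose law is the kernel of `(1 - (r / 4π²) Δ)⁻¹`. -/
def besselVector (r : ℝ) (p : ℝ × Vec d) : Vec d := Real.sqrt (r * p.1 / (2 * Real.pi ^ 2)) • p.2

lemma measurable_besselVector (r : ℝ) : Measurable (besselVector (d := d) r) := by
  unfold besselVector; fun_prop

lemma ae_expMeasure_nonneg : ∀ᵐ t ∂(expMeasure 1), 0 ≤ t := by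
  rw [expMeasure, gammaMeasure, ae_withDensity_iff
    (by exact measurable_gammaPDFReal 1 1 |>.ennreal_ofReal)]
  refine Filter.Eventually.of_forall fun t ht => ?_
  by_contra h
  exact ht (gammaPDF_of_neg (by linarith))

/-- For fixed t the vector is a centred Gaussian with covariance r t / (2π²) times the identity, so
its characteristic function at -2πξ is exp(-r t |ξ|²). Averaging over the exponential law of t gives
(1 + r|ξ|²)⁻¹. -/
lemma charFun_besselVector {r : ℝ} (hr : 0 < r) (ξ : Vec d) :
    ∫ p, Complex.exp (((-(2 * Real.pi * inner ℝ (besselVector r p) ξ) : ℝ) : ℂ) * Complex.I)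
      ∂(besselMeasure d) = (bes r (-1) ξ : ℂ) := by
  have hi : Integrable (fun p : ℝ × Vec d => Complex.exp
      (((-(2 * Real.pi * inner ℝ (besselVector r p) ξ) : ℝ) : ℂ) * Complex.I))
      (besselMeasure d) := by
    refine Integrable.of_bound (C := 1) (Measurable.aestronglyMeasurable ?_) (.of_forall fun p => ?_)
    · have := measurable_besselVector (d := d) r
      fun_prop
    · rw [Complex.norm_exp_ofReal_mul_I]
  unfold besselMeasure at hi ⊢
  rw [integral_prod _ hi]
  have h : ∀ᵐ t ∂(expMeasure 1), ∫ y, Complex.exp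
      (((-(2 * Real.pi * inner ℝ (besselVector r (t, y)) ξ) : ℝ) : ℂ) * Complex.I)
        ∂(stdGaussian (Vec d)) = Complex.exp ((-(r * ‖ξ‖ ^ 2 * t) : ℝ) : ℂ) := by
    filter_upwards [ae_expMeasure_nonneg] with t ht
    have := charFun_stdGaussian
      (-(2 * Real.pi * Real.sqrt (r * t / (2 * Real.pi ^ 2))) • ξ : Vec d)
    rw [charFun_apply] at this
    convert this using 3
    · simp only [besselVector, real_inner_smul_left, real_inner_smul_right]
      congr 1; ring_nf
    · rw [← Complex.ofReal_pow, norm_smul, mul_pow, Real.norm_eq_abs, sq_abs,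
        neg_sq, mul_pow, Real.sq_sqrt (by positivity)]
      push_cast
      field_simp
  rw [integral_congr_ae h, integral_exp_expMeasure (by positivity)]
  simp [bes, Real.rpow_neg_one]

/-! ### Bessel potential operators -/

/-- The Bessel potential operator with symbol `(1 + r|ξ|²) ^ a`. -/
def besOp (r a : ℝ) : 𝓢(Vec d, ℂ) →L[ℂ] 𝓢(Vec d, ℂ) :=
  SchwartzMap.fourierMultiplierCLM ℂ fun ξ : Vec d => (bes r a ξ : ℂ)

lemma fourier_besOp {r : ℝ} (hr : 0 < r) (a : ℝ) (η : 𝓢(Vec d, ℂ)) (ξ : Vec d) :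
    𝓕 (besOp r a η) ξ = (bes r a ξ : ℂ) * 𝓕 η ξ := by
  rw [besOp, SchwartzMap.fourierMultiplierCLM_apply, FourierTransform.fourier_fourierInv_eq,
    SchwartzMap.smulLeftCLM_apply_apply (hasTemperateGrowth_bes_complex hr a), smul_eq_mul]

lemma fourierInv_eq_fourier_neg' (f : Vec d → ℂ) (ξ : Vec d) : 𝓕⁻ f ξ = 𝓕 f (-ξ) := by
  rw [Real.fourierInv_eq_fourier_neg]

lemma fourierInv_besOp {r : ℝ} (hr : 0 < r) (a : ℝ) (η : 𝓢(Vec d, ℂ)) (ξ : Vec d) :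
    𝓕⁻ (besOp r a η : Vec d → ℂ) ξ = (bes r a ξ : ℂ) * 𝓕⁻ (η : Vec d → ℂ) ξ := by
  have := fourier_besOp hr a η (-ξ)
  rw [bes_neg] at this
  simpa only [fourierInv_eq_fourier_neg', SchwartzMap.fourier_coe] using this

lemma besOp_eq_fourierInv {r : ℝ} (hr : 0 < r) (a : ℝ) (η : 𝓢(Vec d, ℂ)) (x : Vec d) :
    besOp r a η x = 𝓕⁻ (fun ξ => (bes r a ξ : ℂ) * 𝓕 (η : Vec d → ℂ) ξ) x := by
  have h : (besOp r a η) = 𝓕⁻ (𝓕 (besOp r a η)) := by simp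
  rw [h, SchwartzMap.fourierInv_coe]
  refine congrArg (fun f : Vec d → ℂ => (𝓕⁻ f : Vec d → ℂ) x) (funext fun ξ => ?_)
  rw [fourier_besOp hr]; rfl

lemma besOp_besOp {r : ℝ} (hr : 0 < r) (a b : ℝ) (η : 𝓢(Vec d, ℂ)) :
    besOp r a (besOp r b η) = besOp r (a + b) η := by
  rw [besOp, besOp, SchwartzMap.fourierMultiplierCLM_fourierMultiplierCLM_apply
    (hasTemperateGrowth_bes_complex hr a) (hasTemperateGrowth_bes_complex hr b), besOp]
  congr 2
  ext ξ
  simp [bes_add hr.le]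

lemma besOp_zero (r : ℝ) (η : 𝓢(Vec d, ℂ)) : besOp r 0 η = η := by
  simp only [besOp, bes_zero, Complex.ofReal_one]
  rw [SchwartzMap.fourierMultiplierCLM_const]; simp

lemma besOp_lineDeriv {r : ℝ} (hr : 0 < r) (a : ℝ) (v : Vec d) (η : 𝓢(Vec d, ℂ)) :
    besOp r a (LineDeriv.lineDerivOp v η) = LineDeriv.lineDerivOp v (besOp r a η) := by
  have hv : Function.HasTemperateGrowth (fun ξ : Vec d => ((inner ℝ ξ v : ℝ) : ℂ)) :=
    Function.HasTemperateGrowth.comp Function.Complex.hasTemperateGrowth_ofReal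
      (Function.hasTemperateGrowth_inner_left v)
  have h : ∀ f : 𝓢(Vec d, ℂ), LineDeriv.lineDerivOp v f = (2 * Real.pi * Complex.I) •
      SchwartzMap.fourierMultiplierCLM ℂ (fun ξ : Vec d => ((inner ℝ ξ v : ℝ) : ℂ)) f := fun f => by
    rw [SchwartzMap.lineDeriv_eq_fourierMultiplierCLM,
      ← SchwartzMap.fourierMultiplierCLM_ofReal ℂ (Function.hasTemperateGrowth_inner_left v)]
    rfl
  rw [h, h, map_smul]
  congr 1
  rw [besOp, SchwartzMap.fourierMultiplierCLM_fourierMultiplierCLM_apply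
    (hasTemperateGrowth_bes_complex hr a) hv,
    SchwartzMap.fourierMultiplierCLM_fourierMultiplierCLM_apply hv
    (hasTemperateGrowth_bes_complex hr a), mul_comm]

/-- `(1 - (r / 4π²) Δ)⁻¹` is convolution with a probability measure. -/
lemma besOp_neg_one_apply {r : ℝ} (hr : 0 < r) (η : 𝓢(Vec d, ℂ)) (x : Vec d) :
    besOp r (-1) η x = ∫ p, η (x - besselVector r p) ∂(besselMeasure d) := by
  have hη : ∀ z, η z = 𝓕⁻ (𝓕 (η : Vec d → ℂ)) z := fun z => by
    have : η = 𝓕⁻ (𝓕 η) := by simp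
    conv_lhs => rw [this, SchwartzMap.fourierInv_coe, SchwartzMap.fourier_coe]
  rw [besOp_eq_fourierInv hr, Real.fourierInv_eq']
  simp_rw [hη, Real.fourierInv_eq']
  have hi : Integrable (𝓕 (η : Vec d → ℂ)) := by
    rw [← SchwartzMap.fourier_coe]; exact SchwartzMap.integrable _
  have hm := measurable_besselVector (d := d) r
  rw [integral_integral_swap]
  · refine integral_congr_ae (.of_forall fun ξ => ?_)
    simp only [smul_eq_mul]
    rw [← charFun_besselVector hr, ← integral_mul_const, ← integral_const_mul]
    refine integral_congr_ae (.of_forall fun p => ?_)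
    simp only
    rw [← mul_assoc, ← Complex.exp_add, ← add_mul, ← Complex.ofReal_add, inner_sub_right,
      real_inner_comm ξ (besselVector r p), mul_sub, sub_eq_add_neg]
  · have h1 : Integrable (Function.uncurry fun (_ : ℝ × Vec d) (ξ : Vec d) => 𝓕 (η : Vec d → ℂ) ξ)
        ((besselMeasure d).prod volume) := by
      simpa [Function.uncurry_def] using
        (integrable_const (1 : ℂ) (μ := besselMeasure d)).mul_prod hi
    refine h1.mono (AEStronglyMeasurable.mul (Measurable.aestronglyMeasurable ?_)
      h1.aestronglyMeasurable) (.of_forall fun p => ?_)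
    · fun_prop
    · simp only [Function.uncurry_def, norm_smul, Complex.norm_exp_ofReal_mul_I, one_mul, le_refl]

lemma norm_besOp_neg_one_le {r : ℝ} (hr : 0 < r) (η : 𝓢(Vec d, ℂ)) {S : ℝ}
    (h : ∀ x, ‖η x‖ ≤ S) (x : Vec d) : ‖besOp r (-1) η x‖ ≤ S := by
  rw [besOp_neg_one_apply hr]
  refine (norm_integral_le_of_norm_le_const (.of_forall fun p => h _)).trans ?_
  simp

lemma integral_norm_besOp_neg_one_le {r : ℝ} (hr : 0 < r) (η : 𝓢(Vec d, ℂ)) :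
    ∫ x, ‖besOp r (-1) η x‖ ≤ ∫ x, ‖η x‖ := by
  rw [integral_norm_eq_lintegral_enorm (by fun_prop), integral_norm_eq_lintegral_enorm (by fun_prop)]
  refine ENNReal.toReal_mono (SchwartzMap.integrable η).2.ne ?_
  have hm := measurable_besselVector (d := d) r
  calc ∫⁻ x, ‖besOp r (-1) η x‖ₑ
      ≤ ∫⁻ x, ∫⁻ p, ‖η (x - besselVector r p)‖ₑ ∂(besselMeasure d) := by
        refine lintegral_mono fun x => ?_
        rw [besOp_neg_one_apply hr]
        exact enorm_integral_le_lintegral_enorm _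
    _ = ∫⁻ p, ∫⁻ x, ‖η (x - besselVector r p)‖ₑ ∂volume ∂(besselMeasure d) := by
        refine lintegral_lintegral_swap (Measurable.aemeasurable ?_)
        have := η.continuous.measurable
        change Measurable fun z : Vec d × (ℝ × Vec d) => ‖η (z.1 - besselVector r z.2)‖ₑ
        fun_prop
    _ = ∫⁻ x, ‖η x‖ₑ := by
        have e : ∀ p, ∫⁻ x, ‖η (x - besselVector r p)‖ₑ = ∫⁻ x, ‖η x‖ₑ :=
          fun p => lintegral_sub_right_eq_self (fun x => ‖η x‖ₑ) _
        simp_rw [e]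
        simp

/-- Each unit of order lost is an average over translates. The point is a bound independent of n,
here and in the L¹ version that follows. -/
lemma norm_besOp_sub_nat_le {r : ℝ} (hr : 0 < r) (a : ℝ) (η : 𝓢(Vec d, ℂ)) {S : ℝ}
    (h : ∀ x, ‖besOp r a η x‖ ≤ S) (n : ℕ) (x : Vec d) : ‖besOp r (a - n) η x‖ ≤ S := by
  induction n generalizing x with
  | zero => simpa using h x
  | succ n ih =>
    have : a - (n + 1 : ℕ) = -1 + (a - n) := by push_cast; ring
    rw [this, ← besOp_besOp hr]
    exact norm_besOp_neg_one_le hr _ ih x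

lemma integral_norm_besOp_sub_nat_le {r : ℝ} (hr : 0 < r) (a : ℝ) (η : 𝓢(Vec d, ℂ)) (n : ℕ) :
    ∫ x, ‖besOp r (a - n) η x‖ ≤ ∫ x, ‖besOp r a η x‖ := by
  induction n with
  | zero => simp
  | succ n ih =>
    have : a - (n + 1 : ℕ) = -1 + (a - n) := by push_cast; ring
    rw [this, ← besOp_besOp hr]
    exact (integral_norm_besOp_neg_one_le hr _).trans ih

end

section

open Filter Topology

variable {d : ℕ}

/-! ### Pairing with `L¹ ∩ L^∞` -/

/-- Pairing with `w` is bounded by `A ‖f‖_∞ + B ‖f‖_1` on `L¹ ∩ L^∞`. -/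
def PairBound (w : Vec d → ℂ) (A B : ℝ) : Prop :=
  AEStronglyMeasurable w volume ∧ ∀ (f : Vec d → ℂ) (S : ℝ), Integrable f → (∀ x, ‖f x‖ ≤ S) →
    Integrable (fun x => w x * f x) ∧ ∫ x, ‖w x * f x‖ ≤ A * S + B * ∫ x, ‖f x‖

lemma PairBound.integrable {w : Vec d → ℂ} {A B S : ℝ} (hw : PairBound w A B) {f : Vec d → ℂ}
    (hf : Integrable f) (hS : ∀ x, ‖f x‖ ≤ S) : Integrable (fun x => w x * f x) :=
  (hw.2 f S hf hS).1

lemma PairBound.norm_integral_le {w : Vec d → ℂ} {A B S : ℝ} (hw : PairBound w A B)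
    {f : Vec d → ℂ} (hf : Integrable f) (hS : ∀ x, ‖f x‖ ≤ S) :
    ‖∫ x, w x * f x‖ ≤ A * S + B * ∫ x, ‖f x‖ :=
  (norm_integral_le_integral_norm _).trans (hw.2 f S hf hS).2

lemma pairBound_add {g h : Vec d → ℂ} {B : ℝ} (hg : Integrable g)
    (hh : AEStronglyMeasurable h volume) (hB : ∀ᵐ x, ‖h x‖ ≤ B) :
    PairBound (g + h) (∫ x, ‖g x‖) B := by
  refine ⟨hg.aestronglyMeasurable.add hh, fun f S hf hS => ?_⟩
  have h1 : Integrable (fun x => g x * f x) := by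
    refine (hg.norm.mul_const S).mono' (hg.aestronglyMeasurable.mul hf.aestronglyMeasurable)
      (.of_forall fun x => ?_)
    rw [norm_mul]
    exact mul_le_mul_of_nonneg_left (hS x) (norm_nonneg _)
  have h2 : ∀ᵐ x, ‖h x * f x‖ ≤ B * ‖f x‖ := by
    filter_upwards [hB] with x hx
    rw [norm_mul]
    exact mul_le_mul_of_nonneg_right hx (norm_nonneg _)
  have h3 : Integrable (fun x => h x * f x) :=
    (hf.norm.const_mul B).mono' (hh.mul hf.aestronglyMeasurable) h2
  have e : (fun x => (g + h) x * f x) = fun x => g x * f x + h x * f x := by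
    ext x; simp [add_mul]
  refine ⟨by rw [e]; exact h1.add h3, ?_⟩
  calc ∫ x, ‖(g + h) x * f x‖ ≤ ∫ x, (‖g x * f x‖ + ‖h x * f x‖) := by
        refine integral_mono (by simpa [add_mul] using (h1.add h3).norm) (h1.norm.add h3.norm)
          fun x => ?_
        simp only [Pi.add_apply, add_mul]
        exact norm_add_le _ _
    _ = (∫ x, ‖g x * f x‖) + ∫ x, ‖h x * f x‖ := integral_add h1.norm h3.norm
    _ ≤ _ := by
        refine add_le_add ?_ ?_
        · rw [← integral_mul_const]
          refine integral_mono h1.norm (hg.norm.mul_const S) fun x => ?_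
          simp only [norm_mul]
          exact mul_le_mul_of_nonneg_left (hS x) (norm_nonneg _)
        · rw [← integral_const_mul]
          exact integral_mono_ae h3.norm (hf.norm.const_mul B) h2

lemma PairBound.sub {w v : Vec d → ℂ} {A B A' B' : ℝ} (hw : PairBound w A B)
    (hv : PairBound v A' B') : PairBound (w - v) (A + A') (B + B') := by
  refine ⟨hw.1.sub hv.1, fun f S hf hS => ?_⟩
  obtain ⟨h1, h2⟩ := hw.2 f S hf hS
  obtain ⟨h3, h4⟩ := hv.2 f S hf hS
  have e : (fun x => (w - v) x * f x) = fun x => w x * f x - v x * f x := by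
    ext x; simp [sub_mul]
  refine ⟨by rw [e]; exact h1.sub h3, ?_⟩
  calc ∫ x, ‖(w - v) x * f x‖ ≤ ∫ x, (‖w x * f x‖ + ‖v x * f x‖) := by
        refine integral_mono (by simpa [sub_mul] using (h1.sub h3).norm) (h1.norm.add h3.norm)
          fun x => ?_
        simp only [Pi.sub_apply, sub_mul]
        exact norm_sub_le _ _
    _ = (∫ x, ‖w x * f x‖) + ∫ x, ‖v x * f x‖ := integral_add h1.norm h3.norm
    _ ≤ _ := by linarith

lemma exists_pairBound_component {u : Vec d → Vec d} (hu : MemL1AddLinfty u) (j : Fin d) :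
    ∃ A B, PairBound (fun x => (u x j : ℂ)) A B := by
  obtain ⟨g, h, hg, hh, rfl⟩ := hu
  have hc : ∀ v : Vec d, ‖((v j : ℝ) : ℂ)‖ ≤ ‖v‖ := fun v => by
    rw [Complex.norm_real]; exact PiLp.norm_apply_le v j
  have hm : ∀ {f : Vec d → Vec d}, AEStronglyMeasurable f volume →
      AEStronglyMeasurable (fun x => ((f x j : ℝ) : ℂ)) volume := fun {f} hf =>
    (by fun_prop : Continuous fun v : Vec d => ((v j : ℝ) : ℂ)).comp_aestronglyMeasurable hf
  have h1 : Integrable (fun x => ((g x j : ℝ) : ℂ)) :=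
    (memLp_one_iff_integrable.1 hg).norm.mono' (hm hg.1) (.of_forall fun x => hc _)
  refine ⟨∫ x, ‖((g x j : ℝ) : ℂ)‖, (eLpNorm h ⊤ volume).toReal, ?_⟩
  have e : (fun x => (((g + h) x j : ℝ) : ℂ)) =
      (fun x => ((g x j : ℝ) : ℂ)) + fun x => ((h x j : ℝ) : ℂ) := by ext x; simp
  rw [e]
  refine pairBound_add h1 (hm hh.1) ?_
  rw [eLpNorm_exponent_top]
  filter_upwards [ae_le_eLpNormEssSup (f := h) (μ := volume)] with x hx
  refine (hc _).trans ?_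
  have := hh.2
  rw [eLpNorm_exponent_top] at this
  exact (ENNReal.ofReal_le_iff_le_toReal this.ne).1 (by rwa [ofReal_norm])

/-! ### Fractional powers of the Laplacian as series of Bessel potentials -/

/-- The operator with symbol `(r|ξ|²) ^ a`. -/
def fracPow (r a : ℝ) (φ : Vec d → ℂ) : Vec d → ℂ :=
  𝓕⁻ (fun ξ : Vec d => (((r * ‖ξ‖ ^ 2) ^ a : ℝ) : ℂ) * 𝓕 φ ξ)

/-- The value r = 4π² gives the Laplacian itself. Another r multiplies the operator by a constant
only, but it changes the expansion into Bessel potentials; the Liouville argument uses this with r →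
∞. -/
lemma fracLaplacian_eq_fracPow (α : ℝ) (φ : Vec d → ℂ) :
    fracLaplacian (2 * α) φ = fracPow (4 * Real.pi ^ 2) α φ := by
  unfold fracLaplacian fracPow
  congr 1
  ext ξ
  rw [Real.rpow_mul (by positivity), Real.rpow_two]
  congr 4
  ring

lemma exists_norm_le (η : 𝓢(Vec d, ℂ)) : ∃ S, ∀ x, ‖η x‖ ≤ S :=
  ⟨_, fun x => SchwartzMap.norm_le_seminorm ℝ η x⟩

variable [NeZero d]

/-- The expansion is integrated termwise under the inverse Fourier integral: the terms are dominated
by |c_n| (1 + r|ξ|²)^a |η̂(ξ)|, which is summable in n with integrable sum. -/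
lemma hasSum_besOp {r : ℝ} (hr : 0 < r) {a : ℝ} (ha : 0 < a) (η : 𝓢(Vec d, ℂ)) (x : Vec d) :
    HasSum (fun n : ℕ => (binomCoeff a n : ℂ) * besOp r (a - n) η x) (fracPow r a η x) := by
  have hi : Integrable (fun ξ => (bes r a ξ : ℂ) * 𝓕 (η : Vec d → ℂ) ξ) := by
    refine (SchwartzMap.integrable (𝓕 (besOp r a η))).congr (.of_forall fun ξ => ?_)
    simp only
    rw [fourier_besOp hr, SchwartzMap.fourier_coe]
  have hm : Measurable fun ξ : Vec d => ((bes r a ξ : ℝ) : ℂ) :=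
    (hasTemperateGrowth_bes_complex hr a).1.continuous.measurable
  have hF : ∀ n : ℕ, Integrable (fun ξ => Complex.exp (↑(2 * Real.pi * inner ℝ ξ x) * Complex.I) *
      ((binomCoeff a n : ℂ) * ((bes r (a - n) ξ : ℂ) * 𝓕 (η : Vec d → ℂ) ξ))) ∧
      ∫ ξ, ‖Complex.exp (↑(2 * Real.pi * inner ℝ ξ x) * Complex.I) *
      ((binomCoeff a n : ℂ) * ((bes r (a - n) ξ : ℂ) * 𝓕 (η : Vec d → ℂ) ξ))‖ ≤
      |binomCoeff a n| * ∫ ξ, ‖(bes r a ξ : ℂ) * 𝓕 (η : Vec d → ℂ) ξ‖ := by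
    intro n
    have hin : Integrable (fun ξ => (bes r (a - n) ξ : ℂ) * 𝓕 (η : Vec d → ℂ) ξ) := by
      refine (SchwartzMap.integrable (𝓕 (besOp r (a - n) η))).congr (.of_forall fun ξ => ?_)
      simp only
      rw [fourier_besOp hr, SchwartzMap.fourier_coe]
    have hI : Integrable (fun ξ => Complex.exp (↑(2 * Real.pi * inner ℝ ξ x) * Complex.I) *
        ((binomCoeff a n : ℂ) * ((bes r (a - n) ξ : ℂ) * 𝓕 (η : Vec d → ℂ) ξ))) := by
      refine (hin.const_mul (binomCoeff a n : ℂ)).bdd_mul (c := 1)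
        (Continuous.aestronglyMeasurable (by fun_prop)) (.of_forall fun ξ => ?_)
      rw [Complex.norm_exp_ofReal_mul_I]
    refine ⟨hI, ?_⟩
    rw [← integral_const_mul]
    refine integral_mono hI.norm (hi.norm.const_mul _) fun ξ => ?_
    simp only [norm_mul, Complex.norm_exp_ofReal_mul_I, one_mul, Complex.norm_real,
      Real.norm_eq_abs, abs_of_pos (bes_pos hr.le _ ξ)]
    gcongr
    exact bes_sub_nat_le hr.le a n ξ
  have hs := hasSum_integral_of_summable_integral_norm (fun n => (hF n).1)
    (Summable.of_nonneg_of_le (fun n => by positivity) (fun n => (hF n).2)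
      ((summable_abs_binomCoeff ha).mul_right _))
  have e : fracPow r a η x = ∫ ξ, ∑' n : ℕ, Complex.exp (↑(2 * Real.pi * inner ℝ ξ x) * Complex.I) *
      ((binomCoeff a n : ℂ) * ((bes r (a - n) ξ : ℂ) * 𝓕 (η : Vec d → ℂ) ξ)) := by
    rw [fracPow, Real.fourierInv_eq']
    -- The pointwise expansion is available off the origin, a null set since d ≠ 0.
    have hne : ∀ᵐ ξ : Vec d, ξ ≠ 0 := by
      have : Nontrivial (Vec d) := inferInstance
      exact Measure.ae_ne volume 0
    refine integral_congr_ae ?_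
    filter_upwards [hne] with ξ hξ
    have h1 := (Complex.hasSum_ofReal.2 (hasSum_bes hr (a := a) hξ)).mul_right (𝓕 (η : Vec d → ℂ) ξ)
    have h2 := h1.mul_left (Complex.exp (↑(2 * Real.pi * inner ℝ ξ x) * Complex.I))
    rw [smul_eq_mul, ← h2.tsum_eq]
    refine tsum_congr fun n => ?_
    push_cast; ring
  rw [e]
  refine hasSum_of_eq hs fun n => ?_
  rw [besOp_eq_fourierInv hr, Real.fourierInv_eq', ← integral_const_mul]
  refine integral_congr_ae (.of_forall fun ξ => ?_)
  simp only [smul_eq_mul]; ring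

/-- With `integrable_fracPow` this puts the function in L¹ ∩ L^∞, the class on which a `PairBound`
acts. Both bounds sum the n-independent bounds for the Bessel potentials against |c_n|. -/
lemma norm_fracPow_le {r : ℝ} (hr : 0 < r) {a : ℝ} (ha : 0 < a) (η : 𝓢(Vec d, ℂ)) {S : ℝ}
    (hS : ∀ x, ‖besOp r a η x‖ ≤ S) (x : Vec d) :
    ‖fracPow r a η x‖ ≤ (∑' n, |binomCoeff a n|) * S := by
  have h := hasSum_besOp hr ha η x
  rw [← h.tsum_eq, ← tsum_mul_right]
  refine tsum_of_norm_bounded ((summable_abs_binomCoeff ha).mul_right S).hasSum fun n => ?_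
  rw [norm_mul, Complex.norm_real, Real.norm_eq_abs]
  exact mul_le_mul_of_nonneg_left (norm_besOp_sub_nat_le hr a η hS n x) (abs_nonneg _)

lemma integrable_fracPow {r : ℝ} (hr : 0 < r) {a : ℝ} (ha : 0 < a) (η : 𝓢(Vec d, ℂ)) :
    Integrable (fracPow r a η) ∧
      ∫ x, ‖fracPow r a η x‖ ≤ (∑' n, |binomCoeff a n|) * ∫ x, ‖besOp r a η x‖ := by
  have hm : AEStronglyMeasurable (fracPow r a η) volume := by
    refine aestronglyMeasurable_of_tendsto_ae atTop
      (f := fun N : ℕ => fun x => ∑ n ∈ Finset.range N, (binomCoeff a n : ℂ) * besOp r (a - n) η x)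
      (fun N => Continuous.aestronglyMeasurable (by fun_prop))
      (.of_forall fun x => (hasSum_besOp hr ha η x).tendsto_sum_nat)
  set I := ∫ x, ‖besOp r a η x‖
  have hl : ∫⁻ x, ‖fracPow r a η x‖ₑ ≤ ENNReal.ofReal ((∑' n, |binomCoeff a n|) * I) := by
    calc ∫⁻ x, ‖fracPow r a η x‖ₑ
        ≤ ∫⁻ x, ∑' n : ℕ, ‖(binomCoeff a n : ℂ) * besOp r (a - n) η x‖ₑ := by
          refine lintegral_mono fun x => ?_
          rw [← (hasSum_besOp hr ha η x).tsum_eq]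
          exact enorm_tsum_le_tsum_enorm
      _ = ∑' n : ℕ, ∫⁻ x, ‖(binomCoeff a n : ℂ) * besOp r (a - n) η x‖ₑ :=
          lintegral_tsum fun n => Continuous.aemeasurable (by fun_prop)
      _ ≤ ∑' n : ℕ, ENNReal.ofReal (|binomCoeff a n| * I) := by
          refine ENNReal.tsum_le_tsum fun n => ?_
          have hi := (SchwartzMap.integrable (μ := volume) (besOp r (a - n) η)).const_mul
            (binomCoeff a n : ℂ)
          rw [← ofReal_integral_norm_eq_lintegral_enorm hi]
          refine ENNReal.ofReal_le_ofReal ?_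
          simp_rw [norm_mul, Complex.norm_real, Real.norm_eq_abs]
          rw [integral_const_mul]
          exact mul_le_mul_of_nonneg_left (integral_norm_besOp_sub_nat_le hr a η n) (abs_nonneg _)
      _ = _ := by
          rw [← ENNReal.ofReal_tsum_of_nonneg (fun n => by positivity)
            ((summable_abs_binomCoeff ha).mul_right I), tsum_mul_right]
  have hi : Integrable (fracPow r a η) := ⟨hm, hl.trans_lt ENNReal.ofReal_lt_top⟩
  refine ⟨hi, ?_⟩
  rw [← ENNReal.ofReal_le_ofReal_iff (by positivity), ofReal_integral_norm_eq_lintegral_enorm hi]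
  exact hl

/-- Pairing with `w ∈ L¹ + L^∞` commutes with the series. -/
lemma PairBound.hasSum_fracPow {w : Vec d → ℂ} {A B : ℝ} (hw : PairBound w A B)
    {r : ℝ} (hr : 0 < r) {a : ℝ} (ha : 0 < a) (η : 𝓢(Vec d, ℂ)) :
    HasSum (fun n : ℕ => (binomCoeff a n : ℂ) * ∫ x, w x * besOp r (a - n) η x)
      (∫ x, w x * fracPow r a η x) := by
  obtain ⟨S, hS⟩ := exists_norm_le (besOp r a η)
  have hb := fun n : ℕ => hw.2 (besOp r (a - n) η) S (SchwartzMap.integrable _)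
    (norm_besOp_sub_nat_le hr a η hS n)
  have hA : ∀ n : ℕ, ∫ x, ‖w x * besOp r (a - n) η x‖ ≤ A * S + |B| * ∫ x, ‖besOp r a η x‖ := by
    intro n
    refine (hb n).2.trans ?_
    exact add_le_add le_rfl (mul_le_mul (le_abs_self B) (integral_norm_besOp_sub_nat_le hr a η n)
      (by positivity) (abs_nonneg B))
  have hs := hasSum_integral_of_summable_integral_norm
    (F := fun (n : ℕ) x => (binomCoeff a n : ℂ) * (w x * besOp r (a - n) η x))
    (fun n => (hb n).1.const_mul _) (by
      simp_rw [norm_mul _ (w _ * _), Complex.norm_real, Real.norm_eq_abs, integral_const_mul]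
      exact Summable.of_nonneg_of_le (fun n => by positivity)
        (fun n => mul_le_mul_of_nonneg_left (hA n) (abs_nonneg _))
        ((summable_abs_binomCoeff ha).mul_right _))
  have e : ∫ x, w x * fracPow r a η x =
      ∫ x, ∑' n : ℕ, (binomCoeff a n : ℂ) * (w x * besOp r (a - n) η x) := by
    refine integral_congr_ae (.of_forall fun x => ?_)
    simp only
    rw [← (hasSum_besOp hr ha η x).tsum_eq, ← tsum_mul_left]
    exact tsum_congr fun n => by ring
  rw [e]
  exact hasSum_of_eq hs fun n => (integral_const_mul _ _).symm

lemma PairBound.integrable_fracPow {w : Vec d → ℂ} {A B : ℝ} (hw : PairBound w A B)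
    {r : ℝ} (hr : 0 < r) {a : ℝ} (ha : 0 < a) (η : 𝓢(Vec d, ℂ)) :
    Integrable (fun x => w x * fracPow r a η x) := by
  obtain ⟨S, hS⟩ := exists_norm_le (besOp r a η)
  exact hw.integrable (FracStokes.integrable_fracPow hr ha η).1 (norm_fracPow_le hr ha η hS)

end

section

open Filter Topology

variable {d : ℕ}

/-! ### Homogeneous kernels -/

/-- Cut at the unit sphere: |x|^(-β) is integrable inside since β < d, and at most 1 outside since β
≥ 0. -/
lemma pairBound_of_norm_le_rpow [NeZero d] {h : Vec d → ℂ} (hm : AEStronglyMeasurable h volume)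
    {C β : ℝ} (hC : 0 ≤ C) (hβ : 0 ≤ β) (hβd : β < d) (hb : ∀ᵐ x, ‖h x‖ ≤ C * ‖x‖ ^ (-β)) :
    ∃ A, PairBound h A C := by
  have hd : Module.finrank ℝ (Vec d) = d := by simp
  have h1 : 1 ≤ Module.finrank ℝ (Vec d) := by rw [hd]; exact Nat.one_le_iff_ne_zero.2 (NeZero.ne d)
  have hi := integrableOn_ball_of_norm_le_rpow (μ := volume) h1 (r := 1) (by rw [hd]; exact hβd)
    (ae_restrict_of_ae hb) hm
  have e : h = (Metric.ball 0 1).indicator h + (Metric.ball 0 1)ᶜ.indicator h :=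
    (Set.indicator_self_add_compl _ _).symm
  refine ⟨∫ x, ‖(Metric.ball 0 1).indicator h x‖, ?_⟩
  suffices hs : ∀ᵐ x, ‖(Metric.ball (0 : Vec d) 1)ᶜ.indicator h x‖ ≤ C by
    have := pairBound_add (hi.integrable_indicator measurableSet_ball)
      (hm.indicator measurableSet_ball.compl) hs
    rwa [← e] at this
  filter_upwards [hb] with x hx
  by_cases hx1 : x ∈ Metric.ball (0 : Vec d) 1
  · rw [Set.indicator_of_notMem (by simpa using hx1)]; simpa using hC
  · rw [Set.indicator_of_mem (by exact hx1)]
    refine hx.trans (mul_le_of_le_one_right hC ?_)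
    refine Real.rpow_le_one_of_one_le_of_nonpos ?_ (by linarith)
    simpa using hx1

lemma PairBound.integrable_schwartz {w : Vec d → ℂ} {A B : ℝ} (hw : PairBound w A B)
    (η : 𝓢(Vec d, ℂ)) : Integrable (fun x => w x * η x) :=
  hw.integrable (SchwartzMap.integrable η) (exists_norm_le η).choose_spec

/-! ### Gaussian subordination -/

/-- The Gaussian `exp (-π t |x|²)`. -/
def gauss (t : ℝ) (x : Vec d) : ℝ := Real.exp (-(Real.pi * ‖x‖ ^ 2 * t))

lemma continuous_gauss (t : ℝ) : Continuous (gauss (d := d) t) := by unfold gauss; fun_prop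

lemma gauss_pos (t : ℝ) (x : Vec d) : 0 < gauss t x := Real.exp_pos _

lemma gauss_le_one {t : ℝ} (ht : 0 ≤ t) (x : Vec d) : gauss t x ≤ 1 := by
  rw [gauss, Real.exp_le_one_iff]
  have : 0 ≤ Real.pi * ‖x‖ ^ 2 * t := by positivity
  linarith

lemma pairBound_gauss {t : ℝ} (ht : 0 ≤ t) :
    PairBound (fun x : Vec d => (gauss t x : ℂ)) (∫ _ : Vec d, ‖(0 : ℂ)‖) 1 := by
  have h := pairBound_add (d := d) (g := 0) (h := fun x : Vec d => (gauss t x : ℂ)) (B := 1)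
    (integrable_zero _ _ _) (by have := continuous_gauss (d := d) t; fun_prop) (.of_forall fun x => by
      rw [Complex.norm_real, Real.norm_eq_abs, abs_of_pos (gauss_pos t x)]
      exact gauss_le_one ht x)
  rwa [zero_add] at h

/-- Integrating Gaussians in the scale parameter yields homogeneous functions. -/
lemma gauss_subordination [NeZero d] {p : ℝ} (hp : 0 < p) {h : Vec d → ℂ}
    (hm : AEStronglyMeasurable h volume)
    (hi : Integrable (fun x => ((‖x‖ ^ (-(2 * p)) : ℝ) : ℂ) * h x)) :
    Integrable (fun t : ℝ => ((t ^ (p - 1) : ℝ) : ℂ) * ∫ x, (gauss t x : ℂ) * h x)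
      (volume.restrict (Set.Ioi 0)) ∧
    ∫ t in Set.Ioi 0, ((t ^ (p - 1) : ℝ) : ℂ) * ∫ x, (gauss t x : ℂ) * h x =
      ((Real.Gamma p * Real.pi ^ (-p) : ℝ) : ℂ) * ∫ x, ((‖x‖ ^ (-(2 * p)) : ℝ) : ℂ) * h x := by
  have hne : ∀ᵐ x : Vec d, x ≠ 0 := by
    have : Nontrivial (Vec d) := inferInstance
    exact Measure.ae_ne volume 0
  have hval : ∀ x : Vec d, x ≠ 0 → ∫ t in Set.Ioi (0 : ℝ), t ^ (p - 1) * gauss t x =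
      Real.Gamma p * Real.pi ^ (-p) * ‖x‖ ^ (-(2 * p)) := by
    intro x hx
    have hx' : 0 < ‖x‖ := norm_pos_iff.2 hx
    have h1 := Real.integral_rpow_mul_exp_neg_mul_Ioi hp (r := Real.pi * ‖x‖ ^ 2) (by positivity)
    simp only [gauss]
    rw [h1, one_div, Real.inv_rpow (by positivity), ← Real.rpow_neg (by positivity),
      Real.mul_rpow (by positivity) (by positivity), ← Real.rpow_natCast, ← Real.rpow_mul hx'.le]
    push_cast
    rw [show (2 : ℝ) * -p = -(2 * p) by ring]
    ring
  have hintt : ∀ x : Vec d, x ≠ 0 → Integrable (fun t : ℝ => t ^ (p - 1) * gauss t x)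
      (volume.restrict (Set.Ioi 0)) := by
    intro x hx
    -- The integral of a nonintegrable function is 0 by convention, whereas the value in `hval` is
    -- positive.
    by_contra hcon
    have := hval x hx
    rw [integral_undef hcon] at this
    have h2 : 0 < Real.Gamma p * Real.pi ^ (-p) * ‖x‖ ^ (-(2 * p)) := by
      have hx' : 0 < ‖x‖ := norm_pos_iff.2 hx
      have := Real.Gamma_pos_of_pos hp
      positivity
    linarith
  have hgm : Measurable fun z : ℝ × Vec d => (((z.1 ^ (p - 1) * gauss z.1 z.2 : ℝ)) : ℂ) := by
    unfold gauss; fun_prop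
  have hprod : Integrable (fun z : ℝ × Vec d => ((z.1 ^ (p - 1) * gauss z.1 z.2 : ℝ) : ℂ) * h z.2)
      ((volume.restrict (Set.Ioi 0)).prod volume) := by
    have hmeas : AEStronglyMeasurable
        (fun z : ℝ × Vec d => ((z.1 ^ (p - 1) * gauss z.1 z.2 : ℝ) : ℂ) * h z.2)
        ((volume.restrict (Set.Ioi 0)).prod volume) :=
      hgm.aestronglyMeasurable.mul hm.comp_snd
    rw [integrable_prod_iff' hmeas]
    refine ⟨?_, ?_⟩
    · filter_upwards [hne] with x hx
      exact (hintt x hx).ofReal.mul_const _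
    · refine (hi.norm.const_mul (Real.Gamma p * Real.pi ^ (-p))).congr ?_
      filter_upwards [hne] with x hx
      simp only [norm_mul _ (h x), Complex.norm_real, Real.norm_eq_abs]
      rw [integral_mul_const, abs_of_nonneg (by positivity), ← mul_assoc, ← hval x hx]
      congr 1
      refine setIntegral_congr_fun measurableSet_Ioi fun t ht => ?_
      have h1 := gauss_pos t x
      have h2 : (0 : ℝ) < t := ht
      exact (abs_of_nonneg (by positivity)).symm
  have e : ∀ t : ℝ, ((t ^ (p - 1) : ℝ) : ℂ) * ∫ x, (gauss t x : ℂ) * h x =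
      ∫ x, ((t ^ (p - 1) * gauss t x : ℝ) : ℂ) * h x := by
    intro t
    rw [← integral_const_mul]
    refine integral_congr_ae (.of_forall fun x => ?_)
    push_cast; ring
  simp_rw [e]
  refine ⟨hprod.integral_prod_left, ?_⟩
  rw [integral_integral_swap hprod, ← integral_const_mul]
  refine integral_congr_ae ?_
  filter_upwards [hne] with x hx
  rw [integral_mul_const, integral_complex_ofReal, hval x hx]
  push_cast; ring

/-! ### Gaussian moments of Schwartz functions -/

/-- Multiplication by the `c`-th coordinate. -/
def coordMul (c : Fin d) : 𝓢(Vec d, ℂ) →L[ℂ] 𝓢(Vec d, ℂ) :=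
  SchwartzMap.smulLeftCLM ℂ fun x : Vec d => ((x c : ℝ) : ℂ)

lemma hasTemperateGrowth_coord (c : Fin d) :
    Function.HasTemperateGrowth fun x : Vec d => ((x c : ℝ) : ℂ) :=
  Function.HasTemperateGrowth.comp Function.Complex.hasTemperateGrowth_ofReal
    (EuclideanSpace.proj (𝕜 := ℝ) c : Vec d →L[ℝ] ℝ).hasTemperateGrowth

lemma coordMul_apply (c : Fin d) (φ : 𝓢(Vec d, ℂ)) (x : Vec d) :
    coordMul c φ x = (x c : ℂ) * φ x := by
  rw [coordMul, SchwartzMap.smulLeftCLM_apply_apply (hasTemperateGrowth_coord c), smul_eq_mul]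

/-- The partial derivative of a Schwartz function. -/
def partialD (c : Fin d) : 𝓢(Vec d, ℂ) →L[ℂ] 𝓢(Vec d, ℂ) :=
  LineDeriv.lineDerivOpCLM ℂ 𝓢(Vec d, ℂ) (EuclideanSpace.single c (1 : ℝ))

lemma partialD_eq (c : Fin d) (φ : 𝓢(Vec d, ℂ)) :
    partialD c φ = LineDeriv.lineDerivOp (EuclideanSpace.single c (1 : ℝ)) φ := rfl

lemma partialD_apply (c : Fin d) (φ : 𝓢(Vec d, ℂ)) (x : Vec d) :
    partialD c φ x = fderiv ℝ φ x (EuclideanSpace.single c 1) :=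
  SchwartzMap.lineDerivOp_apply_eq_fderiv _ _ _

lemma fourierInv_partialD (c : Fin d) (φ : 𝓢(Vec d, ℂ)) (ξ : Vec d) :
    𝓕⁻ (partialD c φ : Vec d → ℂ) ξ = -(2 * Real.pi * Complex.I) * (ξ c : ℂ) *
      𝓕⁻ (φ : Vec d → ℂ) ξ := by
  have h := SchwartzMap.fourierInv_lineDerivOp_eq φ (EuclideanSpace.single c (1 : ℝ))
  have h2 := congrArg (fun f : 𝓢(Vec d, ℂ) => f ξ) h
  simp only [SchwartzMap.fourierInv_coe] at h2
  rw [partialD_eq, h2]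
  rw [smul_apply, SchwartzMap.smulLeftCLM_apply_apply
    (Function.hasTemperateGrowth_inner_left _), SchwartzMap.fourierInv_coe]
  simp [EuclideanSpace.inner_single_right]
  ring

lemma coordMul_partialD (a b : Fin d) (φ : 𝓢(Vec d, ℂ)) :
    coordMul a (partialD b φ) = partialD b (coordMul a φ) - (kron a b : ℂ) • φ := by
  ext x
  have h : HasFDerivAt (coordMul a φ)
      (((x a : ℝ) : ℂ) • fderiv ℝ φ x + ((Complex.ofRealCLM ∘L
        (EuclideanSpace.proj (𝕜 := ℝ) a : Vec d →L[ℝ] ℝ)).smulRight (φ x))) x := by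
    have h1 := (SchwartzMap.hasFDerivAt φ x)
    have h2 : HasFDerivAt (fun x : Vec d => ((x a : ℝ) : ℂ)) (Complex.ofRealCLM ∘L
        (EuclideanSpace.proj (𝕜 := ℝ) a : Vec d →L[ℝ] ℝ)) x :=
      (Complex.ofRealCLM ∘L (EuclideanSpace.proj (𝕜 := ℝ) a : Vec d →L[ℝ] ℝ)).hasFDerivAt
    have h3 := h2.smul h1
    have e : (coordMul a φ : Vec d → ℂ) = fun x => ((x a : ℝ) : ℂ) • φ x := by
      ext x; rw [coordMul_apply, smul_eq_mul]
    rw [e]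
    exact h3
  rw [sub_apply, smul_apply, coordMul_apply, partialD_apply, partialD_apply,
    h.fderiv]
  by_cases hab : a = b
  · subst hab; simp [kron]
  · simp [kron, hab]

/-- Integration by parts: D_c of the Gaussian is -2πs x_c times the Gaussian, and the two minus
signs cancel. -/
lemma integral_gauss_partialD {s : ℝ} (hs : 0 ≤ s) (c : Fin d) (φ : 𝓢(Vec d, ℂ)) :
    ∫ x, (gauss s x : ℂ) * partialD c φ x =
      ((2 * Real.pi * s : ℝ) : ℂ) * ∫ x, (gauss s x : ℂ) * coordMul c φ x := by
  have hd : ∀ x : Vec d, HasFDerivAt (fun x => (gauss s x : ℂ))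
      (((gauss s x : ℝ) : ℂ) • (-(2 * Real.pi * s : ℝ) • (Complex.ofRealCLM ∘L innerSL ℝ x))) x := by
    intro x
    have h1 : HasFDerivAt (fun x : Vec d => -(Real.pi * ‖x‖ ^ 2 * s))
        (-(2 * Real.pi * s) • innerSL ℝ x) x := by
      have := (((hasStrictFDerivAt_norm_sq x).hasFDerivAt.const_mul Real.pi).mul_const s).neg
      refine this.congr_fderiv ?_
      ext v; simp; ring
    have h2 := (Complex.ofRealCLM.hasFDerivAt (x := gauss s x)).comp x h1.exp
    refine h2.congr_fderiv ?_
    ext v; simp [gauss]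
  have hE := pairBound_gauss (d := d) hs
  have h := integral_bilinear_hasLineDerivAt_right_eq_neg_left_of_integrable (μ := volume)
    (f := fun x : Vec d => (gauss s x : ℂ))
    (f' := fun x => -((2 * Real.pi * s : ℝ) : ℂ) * ((gauss s x : ℂ) * (x c : ℂ)))
    (g := φ) (g' := partialD c φ) (v := EuclideanSpace.single c (1 : ℝ))
    (B := ContinuousLinearMap.mul ℝ ℂ) ?_ ?_ ?_ ?_ ?_
  · simp only [ContinuousLinearMap.mul_apply'] at h
    rw [h, ← integral_const_mul, ← integral_neg]
    refine integral_congr_ae (.of_forall fun x => ?_)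
    simp only [coordMul_apply]; ring
  · simp only [ContinuousLinearMap.mul_apply']
    refine ((hE.integrable_schwartz (coordMul c φ)).const_mul
      (-((2 * Real.pi * s : ℝ) : ℂ))).congr (.of_forall fun x => ?_)
    simp only [coordMul_apply]; ring
  · exact hE.integrable_schwartz _
  · exact hE.integrable_schwartz _
  · intro x _
    have := (hd x).hasLineDerivAt (EuclideanSpace.single c (1 : ℝ))
    convert this using 1
    simp [EuclideanSpace.inner_single_right]
    ring
  · intro x _
    rw [partialD_apply]
    exact (SchwartzMap.hasFDerivAt φ x).hasLineDerivAt _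

lemma integral_gauss_sub {s : ℝ} (hs : 0 ≤ s) (φ ψ : 𝓢(Vec d, ℂ)) (c : ℂ) :
    ∫ x, (gauss s x : ℂ) * (φ - c • ψ) x =
      (∫ x, (gauss s x : ℂ) * φ x) - c * ∫ x, (gauss s x : ℂ) * ψ x := by
  rw [← integral_const_mul, ← integral_sub ((pairBound_gauss hs).integrable_schwartz φ)
    (((pairBound_gauss hs).integrable_schwartz ψ).const_mul c)]
  refine integral_congr_ae (.of_forall fun x => ?_)
  simp only [sub_apply, smul_apply, smul_eq_mul]; ring

/-- Each derivative moved onto the Gaussian produces 2πs times a coordinate, and commuting that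
coordinate past the remaining derivatives leaves Kronecker deltas. The result is the third Hermite
polynomial of the Gaussian. -/
lemma integral_gauss_partialD₃ {s : ℝ} (hs : 0 ≤ s) (a b c : Fin d) (φ : 𝓢(Vec d, ℂ)) :
    ∫ x, (gauss s x : ℂ) * partialD a (partialD b (partialD c φ)) x =
      ((2 * Real.pi * s : ℝ) : ℂ) ^ 3 *
        (∫ x, (gauss s x : ℂ) * coordMul a (coordMul b (coordMul c φ)) x) -
      ((2 * Real.pi * s : ℝ) : ℂ) ^ 2 *
        ((kron b c : ℂ) * (∫ x, (gauss s x : ℂ) * coordMul a φ x) +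
          (kron a c : ℂ) * (∫ x, (gauss s x : ℂ) * coordMul b φ x) +
          (kron a b : ℂ) * (∫ x, (gauss s x : ℂ) * coordMul c φ x)) := by
  rw [integral_gauss_partialD hs, coordMul_partialD, integral_gauss_sub hs,
    integral_gauss_partialD hs, integral_gauss_partialD hs, coordMul_partialD, map_sub, map_smul,
    integral_gauss_sub hs, coordMul_partialD, integral_gauss_sub hs, integral_gauss_partialD hs]
  have e : coordMul c (coordMul b (coordMul a φ)) = coordMul a (coordMul b (coordMul c φ)) := by
    ext x; simp only [coordMul_apply]; ring
  rw [e]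
  ring

end

section

open Filter Topology

variable {d : ℕ}

/-! ### The inverse Fourier transform of the symbol -/

lemma fourier_gauss {s : ℝ} (hs : 0 < s) (ξ : Vec d) :
    𝓕 (fun x : Vec d => (gauss s x : ℂ)) ξ =
      ((s ^ (-((d : ℝ) / 2)) : ℝ) : ℂ) * (gauss s⁻¹ ξ : ℂ) := by
  have h := fourier_gaussian_innerProductSpace (V := Vec d) (b := ((Real.pi * s : ℝ) : ℂ))
    (by rw [Complex.ofReal_re]; positivity) ξ
  have e : (fun v : Vec d => Complex.exp (-((Real.pi * s : ℝ) : ℂ) * (‖v‖ : ℂ) ^ 2)) =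
      fun x : Vec d => (gauss s x : ℂ) := by
    ext v; simp only [gauss]; push_cast; congr 1; ring
  rw [e] at h
  rw [h]
  congr 1
  · rw [← Complex.ofReal_div, div_mul_cancel_left₀ Real.pi_ne_zero, finrank_euclideanSpace,
      Fintype.card_fin, Real.rpow_neg hs.le, ← Real.inv_rpow hs.le, Complex.ofReal_cpow (by positivity)]
    push_cast; rfl
  · simp only [gauss]; push_cast; congr 1
    have : (s : ℂ) ≠ 0 := by exact_mod_cast hs.ne'
    have : (Real.pi : ℂ) ≠ 0 := by exact_mod_cast Real.pi_ne_zero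
    field_simp

lemma integrable_gauss {s : ℝ} (hs : 0 < s) : Integrable (fun x : Vec d => (gauss s x : ℂ)) := by
  have := GaussianFourier.integrable_cexp_neg_mul_sq_norm_add (V := Vec d)
    (b := ((Real.pi * s : ℝ) : ℂ)) (by rw [Complex.ofReal_re]; positivity) 0 0
  refine this.congr (.of_forall fun x => ?_)
  simp only [gauss]; push_cast; congr 1; simp; ring

/-- The multiplication formula ∫ f̂ g = ∫ f ĝ for f the Gaussian of scale s and g = φ^∨, with the
factor s^(-d/2) of the transformed Gaussian moved to the other side. -/
lemma integral_gauss_fourierInv {s : ℝ} (hs : 0 < s) (φ : 𝓢(Vec d, ℂ)) :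
    ∫ ξ, (gauss s⁻¹ ξ : ℂ) * 𝓕⁻ (φ : Vec d → ℂ) ξ =
      ((s ^ ((d : ℝ) / 2) : ℝ) : ℂ) * ∫ x, (gauss s x : ℂ) * φ x := by
  have h : ∫ ξ, 𝓕 (fun x : Vec d => (gauss s x : ℂ)) ξ • (𝓕⁻ φ : 𝓢(Vec d, ℂ)) ξ =
      ∫ x, (gauss s x : ℂ) • 𝓕 ((𝓕⁻ φ : 𝓢(Vec d, ℂ)) : Vec d → ℂ) x := by
    simpa using! VectorFourier.integral_fourierIntegral_smul_eq_flip (L := innerₗ (Vec d))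
      Real.continuous_fourierChar continuous_inner (integrable_gauss hs)
      (SchwartzMap.integrable (𝓕⁻ φ : 𝓢(Vec d, ℂ)))
  have e : 𝓕 ((𝓕⁻ φ : 𝓢(Vec d, ℂ)) : Vec d → ℂ) = φ := by
    rw [← SchwartzMap.fourier_coe]; simp
  rw [e] at h
  simp only [smul_eq_mul, fourier_gauss hs, SchwartzMap.fourierInv_coe] at h
  rw [← h, ← integral_const_mul]
  refine integral_congr_ae (.of_forall fun ξ => ?_)
  simp only
  rw [← mul_assoc, ← mul_assoc, ← Complex.ofReal_mul, ← Real.rpow_add hs]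
  simp

/-- The cubic numerator of the symbol. -/
def cubic (j k l : Fin d) (x : Vec d) : ℝ := x l * (kron j k * ‖x‖ ^ 2 - x j * x k)

/-- The trace part of the third derivatives of a Gaussian. -/
def linearPart (j k l : Fin d) (x : Vec d) : ℝ :=
  kron j k * (d + 1) * x l - kron l j * x k - kron l k * x j

lemma norm_sq_eq (x : Vec d) : ‖x‖ ^ 2 = ∑ i, x i * x i := by
  rw [EuclideanSpace.norm_sq_eq]; simp [sq]

/-- `coordMul` cubed, combined into multiplication by `cubic`. -/
def cubicMul (j k l : Fin d) (φ : 𝓢(Vec d, ℂ)) : 𝓢(Vec d, ℂ) :=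
  (kron j k : ℂ) • (∑ i, coordMul l (coordMul i (coordMul i φ))) -
    coordMul l (coordMul j (coordMul k φ))

lemma cubicMul_apply (j k l : Fin d) (φ : 𝓢(Vec d, ℂ)) (x : Vec d) :
    cubicMul j k l φ x = (cubic j k l x : ℂ) * φ x := by
  simp only [cubicMul, sub_apply, smul_apply, sum_apply, coordMul_apply,
    smul_eq_mul, cubic, norm_sq_eq]
  push_cast
  rw [← Finset.mul_sum]
  have : ∑ i, (x i : ℂ) * ((x i : ℂ) * φ x) = (∑ i, (x i : ℂ) * (x i : ℂ)) * φ x := by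
    rw [Finset.sum_mul]; exact Finset.sum_congr rfl fun i _ => by ring
  rw [this]; ring

/-- Multiplication by `linearPart`. -/
def linearMul (j k l : Fin d) (φ : 𝓢(Vec d, ℂ)) : 𝓢(Vec d, ℂ) :=
  ((kron j k * (d + 1) : ℝ) : ℂ) • coordMul l φ - (kron l j : ℂ) • coordMul k φ -
    (kron l k : ℂ) • coordMul j φ

lemma linearMul_apply (j k l : Fin d) (φ : 𝓢(Vec d, ℂ)) (x : Vec d) :
    linearMul j k l φ x = (linearPart j k l x : ℂ) * φ x := by
  simp only [linearMul, sub_apply, smul_apply, coordMul_apply,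
    smul_eq_mul, linearPart]
  push_cast; ring

/-- The third order differential operator with symbol proportional to `cubic`. -/
def cubicDeriv (j k l : Fin d) (φ : 𝓢(Vec d, ℂ)) : 𝓢(Vec d, ℂ) :=
  (kron j k : ℂ) • (∑ i, partialD l (partialD i (partialD i φ))) -
    partialD l (partialD j (partialD k φ))

lemma fourierInv_sub_smul_sum {ι : Type*} (s : Finset ι) (f : ι → 𝓢(Vec d, ℂ)) (g : 𝓢(Vec d, ℂ))
    (c : ℂ) (ξ : Vec d) : 𝓕⁻ ((c • (∑ i ∈ s, f i) - g : 𝓢(Vec d, ℂ)) : Vec d → ℂ) ξ =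
      c * (∑ i ∈ s, 𝓕⁻ (f i : Vec d → ℂ) ξ) - 𝓕⁻ (g : Vec d → ℂ) ξ := by
  have h : (𝓕⁻ (c • (∑ i ∈ s, f i) - g) : 𝓢(Vec d, ℂ)) =
      c • (∑ i ∈ s, (𝓕⁻ (f i) : 𝓢(Vec d, ℂ))) - 𝓕⁻ g := by
    have := map_sub (FourierTransform.fourierInvCLM ℂ 𝓢(Vec d, ℂ)) (c • (∑ i ∈ s, f i)) g
    rw [map_smul, map_sum] at this
    exact this
  have h2 := congrArg (fun f : 𝓢(Vec d, ℂ) => f ξ) h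
  simpa [SchwartzMap.fourierInv_coe] using h2

/-- Three derivatives contribute (-2πi)³ = 8π³ i. -/
lemma fourierInv_cubicDeriv (j k l : Fin d) (φ : 𝓢(Vec d, ℂ)) (ξ : Vec d) :
    𝓕⁻ (cubicDeriv j k l φ : Vec d → ℂ) ξ =
      (8 * Real.pi ^ 3 * Complex.I) * ((cubic j k l ξ : ℂ) * 𝓕⁻ (φ : Vec d → ℂ) ξ) := by
  rw [cubicDeriv, fourierInv_sub_smul_sum]
  simp only [fourierInv_partialD, cubic, norm_sq_eq]
  push_cast
  have : ∑ i, -(2 * (Real.pi : ℂ) * Complex.I) * (ξ l : ℂ) * (-(2 * Real.pi * Complex.I) * (ξ i : ℂ) *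
      (-(2 * Real.pi * Complex.I) * (ξ i : ℂ) * 𝓕⁻ (φ : Vec d → ℂ) ξ)) =
      (-(2 * Real.pi * Complex.I)) ^ 3 * (ξ l : ℂ) * (∑ i, (ξ i : ℂ) * (ξ i : ℂ)) *
        𝓕⁻ (φ : Vec d → ℂ) ξ := by
    rw [Finset.mul_sum, Finset.sum_mul]
    exact Finset.sum_congr rfl fun i _ => by ring
  rw [this]
  have hI : Complex.I ^ 3 = - Complex.I := by rw [pow_succ, Complex.I_sq]; ring
  ring_nf
  rw [hI]; ring

/-- Contract the formula for third derivatives. In D_l Δ the deltas add up to (d + 2) x_l, and D_l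
D_j D_k removes one δ_jk x_l; this explains the factor d + 1 in `linearPart`. -/
lemma integral_gauss_cubicDeriv {s : ℝ} (hs : 0 ≤ s) (j k l : Fin d) (φ : 𝓢(Vec d, ℂ)) :
    ∫ x, (gauss s x : ℂ) * cubicDeriv j k l φ x =
      ((2 * Real.pi * s : ℝ) : ℂ) ^ 3 * (∫ x, (gauss s x : ℂ) * cubicMul j k l φ x) -
      ((2 * Real.pi * s : ℝ) : ℂ) ^ 2 * (∫ x, (gauss s x : ℂ) * linearMul j k l φ x) := by
  have hint : ∀ ψ : 𝓢(Vec d, ℂ), Integrable fun x => (gauss s x : ℂ) * ψ x :=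
    (pairBound_gauss hs).integrable_schwartz
  let T : 𝓢(Vec d, ℂ) →ₗ[ℂ] ℂ :=
    { toFun := fun ψ => ∫ x, (gauss s x : ℂ) * ψ x
      map_add' := fun φ ψ => by
        simp only [add_apply, mul_add]; exact integral_add (hint φ) (hint ψ)
      map_smul' := fun c ψ => by
        simp only [smul_apply, smul_eq_mul, RingHom.id_apply]
        rw [← integral_const_mul]; congr 1; ext x; ring }
  have h3 : ∀ a b c, T (partialD a (partialD b (partialD c φ))) = _ :=
    fun a b c => integral_gauss_partialD₃ hs a b c φ
  change T _ = _ * T _ - _ * T _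
  have hT : ∀ ψ, (∫ x, (gauss s x : ℂ) * ψ x) = T ψ := fun ψ => rfl
  simp only [hT] at h3
  have hk : ∑ i, (kron l i : ℂ) * T (coordMul i φ) = T (coordMul l φ) := by
    rw [Finset.sum_eq_single l (fun i _ h => by simp [kron, h.symm]) (by simp)]
    simp [kron]
  have hk' : ∀ i : Fin d, (kron i i : ℂ) = 1 := fun i => by simp [kron]
  simp only [cubicDeriv, cubicMul, linearMul, map_sub, map_smul, map_sum, smul_eq_mul, h3,
    Finset.sum_sub_distrib, ← Finset.mul_sum, Finset.sum_add_distrib, hk, hk', one_mul,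
    Finset.sum_const, Finset.card_univ, Fintype.card_fin, nsmul_eq_mul]
  push_cast
  ring

end

/-! ### Homogeneity and size of the symbol and the kernel -/

section

open Filter Topology

variable {d : ℕ}

lemma abs_coord_le (x : Vec d) (i : Fin d) : |x i| ≤ ‖x‖ := PiLp.norm_apply_le x i

lemma abs_kron_le (j k : Fin d) : |kron j k| ≤ 1 := by unfold kron; split_ifs <;> simp

lemma abs_cubic_le (j k l : Fin d) (x : Vec d) : |cubic j k l x| ≤ 2 * ‖x‖ ^ 3 := by
  have h1 : |kron j k * ‖x‖ ^ 2 - x j * x k| ≤ 2 * ‖x‖ ^ 2 := by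
    refine (abs_sub _ _).trans ?_
    rw [abs_mul, abs_mul, abs_of_nonneg (by positivity : (0 : ℝ) ≤ ‖x‖ ^ 2)]
    nlinarith [mul_le_mul (abs_coord_le x j) (abs_coord_le x k) (abs_nonneg _) (norm_nonneg x),
      mul_le_mul_of_nonneg_right (abs_kron_le j k) (sq_nonneg ‖x‖)]
  rw [cubic, abs_mul]
  calc _ ≤ ‖x‖ * (2 * ‖x‖ ^ 2) :=
        mul_le_mul (abs_coord_le x l) h1 (abs_nonneg _) (norm_nonneg x)
    _ = _ := by ring

lemma abs_linearPart_le (j k l : Fin d) (x : Vec d) : |linearPart j k l x| ≤ (d + 3) * ‖x‖ := by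
  have h : ∀ (a b i : Fin d), |kron a b * x i| ≤ ‖x‖ := fun a b i => by
    rw [abs_mul]
    calc _ ≤ 1 * ‖x‖ := mul_le_mul (abs_kron_le a b) (abs_coord_le x i) (abs_nonneg _) zero_le_one
      _ = _ := one_mul _
  have h1 : |kron j k * (d + 1) * x l| ≤ (d + 1) * ‖x‖ := by
    rw [show kron j k * ((d : ℝ) + 1) * x l = (d + 1) * (kron j k * x l) by ring, abs_mul,
      abs_of_nonneg (by positivity : (0 : ℝ) ≤ (d : ℝ) + 1)]
    exact mul_le_mul_of_nonneg_left (h _ _ _) (by positivity)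
  rw [linearPart]
  refine (abs_sub _ _).trans ?_
  have h2 := abs_sub (kron j k * (d + 1) * x l) (kron l j * x k)
  have h3 := h l j k
  have h4 := h l k j
  linarith

lemma continuous_coord (i : Fin d) : Continuous fun x : Vec d => x i := by fun_prop

lemma measurable_cubic (j k l : Fin d) : Measurable (cubic j k l) := by
  unfold cubic
  have := fun i : Fin d => (continuous_coord i).measurable
  fun_prop

lemma measurable_linearPart (j k l : Fin d) : Measurable (linearPart j k l) := by
  unfold linearPart
  have := fun i : Fin d => (continuous_coord i).measurable
  fun_prop

/-- The constant in front of the kernel. -/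
def kernelConst (d : ℕ) (α : ℝ) : ℝ :=
  Real.Gamma (1 + d / 2 - α) /
      ((2 : ℝ) ^ (2 * α) * Real.pi ^ ((d : ℝ) / 2) * Real.Gamma (1 + α))

/-- The form needed for subordination: a pure power of |ξ| times a polynomial. At ξ = 0 both sides
are 0. -/
lemma symbol_eq (α : ℝ) (j k l : Fin d) (ξ : Vec d) :
    symbol α j k l ξ = (((2 * Real.pi) ^ (1 - 2 * α) : ℝ) : ℂ) * Complex.I *
      (((‖ξ‖ ^ (-(2 * (α + 1))) : ℝ) : ℂ) * (cubic j k l ξ : ℂ)) := by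
  by_cases hξ : ξ = 0
  · subst hξ; simp [symbol, cubic]
  have hx : 0 < ‖ξ‖ := norm_pos_iff.2 hξ
  have h1 : (2 * Real.pi * ‖ξ‖) ^ (2 * α) = (2 * Real.pi) ^ (2 * α) * ‖ξ‖ ^ (2 * α) :=
    Real.mul_rpow (by positivity) hx.le
  have h2 : ‖ξ‖ ^ (-(2 * (α + 1))) = (‖ξ‖ ^ (2 * α))⁻¹ * (‖ξ‖ ^ 2)⁻¹ := by
    rw [← Real.rpow_neg hx.le, ← Real.rpow_natCast, ← Real.rpow_neg hx.le, ← Real.rpow_add hx]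
    congr 1; push_cast; ring
  have h3 : (2 * Real.pi) ^ (1 - 2 * α) = 2 * Real.pi * ((2 * Real.pi) ^ (2 * α))⁻¹ := by
    rw [sub_eq_add_neg, Real.rpow_add (by positivity), Real.rpow_one, Real.rpow_neg (by positivity)]
  have h4 : (((2 * Real.pi) ^ (2 * α) : ℝ) : ℂ) ≠ 0 := by
    exact_mod_cast (by positivity : (0 : ℝ) < (2 * Real.pi) ^ (2 * α)).ne'
  have h5 : ((‖ξ‖ ^ (2 * α) : ℝ) : ℂ) ≠ 0 := by
    exact_mod_cast (by positivity : (0 : ℝ) < ‖ξ‖ ^ (2 * α)).ne'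
  have h6 : ((‖ξ‖ : ℝ) : ℂ) ≠ 0 := by exact_mod_cast hx.ne'
  rw [symbol, h1, h2, h3, cubic]
  push_cast
  set X := ((‖ξ‖ ^ (2 * α) : ℝ) : ℂ)
  set Y := (((2 * Real.pi) ^ (2 * α) : ℝ) : ℂ)
  field_simp

lemma hasFDerivAt_norm_rpow' (b : ℝ) {x : Vec d} (hx : x ≠ 0) :
    HasFDerivAt (fun y : Vec d => ‖y‖ ^ b) ((b * ‖x‖ ^ (b - 2)) • innerSL ℝ x) x := by
  have hx' : 0 < ‖x‖ := norm_pos_iff.2 hx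
  have h := ((hasStrictFDerivAt_norm_sq x).hasFDerivAt).rpow_const (p := b / 2)
    (Or.inl (by positivity))
  have e : (fun y : Vec d => (‖y‖ ^ 2) ^ (b / 2)) = fun y => ‖y‖ ^ b := by
    ext y
    rw [← Real.rpow_natCast, ← Real.rpow_mul (norm_nonneg _)]
    congr 1; push_cast; ring
  rw [e] at h
  refine h.congr_fderiv ?_
  have : (‖x‖ ^ 2) ^ (b / 2 - 1) = ‖x‖ ^ (b - 2) := by
    rw [← Real.rpow_natCast, ← Real.rpow_mul (norm_nonneg _)]
    congr 1; push_cast; ring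
  rw [this]
  ext v; simp; ring

/-- Put b = d + 2 - 2α. Differentiate the quotient and add and subtract b δ_jk x_l |x|^(-b). Since b
- (d + 1) = 1 - 2α, the bracket becomes a combination of the two polynomials that the Gaussian
identity produces. -/
lemma kernel_eq (α : ℝ) (j k l : Fin d) {x : Vec d} (hx : x ≠ 0) :
    kernel α j k l x = kernelConst d α *
      (((d : ℝ) + 2 - 2 * α) * (‖x‖ ^ (-(2 * ((d : ℝ) / 2 + 2 - α))) * cubic j k l x) -
        ‖x‖ ^ (-(2 * ((d : ℝ) / 2 + 1 - α))) * linearPart j k l x) := by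
  have hx' : 0 < ‖x‖ := norm_pos_iff.2 hx
  set b : ℝ := (d : ℝ) + 2 - 2 * α with hb
  have hp : pderiv l (fun y : Vec d => y j * y k / ‖y‖ ^ b) x =
      (kron l j * x k + kron l k * x j) * ‖x‖ ^ (-b) - b * (x j * x k * x l) * ‖x‖ ^ (-b - 2) := by
    have e : (fun y : Vec d => y j * y k / ‖y‖ ^ b) = fun y => y j * y k * ‖y‖ ^ (-b) := by
      ext y; rw [Real.rpow_neg (norm_nonneg _), div_eq_mul_inv]
    have hc : ∀ i : Fin d, HasFDerivAt (fun y : Vec d => y i)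
        (EuclideanSpace.proj (𝕜 := ℝ) i : Vec d →L[ℝ] ℝ) x :=
      fun i => (EuclideanSpace.proj (𝕜 := ℝ) i : Vec d →L[ℝ] ℝ).hasFDerivAt
    have h := ((hc j).mul (hc k)).mul (hasFDerivAt_norm_rpow' (-b) hx)
    have hs : ∀ i : Fin d, (EuclideanSpace.single l (1 : ℝ) : Vec d) i = kron l i := fun i => by
      simp [kron, eq_comm]
    rw [pderiv, e]
    erw [h.fderiv]
    simp only [add_apply, smul_apply, innerSL_apply_apply, EuclideanSpace.inner_single_right,
      smul_eq_mul, PiLp.proj_apply, hs]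
    simp
    ring
  have h1 : ‖x‖ ^ (-b - 2) = ‖x‖ ^ (-(2 * ((d : ℝ) / 2 + 2 - α))) := by congr 1; rw [hb]; ring
  have h2 : ‖x‖ ^ (-b) = ‖x‖ ^ (-(2 * ((d : ℝ) / 2 + 1 - α))) := by congr 1; rw [hb]; ring
  have h3 : ‖x‖ ^ (-b) = ‖x‖ ^ (-b - 2) * ‖x‖ ^ 2 := by
    rw [← Real.rpow_natCast, ← Real.rpow_add hx']; congr 1; push_cast; ring
  rw [kernel, ← kernelConst, ← hb, hp, ← h1, ← h2, div_eq_mul_inv, ← Real.rpow_neg hx'.le, h3, cubic,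
    linearPart, hb]
  ring

lemma kernelConst_pos {α : ℝ} (hα : 1 / 2 < α) (hα' : α < ((d : ℝ) + 1) / 2) :
    0 < kernelConst d α := by
  have h1 := Real.Gamma_pos_of_pos (s := 1 + (d : ℝ) / 2 - α) (by linarith)
  have h2 := Real.Gamma_pos_of_pos (s := 1 + α) (by linarith)
  unfold kernelConst; positivity

/-- The size of the kernel. -/
lemma exists_norm_kernel_le {α : ℝ} (hα : 1 / 2 < α) (hα' : α < ((d : ℝ) + 1) / 2) :
    ∃ C : ℝ, 0 ≤ C ∧ ∀ (j k l : Fin d) (x : Vec d), x ≠ 0 →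
      |kernel α j k l x| ≤ C * ‖x‖ ^ (-((d : ℝ) + 1 - 2 * α)) := by
  have hA := kernelConst_pos hα hα'
  have hb : 0 < (d : ℝ) + 2 - 2 * α := by linarith
  refine ⟨kernelConst d α * (((d : ℝ) + 2 - 2 * α) * 2 + (d + 3)), by positivity, ?_⟩
  intro j k l x hx
  have hx' : 0 < ‖x‖ := norm_pos_iff.2 hx
  rw [kernel_eq α j k l hx, abs_mul, abs_of_pos hA, mul_assoc]
  refine mul_le_mul_of_nonneg_left ?_ hA.le
  refine (abs_sub _ _).trans ?_
  rw [add_mul]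
  refine add_le_add ?_ ?_
  · rw [abs_mul, abs_of_pos hb, abs_mul, abs_of_nonneg (by positivity), mul_assoc]
    refine mul_le_mul_of_nonneg_left ?_ hb.le
    refine (mul_le_mul_of_nonneg_left (abs_cubic_le j k l x) (by positivity)).trans_eq ?_
    rw [mul_left_comm, ← Real.rpow_natCast, ← Real.rpow_add hx']
    congr 2; push_cast; ring
  · rw [abs_mul, abs_of_nonneg (by positivity)]
    refine (mul_le_mul_of_nonneg_left (abs_linearPart_le j k l x) (by positivity)).trans_eq ?_
    rw [mul_left_comm]
    congr 1
    nth_rw 2 [← Real.rpow_one ‖x‖]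
    rw [← Real.rpow_add hx']
    congr 1; ring

lemma norm_symbol_le (α : ℝ) (j k l : Fin d) (ξ : Vec d) :
    ‖symbol α j k l ξ‖ ≤ (2 * Real.pi) ^ (1 - 2 * α) * 2 * ‖ξ‖ ^ (-(2 * α - 1)) := by
  by_cases hξ : ξ = 0
  · subst hξ; rw [symbol]; simp; positivity
  have hx : 0 < ‖ξ‖ := norm_pos_iff.2 hξ
  rw [symbol_eq, norm_mul, norm_mul, norm_mul, Complex.norm_I, mul_one, Complex.norm_real,
    Complex.norm_real, Complex.norm_real, Real.norm_of_nonneg (by positivity),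
    Real.norm_of_nonneg (by positivity), mul_assoc]
  refine mul_le_mul_of_nonneg_left ?_ (by positivity)
  refine (mul_le_mul_of_nonneg_left (abs_cubic_le j k l ξ) (by positivity)).trans_eq ?_
  rw [mul_left_comm, ← Real.rpow_natCast, ← Real.rpow_add hx]
  congr 2; push_cast; ring

lemma ae_ne_zero [NeZero d] : ∀ᵐ x : Vec d, x ≠ 0 := by
  have : Nontrivial (Vec d) := inferInstance
  exact Measure.ae_ne volume 0

lemma measurable_symbol (α : ℝ) (j k l : Fin d) : Measurable (symbol α j k l) := by
  have : symbol α j k l = fun ξ => (((2 * Real.pi) ^ (1 - 2 * α) : ℝ) : ℂ) * Complex.I *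
      (((‖ξ‖ ^ (-(2 * (α + 1))) : ℝ) : ℂ) * (cubic j k l ξ : ℂ)) := funext (symbol_eq α j k l)
  rw [this]
  have := measurable_cubic j k l
  fun_prop

lemma aestronglyMeasurable_kernel [NeZero d] (α : ℝ) (j k l : Fin d) :
    AEStronglyMeasurable (kernel α j k l) volume := by
  have h1 := measurable_cubic j k l
  have h2 := measurable_linearPart j k l
  refine AEStronglyMeasurable.congr (f := fun x => kernelConst d α *
      (((d : ℝ) + 2 - 2 * α) * (‖x‖ ^ (-(2 * ((d : ℝ) / 2 + 2 - α))) * cubic j k l x) -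
        ‖x‖ ^ (-(2 * ((d : ℝ) / 2 + 1 - α))) * linearPart j k l x))
    (Measurable.aestronglyMeasurable (by fun_prop)) ?_
  filter_upwards [ae_ne_zero] with x hx
  exact (kernel_eq α j k l hx).symm

/-- The two bounds on α say exactly that the order d + 1 - 2α lies strictly between 0 and d. They
say the same of the order 2α - 1 of the symbol. -/
lemma exists_pairBound_kernel [NeZero d] {α : ℝ} (hα : 1 / 2 < α) (hα' : α < ((d : ℝ) + 1) / 2)
    (j k l : Fin d) : ∃ A B, PairBound (fun x => (kernel α j k l x : ℂ)) A B := by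
  obtain ⟨C, hC, h⟩ := exists_norm_kernel_le hα hα'
  obtain ⟨A, hA⟩ := pairBound_of_norm_le_rpow (h := fun x => (kernel α j k l x : ℂ))
    (Complex.continuous_ofReal.comp_aestronglyMeasurable (aestronglyMeasurable_kernel α j k l)) hC
    (β := (d : ℝ) + 1 - 2 * α) (by linarith) (by linarith) (by
      filter_upwards [ae_ne_zero] with x hx
      rw [Complex.norm_real]
      exact h j k l x hx)
  exact ⟨A, C, hA⟩

lemma exists_pairBound_symbol [NeZero d] {α : ℝ} (hα : 1 / 2 < α) (hα' : α < ((d : ℝ) + 1) / 2)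
    (j k l : Fin d) : ∃ A B, PairBound (symbol α j k l) A B := by
  obtain ⟨A, hA⟩ := pairBound_of_norm_le_rpow (measurable_symbol α j k l).aestronglyMeasurable
    (C := (2 * Real.pi) ^ (1 - 2 * α) * 2) (by positivity)
    (β := 2 * α - 1) (by linarith) (by linarith) (.of_forall (norm_symbol_le α j k l))
  exact ⟨A, _, hA⟩

/-- Multiplication of a Schwartz function by a measurable function of homogeneous growth. -/
lemma integrable_rpow_mul [NeZero d] {P : Vec d → ℝ} (hP : Measurable P) {C p : ℝ} {n : ℕ}
    (hC : 0 ≤ C) (hb : ∀ x, |P x| ≤ C * ‖x‖ ^ n) (hn : (n : ℝ) ≤ 2 * p) (hpd : 2 * p - n < d)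
    (φ : 𝓢(Vec d, ℂ)) :
    Integrable fun x => ((‖x‖ ^ (-(2 * p)) : ℝ) : ℂ) * ((P x : ℂ) * φ x) := by
  obtain ⟨A, hA⟩ := pairBound_of_norm_le_rpow (d := d)
    (h := fun x => ((‖x‖ ^ (-(2 * p)) : ℝ) : ℂ) * (P x : ℂ))
    (Measurable.aestronglyMeasurable (by fun_prop)) hC (β := 2 * p - n) (by linarith) hpd (by
      filter_upwards [ae_ne_zero] with x hx
      have hx' : 0 < ‖x‖ := norm_pos_iff.2 hx
      rw [norm_mul, Complex.norm_real, Complex.norm_real, Real.norm_of_nonneg (by positivity)]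
      refine (mul_le_mul_of_nonneg_left (hb x) (by positivity)).trans_eq ?_
      rw [mul_left_comm, ← Real.rpow_natCast, ← Real.rpow_add hx']
      congr 2; ring)
  simpa only [mul_assoc] using hA.integrable_schwartz φ

/-- Write |ξ|^(-2(α+1)) as an integral of Gaussians over the scale t, substitute t = 1/s and apply
the Gaussian identity for each s. The resulting powers of s are again subordination weights, now
with exponents p = d/2 + 2 - α for the cubic term and p = d/2 + 1 - α for the linear one. -/
lemma integral_rpow_cubic_fourierInv [NeZero d] {α : ℝ} (hα : 1 / 2 < α)
    (hα' : α < ((d : ℝ) + 1) / 2) (j k l : Fin d) (φ : 𝓢(Vec d, ℂ)) :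
    (Real.Gamma (α + 1) * Real.pi ^ (-(α + 1)) : ℝ) * ∫ ξ, ((‖ξ‖ ^ (-(2 * (α + 1))) : ℝ) : ℂ) *
        ((cubic j k l ξ : ℂ) * 𝓕⁻ (φ : Vec d → ℂ) ξ) =
      (8 * Real.pi ^ 3 * Complex.I)⁻¹ *
        ((2 * Real.pi) ^ 3 * ((Real.Gamma ((d : ℝ) / 2 + 2 - α) *
          Real.pi ^ (-((d : ℝ) / 2 + 2 - α)) : ℝ) *
          ∫ x, ((‖x‖ ^ (-(2 * ((d : ℝ) / 2 + 2 - α))) : ℝ) : ℂ) * ((cubic j k l x : ℂ) * φ x)) -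
        (2 * Real.pi) ^ 2 * ((Real.Gamma ((d : ℝ) / 2 + 1 - α) *
          Real.pi ^ (-((d : ℝ) / 2 + 1 - α)) : ℝ) *
          ∫ x, ((‖x‖ ^ (-(2 * ((d : ℝ) / 2 + 1 - α))) : ℝ) : ℂ) *
            ((linearPart j k l x : ℂ) * φ x))) := by
  have m1 := measurable_cubic (d := d) j k l
  have m2 := measurable_linearPart (d := d) j k l
  have s0 := gauss_subordination (d := d) (p := α + 1) (by linarith)
    (h := fun ξ => (cubic j k l ξ : ℂ) * (𝓕⁻ φ : 𝓢(Vec d, ℂ)) ξ)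
    (Measurable.aestronglyMeasurable (by
      have := (𝓕⁻ φ : 𝓢(Vec d, ℂ)).continuous.measurable; fun_prop))
    (integrable_rpow_mul m1 zero_le_two (abs_cubic_le j k l) (by push_cast; linarith)
      (by push_cast; linarith) _)
  have s1 := gauss_subordination (d := d) (p := (d : ℝ) / 2 + 2 - α) (by linarith)
    (h := fun x => (cubic j k l x : ℂ) * φ x)
    (Measurable.aestronglyMeasurable (by have := φ.continuous.measurable; fun_prop))
    (integrable_rpow_mul m1 zero_le_two (abs_cubic_le j k l) (by push_cast; linarith)
      (by push_cast; linarith) _)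
  have s2 := gauss_subordination (d := d) (p := (d : ℝ) / 2 + 1 - α) (by linarith)
    (h := fun x => (linearPart j k l x : ℂ) * φ x)
    (Measurable.aestronglyMeasurable (by have := φ.continuous.measurable; fun_prop))
    (integrable_rpow_mul (n := 1) m2 (C := d + 3) (by positivity)
      (fun x => by simpa using abs_linearPart_le j k l x) (by push_cast; linarith)
      (by push_cast; linarith) _)
  simp only [SchwartzMap.fourierInv_coe] at s0
  rw [← s0.2, ← s1.2, ← s2.2, ← integral_comp_rpow_Ioi _ (show (-1 : ℝ) ≠ 0 by norm_num),
    ← integral_const_mul, ← integral_const_mul, ← integral_sub (s1.1.const_mul _) (s2.1.const_mul _),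
    ← integral_const_mul]
  refine setIntegral_congr_fun measurableSet_Ioi fun s hs => ?_
  have hs' : (0 : ℝ) < s := hs
  have key : ∫ ξ, (gauss s⁻¹ ξ : ℂ) * ((cubic j k l ξ : ℂ) * 𝓕⁻ (φ : Vec d → ℂ) ξ) =
      (8 * Real.pi ^ 3 * Complex.I)⁻¹ * (((s ^ ((d : ℝ) / 2) : ℝ) : ℂ) *
      (((2 * Real.pi * s : ℝ) : ℂ) ^ 3 * (∫ x, (gauss s x : ℂ) * ((cubic j k l x : ℂ) * φ x)) -
      ((2 * Real.pi * s : ℝ) : ℂ) ^ 2 *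
        (∫ x, (gauss s x : ℂ) * ((linearPart j k l x : ℂ) * φ x)))) := by
    have h := integral_gauss_fourierInv hs' (cubicDeriv j k l φ)
    rw [integral_gauss_cubicDeriv hs'.le] at h
    simp only [fourierInv_cubicDeriv, cubicMul_apply, linearMul_apply] at h
    rw [← h, ← integral_const_mul]
    refine integral_congr_ae (.of_forall fun ξ => ?_)
    have : (Real.pi : ℂ) ≠ 0 := by exact_mod_cast Real.pi_ne_zero
    have := Complex.I_ne_zero
    simp only
    field_simp
  simp only [Real.rpow_neg_one]
  rw [key]
  -- The factors come from the subordination weight, the Jacobian of t = 1/s, the transformed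
  -- Gaussian and the three derivatives; in `r2` one power of s is lost to a Kronecker delta.
  have r1 : s⁻¹ ^ (α + 1 - 1) * s ^ (-1 - 1 : ℝ) * s ^ ((d : ℝ) / 2) * s ^ 3 =
      s ^ ((d : ℝ) / 2 + 2 - α - 1) := by
    rw [Real.inv_rpow hs'.le, ← Real.rpow_neg hs'.le, ← Real.rpow_natCast, ← Real.rpow_add hs',
      ← Real.rpow_add hs', ← Real.rpow_add hs']
    congr 1; push_cast; ring
  have r2 : s⁻¹ ^ (α + 1 - 1) * s ^ (-1 - 1 : ℝ) * s ^ ((d : ℝ) / 2) * s ^ 2 =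
      s ^ ((d : ℝ) / 2 + 1 - α - 1) := by
    rw [Real.inv_rpow hs'.le, ← Real.rpow_neg hs'.le, ← Real.rpow_natCast, ← Real.rpow_add hs',
      ← Real.rpow_add hs', ← Real.rpow_add hs']
    congr 1; push_cast; ring
  rw [← r1, ← r2]
  simp only [abs_neg, abs_one, one_mul, Complex.real_smul]
  push_cast
  ring

end

/-! ### Matching the constants in part (i) -/

section

open Filter Topology

variable {d : ℕ}

/-- This matches the constant of the linear term. The cubic term then agrees as well: with p = d/2 +
1 - α, the identity Γ(p + 1) = p Γ(p) supplies the factor 2p = d + 2 - 2α of `kernel_eq`. -/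
lemma kernelConst_eq {α : ℝ} (hα : 1 / 2 < α) :
    kernelConst d α * (Real.Gamma (α + 1) * Real.pi ^ (-(α + 1))) =
      (2 * Real.pi) ^ (1 - 2 * α) * ((8 * Real.pi ^ 3)⁻¹ * ((2 * Real.pi) ^ 2 *
        (Real.Gamma ((d : ℝ) / 2 + 1 - α) * Real.pi ^ (-((d : ℝ) / 2 + 1 - α))))) := by
  have hG := (Real.Gamma_pos_of_pos (s := α + 1) (by linarith)).ne'
  have hp := Real.pi_pos
  rw [kernelConst, show 1 + (d : ℝ) / 2 - α = (d : ℝ) / 2 + 1 - α by ring, add_comm 1 α,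
    Real.mul_rpow (by norm_num) hp.le]
  have e1 : (2 : ℝ) ^ (1 - 2 * α) = 2 * ((2 : ℝ) ^ (2 * α))⁻¹ := by
    rw [sub_eq_add_neg, Real.rpow_add (by norm_num), Real.rpow_one, Real.rpow_neg (by norm_num)]
  have e2 : Real.pi ^ (-(α + 1)) * Real.pi ^ (1 : ℕ) =
      Real.pi ^ (1 - 2 * α) * Real.pi ^ (-((d : ℝ) / 2 + 1 - α)) * Real.pi ^ ((d : ℝ) / 2) := by
    simp only [← Real.rpow_natCast, ← Real.rpow_add hp]
    congr 1; push_cast; ring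
  have e3 : (2 : ℝ) ^ (2 * α) ≠ 0 := by positivity
  have e4 : Real.pi ^ ((d : ℝ) / 2) ≠ 0 := by positivity
  rw [e1]
  set X := Real.pi ^ (-(α + 1))
  set Y := Real.pi ^ (1 - 2 * α)
  set Z := Real.pi ^ (-((d : ℝ) / 2 + 1 - α))
  set W := Real.pi ^ ((d : ℝ) / 2)
  set G := Real.Gamma ((d : ℝ) / 2 + 1 - α)
  field_simp
  linear_combination (8 * G) * e2

theorem isInverseFourier_kernel [NeZero d] {α : ℝ} (hα : 1 / 2 < α) (hα' : α < ((d : ℝ) + 1) / 2)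
    (j k l : Fin d) : IsInverseFourier (symbol α j k l) (kernel α j k l) := by
  have hdim : 1 ≤ Module.finrank ℝ (Vec d) := by
    simpa using Nat.one_le_iff_ne_zero.2 (NeZero.ne d)
  obtain ⟨C, hC, hK⟩ := exists_norm_kernel_le hα hα'
  obtain ⟨_, _, hKb⟩ := exists_pairBound_kernel hα hα' j k l
  obtain ⟨_, _, hmb⟩ := exists_pairBound_symbol hα hα' j k l
  have hd : (Module.finrank ℝ (Vec d) : ℝ) = d := by simp
  refine ⟨locallyIntegrable_of_norm_le_rpow hdim (α := 2 * α - 1) (by rw [hd]; linarith)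
    (.of_forall (norm_symbol_le α j k l)) (measurable_symbol α j k l).aestronglyMeasurable,
    locallyIntegrable_of_norm_le_rpow hdim (α := (d : ℝ) + 1 - 2 * α) (C := C)
      (by rw [hd]; linarith)
      (by filter_upwards [ae_ne_zero] with x hx using hK j k l x hx)
      (aestronglyMeasurable_kernel α j k l), fun φ => ⟨hKb.integrable_schwartz φ, ?_, ?_⟩⟩
  · have := hmb.integrable_schwartz (𝓕⁻ φ : 𝓢(Vec d, ℂ))
    simpa only [SchwartzMap.fourierInv_coe] using this
  have hp := Real.pi_pos
  have key := integral_rpow_cubic_fourierInv hα hα' j k l φ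
  set J := ∫ ξ, ((‖ξ‖ ^ (-(2 * (α + 1))) : ℝ) : ℂ) *
        ((cubic j k l ξ : ℂ) * 𝓕⁻ (φ : Vec d → ℂ) ξ) with hJ
  set I₁ := ∫ x, ((‖x‖ ^ (-(2 * ((d : ℝ) / 2 + 2 - α))) : ℝ) : ℂ) *
    ((cubic j k l x : ℂ) * φ x) with hI₁
  set I₂ := ∫ x, ((‖x‖ ^ (-(2 * ((d : ℝ) / 2 + 1 - α))) : ℝ) : ℂ) *
    ((linearPart j k l x : ℂ) * φ x) with hI₂
  have hR : ∫ ξ, symbol α j k l ξ * 𝓕⁻ (φ : Vec d → ℂ) ξ =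
      (((2 * Real.pi) ^ (1 - 2 * α) : ℝ) : ℂ) * Complex.I * J := by
    rw [hJ, ← integral_const_mul]
    refine integral_congr_ae (.of_forall fun ξ => ?_)
    simp only [symbol_eq]; ring
  have hL : ∫ x, (kernel α j k l x : ℂ) * φ x =
      (kernelConst d α : ℂ) * (((d : ℂ) + 2 - 2 * α) * I₁ - I₂) := by
    have i1 : Integrable fun x : Vec d => ((‖x‖ ^ (-(2 * ((d : ℝ) / 2 + 2 - α))) : ℝ) : ℂ) *
        ((cubic j k l x : ℂ) * φ x) :=
      integrable_rpow_mul (measurable_cubic j k l) zero_le_two (abs_cubic_le j k l)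
        (by push_cast; linarith) (by push_cast; linarith) _
    have i2 : Integrable fun x : Vec d => ((‖x‖ ^ (-(2 * ((d : ℝ) / 2 + 1 - α))) : ℝ) : ℂ) *
        ((linearPart j k l x : ℂ) * φ x) :=
      integrable_rpow_mul (n := 1) (measurable_linearPart j k l) (C := d + 3) (by positivity)
        (fun x => by simpa using abs_linearPart_le j k l x) (by push_cast; linarith)
        (by push_cast; linarith) _
    rw [hI₁, hI₂, ← integral_const_mul, ← integral_sub (i1.const_mul _) i2, ← integral_const_mul]
    refine integral_congr_ae ?_
    filter_upwards [ae_ne_zero] with x hx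
    rw [kernel_eq α j k l hx]
    push_cast
    ring
  have hG1 : Real.Gamma ((d : ℝ) / 2 + 2 - α) =
      ((d : ℝ) / 2 + 1 - α) * Real.Gamma ((d : ℝ) / 2 + 1 - α) := by
    rw [← Real.Gamma_add_one (by linarith)]; congr 1; ring
  have hP1 : Real.pi ^ (-((d : ℝ) / 2 + 1 - α)) = Real.pi ^ (-((d : ℝ) / 2 + 2 - α)) * Real.pi := by
    nth_rw 3 [← Real.rpow_one Real.pi]
    rw [← Real.rpow_add hp]; congr 1; ring
  have hKc := congrArg (fun t : ℝ => (t : ℂ)) (kernelConst_eq (d := d) hα)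
  rw [hG1] at key
  rw [hP1] at key hKc
  have hne : (((Real.Gamma (α + 1) * Real.pi ^ (-(α + 1)) : ℝ)) : ℂ) ≠ 0 := by
    have := Real.Gamma_pos_of_pos (s := α + 1) (by linarith)
    exact_mod_cast (by positivity : 0 < Real.Gamma (α + 1) * Real.pi ^ (-(α + 1))).ne'
  rw [hL, hR]
  -- Multiplying by the subordination constant of |ξ|^(-2(α+1)) makes `key` applicable to `J`.
  refine mul_left_cancel₀ hne ?_
  rw [mul_left_comm _ _ J, key]
  have hπ : (Real.pi : ℂ) ≠ 0 := by exact_mod_cast hp.ne'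
  have hI := Complex.I_ne_zero
  rw [← mul_assoc, mul_comm (((Real.Gamma (α + 1) * Real.pi ^ (-(α + 1)) : ℝ)) : ℂ)]
  push_cast at hKc ⊢
  rw [hKc]
  field_simp

end

section

open Filter Topology

variable {d : ℕ}

/-! ### Weak Lebesgue spaces -/

section WeakLp

variable {E : Type*} [NormedAddCommGroup E]

lemma distrib_anti (f : Vec d → E) {s s' : ℝ≥0} (h : s ≤ s') : distrib f s' ≤ distrib f s :=
  measure_mono fun _ hx => lt_of_le_of_lt (NNReal.coe_le_coe.2 h) hx

lemma weakNorm_le_of_distrib_le_of_pos {p : ℝ} (hp : 0 < p) {f : Vec d → E} {A : ℝ≥0} (hA : 0 < A)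
    (h : ∀ s : ℝ≥0, 0 < s → distrib f s ≤ ((A : ℝ≥0∞) / s) ^ p) : weakNorm p f ≤ A := by
  refine iSup₂_le fun t ht => ?_
  have ht' : (0 : ℝ≥0) < t ^ (1 / p) := NNReal.rpow_pos ht
  -- The level at which (A/s)^p = t. It is positive because A > 0, hence admissible in the infimum
  -- that defines f*(t).
  set s : ℝ≥0 := A / t ^ (1 / p) with hs
  have hs0 : 0 < s := div_pos hA ht'
  have hd : distrib f s ≤ t := by
    refine (h s hs0).trans_eq ?_
    rw [← ENNReal.coe_div hs0.ne', hs, div_div_cancel₀ hA.ne', ← ENNReal.coe_rpow_of_nonneg _ hp.le,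
      ← NNReal.rpow_mul, one_div_mul_cancel hp.ne', NNReal.rpow_one]
  have hr : rearrangement f t ≤ s := iInf₂_le s ⟨hs0, hd⟩
  calc (t : ℝ≥0∞) ^ (1 / p) * rearrangement f t ≤ (t : ℝ≥0∞) ^ (1 / p) * s := by gcongr
    _ = A := by
      rw [← ENNReal.coe_rpow_of_nonneg _ (by positivity), ← ENNReal.coe_mul, hs,
        mul_div_cancel₀ _ ht'.ne']

lemma weakNorm_le_of_distrib_le {p : ℝ} (hp : 0 < p) {f : Vec d → E} {A : ℝ≥0}
    (h : ∀ s : ℝ≥0, 0 < s → distrib f s ≤ ((A : ℝ≥0∞) / s) ^ p) : weakNorm p f ≤ A := by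
  refine ENNReal.le_of_forall_pos_le_add fun ε hε _ => ?_
  rw [← ENNReal.coe_add]
  refine weakNorm_le_of_distrib_le_of_pos hp (by positivity) fun s hs => (h s hs).trans ?_
  gcongr
  exact le_self_add

/-- If t < d_f(s), every level admissible for t is at least s, so f*(t) ≥ s and t^(1/p) s is bounded
by the weak norm. Let t increase to d_f(s). -/
lemma distrib_le_of_weakNorm {p : ℝ} (hp : 0 < p) (f : Vec d → E) {s : ℝ≥0} (hs : 0 < s) :
    distrib f s ≤ (weakNorm p f / s) ^ p := by
  refine le_of_forall_lt fun c hc => ?_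
  obtain ⟨t, ht, htd⟩ := ENNReal.lt_iff_exists_nnreal_btwn.1 hc
  refine ht.trans_le ?_
  rcases eq_or_ne t 0 with rfl | ht0
  · simp
  have ht0' : 0 < t := pos_iff_ne_zero.2 ht0
  have hr : (s : ℝ≥0∞) ≤ rearrangement f t := by
    refine le_iInf₂ fun s' hs' => ?_
    by_contra hcon
    rw [not_le, ENNReal.coe_lt_coe] at hcon
    exact absurd (htd.trans_le (distrib_anti f hcon.le)) (not_lt.2 hs'.2)
  have h1 : (t : ℝ≥0∞) ^ (1 / p) * s ≤ weakNorm p f :=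
    (mul_le_mul_right hr _).trans (le_iSup₂_of_le t ht0' le_rfl)
  have h2 : (t : ℝ≥0∞) ^ (1 / p) ≤ weakNorm p f / s := by
    rw [ENNReal.le_div_iff_mul_le (by simp [hs.ne']) (by simp)]; exact h1
  calc (t : ℝ≥0∞) = ((t : ℝ≥0∞) ^ (1 / p)) ^ p := by
        rw [← ENNReal.rpow_mul, one_div_mul_cancel hp.ne', ENNReal.rpow_one]
    _ ≤ _ := ENNReal.rpow_le_rpow h2 hp.le

/-- Layer cake: for t ≤ c the superlevel set has measure at most that of {|f| > c}, and for t > c at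
most M^p t^(-p), which is integrable at infinity because p > 1. -/
lemma lintegral_enorm_indicator_lt_top {p : ℝ} (hp : 1 < p) {f : Vec d → E} (hf : MemWeakLp p f)
    {c : ℝ} (hc : 0 < c) : ∫⁻ x, ‖{x | c < ‖f x‖}.indicator f x‖ₑ < ⊤ := by
  have hp0 : 0 < p := by linarith
  set M : ℝ≥0 := (weakNorm p f).toNNReal with hM
  have hMe : (M : ℝ≥0∞) = weakNorm p f := ENNReal.coe_toNNReal hf.2.ne
  have hdist : ∀ s : ℝ, 0 < s → volume {x | s < ‖f x‖} ≤ ENNReal.ofReal ((M : ℝ) ^ p * s ^ (-p)) := by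
    intro s hs
    lift s to ℝ≥0 using hs.le
    have hs' : 0 < s := NNReal.coe_pos.1 hs
    refine (distrib_le_of_weakNorm hp0 f hs').trans_eq ?_
    rw [← hMe, ← ENNReal.coe_div hs'.ne', ← ENNReal.coe_rpow_of_nonneg _ hp0.le,
      ENNReal.coe_nnreal_eq]
    congr 1
    push_cast
    rw [Real.div_rpow M.coe_nonneg hs.le, Real.rpow_neg hs.le]
    rfl
  have hmn : AEMeasurable (fun x => ‖{x | c < ‖f x‖}.indicator f x‖) volume := by
    have h0 : NullMeasurableSet {x | c < ‖f x‖} volume :=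
      nullMeasurableSet_lt aemeasurable_const hf.1.norm.aemeasurable
    exact (hf.1.indicator₀ h0).norm.aemeasurable
  have e : ∀ x, ‖{x | c < ‖f x‖}.indicator f x‖ₑ =
      ENNReal.ofReal ‖{x | c < ‖f x‖}.indicator f x‖ := fun x => (ofReal_norm _).symm
  simp_rw [e]
  rw [lintegral_eq_lintegral_meas_lt _ (.of_forall fun x => norm_nonneg _) hmn]
  have hsub : ∀ t : ℝ, 0 < t → {x | t < ‖{x | c < ‖f x‖}.indicator f x‖} ⊆
      {x | max c t < ‖f x‖} := by
    intro t ht x hx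
    by_cases hx' : c < ‖f x‖
    · have : {x | c < ‖f x‖}.indicator f x = f x := Set.indicator_of_mem (s := {x | c < ‖f x‖}) hx' f
      simp only [Set.mem_ofPred_eq, this] at hx
      exact max_lt hx' hx
    · have : {x | c < ‖f x‖}.indicator f x = 0 := Set.indicator_of_notMem (s := {x | c < ‖f x‖}) hx' f
      simp only [Set.mem_ofPred_eq, this, norm_zero] at hx
      linarith
  rw [← Set.Ioc_union_Ioi_eq_Ioi hc.le, lintegral_union measurableSet_Ioi
    (Set.Ioc_disjoint_Ioi le_rfl)]
  refine ENNReal.add_lt_top.2 ⟨?_, ?_⟩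
  · calc _ ≤ ∫⁻ t in Set.Ioc 0 c, ENNReal.ofReal ((M : ℝ) ^ p * c ^ (-p)) := by
          refine setLIntegral_mono measurable_const fun t ht => ?_
          refine (measure_mono ((hsub t ht.1).trans fun x hx => ?_)).trans (hdist c hc)
          exact lt_of_le_of_lt (le_max_left c t) hx
      _ < ⊤ := by
          rw [setLIntegral_const]
          exact ENNReal.mul_lt_top ENNReal.ofReal_lt_top (by simp)
  · calc _ ≤ ∫⁻ t in Set.Ioi c, ENNReal.ofReal ((M : ℝ) ^ p * t ^ (-p)) := by
          refine setLIntegral_mono (by fun_prop) fun t ht => ?_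
          have ht0 : 0 < t := hc.trans ht
          refine (measure_mono ((hsub t ht0).trans fun x hx => ?_)).trans (hdist t ht0)
          exact lt_of_le_of_lt (le_max_right c t) hx
      _ < ⊤ := by
          have hi : IntegrableOn (fun t : ℝ => (M : ℝ) ^ p * t ^ (-p)) (Set.Ioi c) :=
            (integrableOn_Ioi_rpow_of_lt (by linarith) hc).const_mul _
          exact hi.lintegral_lt_top

end WeakLp

/-- Truncation at height c. That c may be arbitrarily small is what rules out nonzero constants in
the uniqueness proof. -/
lemma exists_split_of_memWeakLp {p : ℝ} (hp : 1 < p) {f : Vec d → Vec d} (hf : MemWeakLp p f)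
    {c : ℝ} (hc : 0 < c) : ∃ g h : Vec d → Vec d, Integrable g ∧ AEStronglyMeasurable h volume ∧
      (∀ x, ‖h x‖ ≤ c) ∧ f = g + h := by
  have h0 : NullMeasurableSet {x | c < ‖f x‖} volume :=
    nullMeasurableSet_lt aemeasurable_const hf.1.norm.aemeasurable
  refine ⟨{x | c < ‖f x‖}.indicator f, {x | c < ‖f x‖}ᶜ.indicator f,
    ⟨hf.1.indicator₀ h0, lintegral_enorm_indicator_lt_top hp hf hc⟩, hf.1.indicator₀ h0.compl,
    fun x => ?_, (Set.indicator_self_add_compl _ _).symm⟩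
  by_cases hx : c < ‖f x‖
  · rw [Set.indicator_of_notMem (by simpa using hx)]; simpa using hc.le
  · rw [Set.indicator_of_mem (by exact hx)]; exact not_lt.1 hx

lemma memL1AddLinfty_of_memWeakLp {p : ℝ} (hp : 1 < p) {f : Vec d → Vec d} (hf : MemWeakLp p f) :
    MemL1AddLinfty f := by
  obtain ⟨g, h, hg, hm, hb, rfl⟩ := exists_split_of_memWeakLp hp hf one_pos
  exact ⟨g, h, memLp_one_iff_integrable.2 hg, memLp_top_of_bound hm 1 (.of_forall hb), rfl⟩

lemma exists_pairBound_of_memWeakLp {p : ℝ} (hp : 1 < p) {f : Vec d → Vec d} (hf : MemWeakLp p f)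
    (j : Fin d) {c : ℝ} (hc : 0 < c) : ∃ A, PairBound (fun x => (f x j : ℂ)) A c := by
  obtain ⟨g, h, hg, hm, hb, rfl⟩ := exists_split_of_memWeakLp hp hf hc
  have hcj : ∀ v : Vec d, ‖((v j : ℝ) : ℂ)‖ ≤ ‖v‖ := fun v => by
    rw [Complex.norm_real]; exact PiLp.norm_apply_le v j
  have hmj : ∀ {f : Vec d → Vec d}, AEStronglyMeasurable f volume →
      AEStronglyMeasurable (fun x => ((f x j : ℝ) : ℂ)) volume := fun {f} hf =>
    (by fun_prop : Continuous fun v : Vec d => ((v j : ℝ) : ℂ)).comp_aestronglyMeasurable hf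
  refine ⟨∫ x, ‖((g x j : ℝ) : ℂ)‖, ?_⟩
  have e : (fun x => (((g + h) x j : ℝ) : ℂ)) =
      (fun x => ((g x j : ℝ) : ℂ)) + fun x => ((h x j : ℝ) : ℂ) := by ext x; simp
  rw [e]
  exact pairBound_add (hg.norm.mono' (hmj hg.1) (.of_forall fun x => hcj _)) (hmj hm)
    (.of_forall fun x => (hcj _).trans (hb x))

end

section

open Filter Topology

variable {d : ℕ}

/-! ### Compactly supported functions are dense in the Schwartz space -/

lemma exists_cutoff : ∃ θ : Vec d → ℝ, ContDiff ℝ ∞ θ ∧ HasCompactSupport θ ∧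
    ∀ x, ‖x‖ ≤ 1 → θ x = 1 := by
  let b : ContDiffBump (0 : Vec d) := ⟨1, 2, one_pos, one_lt_two⟩
  exact ⟨b, b.contDiff, b.hasCompactSupport, fun x hx =>
    b.one_of_mem_closedBall (by simpa [b] using hx)⟩

lemma norm_iteratedFDeriv_comp_smul_le {θ : Vec d → ℝ} (hθ : ContDiff ℝ ∞ θ) {c : ℝ}
    (hc : |c| ≤ 1) (i : ℕ) {M : ℝ} (hM : ∀ x, ‖iteratedFDeriv ℝ i θ x‖ ≤ M) (x : Vec d) :
    ‖iteratedFDeriv ℝ i (fun y => θ (c • y)) x‖ ≤ M := by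
  have h := (c • ContinuousLinearMap.id ℝ (Vec d)).iteratedFDeriv_comp_right hθ x
    (i := i) (mod_cast le_top)
  have e : (θ ∘ (c • ContinuousLinearMap.id ℝ (Vec d))) = fun y => θ (c • y) := rfl
  rw [← e, h]
  refine (ContinuousMultilinearMap.norm_compContinuousLinearMap_le _ _).trans ?_
  have h1 : ‖c • ContinuousLinearMap.id ℝ (Vec d)‖ ≤ 1 := by
    rw [norm_smul, Real.norm_eq_abs]
    exact mul_le_one₀ hc (norm_nonneg _) ContinuousLinearMap.norm_id_le
  refine (mul_le_of_le_one_right (norm_nonneg _) ?_).trans (hM _)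
  exact Finset.prod_le_one (fun _ _ => norm_nonneg _) fun _ _ => h1

/-- Multiply by the cutoff θ(x/(n + 1)). The difference vanishes for |x| < n + 1. Elsewhere 1 ≤
|x|/(n + 1), so a seminorm with weight |x|^k is at most 1/(n + 1) times seminorms of φ with weight
|x|^(k+1). -/
lemma exists_compactSupport_tendsto (φ : 𝓢(Vec d, ℂ)) : ∃ f : ℕ → 𝓢(Vec d, ℂ),
    (∀ n, HasCompactSupport (f n)) ∧ Tendsto f atTop (𝓝 φ) := by
  obtain ⟨θ, hθ, hθc, hθ1⟩ := exists_cutoff (d := d)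
  let θS := hθc.toSchwartzMap hθ
  have hθM : ∀ i x, ‖iteratedFDeriv ℝ i θ x‖ ≤ SchwartzMap.seminorm ℝ 0 i θS := fun i x =>
    SchwartzMap.norm_iteratedFDeriv_le_seminorm ℝ θS i x
  let c : ℕ → ℝ := fun n => ((n : ℝ) + 1)⁻¹
  have hc0 : ∀ n, 0 < c n := fun n => by positivity
  have hc1 : ∀ n, |c n| ≤ 1 := fun n => by
    rw [abs_of_pos (hc0 n)]; exact inv_le_one_of_one_le₀ (by linarith [n.cast_nonneg (α := ℝ)])
  have hsm : ∀ n, ContDiff ℝ ∞ (fun y : Vec d => θ (c n • y)) := fun n =>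
    hθ.comp (contDiff_const_smul _)
  have hcs : ∀ n, HasCompactSupport (fun y : Vec d => θ (c n • y)) := fun n =>
    hθc.comp_smul (hc0 n).ne'
  have hcs' : ∀ n, HasCompactSupport (fun y : Vec d => θ (c n • y) • φ y) := fun n =>
    (hcs n).smul_right
  have hsm' : ∀ n, ContDiff ℝ ∞ (fun y : Vec d => θ (c n • y) • φ y) := fun n =>
    (hsm n).smul (φ.smooth ⊤)
  refine ⟨fun n => (hcs' n).toSchwartzMap (hsm' n), fun n => hcs' n, ?_⟩
  rw [(schwartz_withSeminorms ℝ (Vec d) ℂ).tendsto_nhds]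
  rintro ⟨k, m⟩ ε hε
  set M : ℝ := SchwartzMap.seminorm ℝ (k + 1) m φ + ∑ i ∈ Finset.range (m + 1),
    (m.choose i : ℝ) * SchwartzMap.seminorm ℝ 0 i θS * SchwartzMap.seminorm ℝ (k + 1) (m - i) φ
    with hM
  have hM0 : 0 ≤ M := by positivity
  have hlim : Tendsto (fun n => c n * M) atTop (𝓝 0) := by
    have : Tendsto c atTop (𝓝 0) := by
      simpa [c, one_div] using tendsto_one_div_add_atTop_nhds_zero_nat (𝕜 := ℝ)
    simpa using this.mul_const M
  filter_upwards [hlim.eventually_lt_const hε] with n hn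
  refine lt_of_le_of_lt ?_ hn
  rw [SchwartzMap.schwartzSeminormFamily_apply]
  refine SchwartzMap.seminorm_le_bound ℝ k m _ (by have := hc0 n; positivity) fun x => ?_
  have ecoe : ((((hcs' n).toSchwartzMap (hsm' n)) - φ : 𝓢(Vec d, ℂ)) : Vec d → ℂ) =
    (fun y => θ (c n • y) • φ y) - fun y => φ y := rfl
  rw [ecoe]
  by_cases hx : ‖x‖ < (n : ℝ) + 1
  · have hz : ((fun y => θ (c n • y) • φ y) - fun y => φ y) =ᶠ[𝓝 x] fun _ => (0 : ℂ) := by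
      have : ∀ᶠ y in 𝓝 x, ‖y‖ < (n : ℝ) + 1 := continuous_norm.continuousAt.eventually_lt_const hx
      filter_upwards [this] with y hy
      have : θ (c n • y) = 1 := by
        refine hθ1 _ ?_
        rw [norm_smul, Real.norm_eq_abs, abs_of_pos (hc0 n), inv_mul_le_one₀ (by positivity)]
        exact hy.le
      simp [this]
    rw [(hz.iteratedFDeriv ℝ m).eq_of_nhds]
    have := hc0 n
    rcases m with _ | m
    · simp; positivity
    · rw [iteratedFDeriv_const_of_ne (by omega)]; simp; positivity
  · rw [not_lt] at hx
    have hx1 : 1 ≤ c n * ‖x‖ := by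
      rw [inv_mul_eq_div, one_le_div (by positivity)]; exact hx
    have hD : ‖iteratedFDeriv ℝ m ((fun y => θ (c n • y) • φ y) - fun y => φ y) x‖ ≤
        ‖iteratedFDeriv ℝ m φ x‖ + ∑ i ∈ Finset.range (m + 1),
          (m.choose i : ℝ) * SchwartzMap.seminorm ℝ 0 i θS * ‖iteratedFDeriv ℝ (m - i) φ x‖ := by
      have h1 : ContDiff ℝ m (fun y : Vec d => θ (c n • y) • φ y) := (hsm' n).of_le (mod_cast le_top)
      have h2 : ContDiff ℝ m (fun y : Vec d => φ y) := φ.smooth m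
      rw [iteratedFDeriv_sub_apply h1.contDiffAt h2.contDiffAt]
      refine (norm_sub_le _ _).trans ?_
      rw [add_comm]
      refine add_le_add le_rfl ?_
      refine (norm_iteratedFDeriv_smul_le (hsm n) (φ.smooth ⊤) x (mod_cast le_top)).trans ?_
      refine Finset.sum_le_sum fun i _ => ?_
      gcongr
      exact norm_iteratedFDeriv_comp_smul_le hθ (hc1 n) i (hθM i) x
    calc ‖x‖ ^ k * ‖iteratedFDeriv ℝ m ((fun y => θ (c n • y) • φ y) - fun y => φ y) x‖
        ≤ (c n * ‖x‖) * ‖x‖ ^ k * (‖iteratedFDeriv ℝ m φ x‖ + ∑ i ∈ Finset.range (m + 1),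
          (m.choose i : ℝ) * SchwartzMap.seminorm ℝ 0 i θS * ‖iteratedFDeriv ℝ (m - i) φ x‖) := by
          refine mul_le_mul ?_ hD (norm_nonneg _) (by have := hc0 n; positivity)
          exact le_mul_of_one_le_left (by positivity) hx1
      _ = c n * (‖x‖ ^ (k + 1) * ‖iteratedFDeriv ℝ m φ x‖ + ∑ i ∈ Finset.range (m + 1),
          (m.choose i : ℝ) * SchwartzMap.seminorm ℝ 0 i θS *
            (‖x‖ ^ (k + 1) * ‖iteratedFDeriv ℝ (m - i) φ x‖)) := by
          rw [pow_succ, mul_add, mul_add, Finset.mul_sum, Finset.mul_sum]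
          congr 1
          · ring
          · exact Finset.sum_congr rfl fun i _ => by ring
      _ ≤ c n * M := by
          refine mul_le_mul_of_nonneg_left ?_ (hc0 n).le
          refine add_le_add (SchwartzMap.le_seminorm ℝ _ _ φ x) (Finset.sum_le_sum fun i _ => ?_)
          refine mul_le_mul_of_nonneg_left (SchwartzMap.le_seminorm ℝ _ _ φ x) (by positivity)

/-- Very weak solutions are tested with compactly supported functions only, a class that Bessel
potentials leave. Identities are therefore extended to all Schwartz functions before the expansion
is used. -/
lemma eq_zero_of_forall_compactSupport {L : 𝓢(Vec d, ℂ) → ℂ} (hL : Continuous L)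
    (h : ∀ φ : 𝓢(Vec d, ℂ), HasCompactSupport φ → L φ = 0) (φ : 𝓢(Vec d, ℂ)) : L φ = 0 := by
  obtain ⟨f, hf, hlim⟩ := exists_compactSupport_tendsto φ
  refine tendsto_nhds_unique ((hL.tendsto φ).comp hlim) ?_
  simp [Function.comp_def, h _ (hf _)]

/-! ### Continuity of pairings on the Schwartz space -/

lemma continuous_of_norm_sub_le {L : 𝓢(Vec d, ℂ) → ℂ} (A B : ℝ)
    (M : 𝓢(Vec d, ℂ) →L[ℂ] 𝓢(Vec d, ℂ))
    (h : ∀ η φ, ‖L η - L φ‖ ≤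
      A * SchwartzMap.seminorm ℝ 0 0 (M (η - φ)) + B * ∫ x, ‖M (η - φ) x‖) :
    Continuous L := by
  refine continuous_iff_continuousAt.2 fun φ => ?_
  refine tendsto_iff_norm_sub_tendsto_zero.2 ?_
  refine squeeze_zero (fun _ => norm_nonneg _) (fun η => h η φ) ?_
  have h1 : Continuous fun η : 𝓢(Vec d, ℂ) => SchwartzMap.seminorm ℝ 0 0 η :=
    (schwartz_withSeminorms ℝ (Vec d) ℂ).continuous_seminorm (0, 0)
  have h2 : Continuous fun η : 𝓢(Vec d, ℂ) => ∫ x, ‖η x‖ := by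
    simp_rw [← SchwartzMap.norm_toLp_one]
    fun_prop
  have h3 : Continuous fun η => M (η - φ) := M.continuous.comp (continuous_id.sub continuous_const)
  have h4 : Continuous fun η => A * SchwartzMap.seminorm ℝ 0 0 (M (η - φ)) +
      B * ∫ x, ‖M (η - φ) x‖ :=
    (continuous_const.mul (h1.comp h3)).add (continuous_const.mul (h2.comp h3))
  refine (h4.tendsto φ).trans ?_
  simp

lemma PairBound.continuous {w : Vec d → ℂ} {A B : ℝ} (hw : PairBound w A B)
    (M : 𝓢(Vec d, ℂ) →L[ℂ] 𝓢(Vec d, ℂ)) :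
    Continuous fun η : 𝓢(Vec d, ℂ) => ∫ x, w x * M η x := by
  refine continuous_of_norm_sub_le A B M fun η φ => ?_
  rw [← integral_sub (hw.integrable_schwartz _) (hw.integrable_schwartz _)]
  have := hw.norm_integral_le (SchwartzMap.integrable (M (η - φ)))
    (SchwartzMap.norm_le_seminorm ℝ (M (η - φ)))
  refine le_of_eq_of_le ?_ this
  congr 2
  ext x
  rw [map_sub, sub_apply, mul_sub]

variable [NeZero d]

lemma fracPow_sub {r : ℝ} (hr : 0 < r) {a : ℝ} (ha : 0 < a) (η φ : 𝓢(Vec d, ℂ)) (x : Vec d) :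
    fracPow r a (η - φ : 𝓢(Vec d, ℂ)) x = fracPow r a η x - fracPow r a φ x := by
  refine (hasSum_besOp hr ha (η - φ) x).unique
    (hasSum_of_eq ((hasSum_besOp hr ha η x).sub (hasSum_besOp hr ha φ x)) fun n => ?_)
  rw [map_sub, sub_apply, mul_sub]

lemma fracPow_add {r : ℝ} (hr : 0 < r) {a : ℝ} (ha : 0 < a) (η φ : 𝓢(Vec d, ℂ)) (x : Vec d) :
    fracPow r a (η + φ : 𝓢(Vec d, ℂ)) x = fracPow r a η x + fracPow r a φ x := by
  refine (hasSum_besOp hr ha (η + φ) x).unique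
    (hasSum_of_eq ((hasSum_besOp hr ha η x).add (hasSum_besOp hr ha φ x)) fun n => ?_)
  rw [map_add, add_apply, mul_add]

lemma fracPow_smul {r : ℝ} (hr : 0 < r) {a : ℝ} (ha : 0 < a) (c : ℂ) (η : 𝓢(Vec d, ℂ))
    (x : Vec d) : fracPow r a (c • η : 𝓢(Vec d, ℂ)) x = c * fracPow r a η x := by
  refine (hasSum_besOp hr ha (c • η) x).unique
    (hasSum_of_eq ((hasSum_besOp hr ha η x).mul_left c) fun n => ?_)
  rw [map_smul, smul_apply, smul_eq_mul]; ring

/-- Both norms of the fractional power of M η are controlled by those of `besOp r a (M η)`, which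
depends continuously on η in the Schwartz topology. -/
lemma PairBound.continuous_fracPow {w : Vec d → ℂ} {A B : ℝ} (hw : PairBound w A B)
    {r : ℝ} (hr : 0 < r) {a : ℝ} (ha : 0 < a) (M : 𝓢(Vec d, ℂ) →L[ℂ] 𝓢(Vec d, ℂ)) :
    Continuous fun η : 𝓢(Vec d, ℂ) => ∫ x, w x * fracPow r a (M η) x := by
  set K := ∑' n, |binomCoeff a n|
  refine continuous_of_norm_sub_le (A * K) (|B| * K) ((besOp r a).comp M) fun η φ => ?_
  rw [← integral_sub (hw.integrable_fracPow hr ha _) (hw.integrable_fracPow hr ha _)]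
  have hI := FracStokes.integrable_fracPow hr ha (M (η - φ))
  have h1 := hw.norm_integral_le hI.1 (norm_fracPow_le hr ha (M (η - φ))
    (SchwartzMap.norm_le_seminorm ℝ (besOp r a (M (η - φ)))))
  have e : ∫ x, (w x * fracPow r a (M η) x - w x * fracPow r a (M φ) x) =
      ∫ x, w x * fracPow r a (M (η - φ)) x := by
    congr 1
    ext x
    rw [map_sub, fracPow_sub hr ha, mul_sub]
  rw [e]
  refine h1.trans ?_
  have h2 : B * ∫ x, ‖fracPow r a (M (η - φ)) x‖ ≤
      |B| * (K * ∫ x, ‖besOp r a (M (η - φ)) x‖) :=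
    mul_le_mul (le_abs_self B) hI.2 (by positivity) (abs_nonneg B)
  simp only [ContinuousLinearMap.comp_apply]
  linarith [mul_assoc A K (SchwartzMap.seminorm ℝ 0 0 (besOp r a (M (η - φ)))),
    mul_assoc |B| K (∫ x, ‖besOp r a (M (η - φ)) x‖)]

end

section

open Filter Topology

variable {d : ℕ}

/-! ### Real test functions -/

lemma ext_fourierInv {φ ψ : 𝓢(Vec d, ℂ)}
    (h : ∀ ξ, 𝓕⁻ (φ : Vec d → ℂ) ξ = 𝓕⁻ (ψ : Vec d → ℂ) ξ) : φ = ψ := by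
  have h1 : 𝓕⁻ φ = 𝓕⁻ ψ := by
    ext ξ
    rw [SchwartzMap.fourierInv_coe, SchwartzMap.fourierInv_coe]
    exact h ξ
  have h2 : 𝓕 (𝓕⁻ φ) = 𝓕 (𝓕⁻ ψ) := by rw [h1]
  simpa using h2

lemma partialD_comm (i j : Fin d) (φ : 𝓢(Vec d, ℂ)) :
    partialD i (partialD j φ) = partialD j (partialD i φ) := by
  refine ext_fourierInv fun ξ => ?_
  simp only [fourierInv_partialD]
  ring

/-- The real part of a Schwartz function. -/
def realPart (η : 𝓢(Vec d, ℂ)) : 𝓢(Vec d, ℂ) :=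
  SchwartzMap.postcompCLM (Complex.ofRealCLM ∘L Complex.reCLM) η

lemma realPart_apply (η : 𝓢(Vec d, ℂ)) (x : Vec d) : realPart η x = ((η x).re : ℂ) := rfl

/-- Test fields in the definition are real while the Fourier side is complex; this decomposition
transfers the identities by linearity. -/
lemma eq_realPart_add (η : 𝓢(Vec d, ℂ)) :
    η = realPart η + Complex.I • realPart ((-Complex.I) • η) := by
  ext x
  rw [add_apply, smul_apply, realPart_apply, realPart_apply, smul_apply]
  simp only [smul_eq_mul, neg_mul, Complex.neg_re, Complex.I_mul_re, neg_neg]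
  rw [mul_comm]
  exact (Complex.re_add_im _).symm

lemma fderiv_re (η : 𝓢(Vec d, ℂ)) (x : Vec d) :
    HasFDerivAt (fun y => (η y).re) (Complex.reCLM ∘L fderiv ℝ η x) x :=
  Complex.reCLM.hasFDerivAt.comp x (SchwartzMap.hasFDerivAt η x)

lemma pderiv_re (j : Fin d) (η : 𝓢(Vec d, ℂ)) (x : Vec d) :
    pderiv j (fun y => (η y).re) x = (partialD j η x).re := by
  rw [pderiv, (fderiv_re η x).fderiv, partialD_apply]; rfl

lemma partialD_realPart (j : Fin d) (η : 𝓢(Vec d, ℂ)) :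
    partialD j (realPart η) = realPart (partialD j η) := by
  ext x
  have h : HasFDerivAt (realPart η) (Complex.ofRealCLM ∘L (Complex.reCLM ∘L fderiv ℝ η x)) x :=
    Complex.ofRealCLM.hasFDerivAt.comp x (fderiv_re η x)
  rw [partialD_apply, h.fderiv, realPart_apply, partialD_apply]; rfl

lemma contDiff_re (η : 𝓢(Vec d, ℂ)) : ContDiff ℝ ∞ fun y => (η y).re :=
  Complex.reCLM.contDiff.comp (η.smooth ⊤)

/-- Very weak solutions tested against Schwartz functions with compact support. -/
lemma IsVeryWeakSolution.apply_realPart [NeZero d] {α : ℝ} {F : Vec d → Tensor d}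
    {u : Vec d → Vec d} (hu : IsVeryWeakSolution α F u) {Ψ : Fin d → 𝓢(Vec d, ℂ)}
    (hΨ : ∀ j, HasCompactSupport (Ψ j)) (hdiv : ∑ j, partialD j (Ψ j) = 0) {χ : 𝓢(Vec d, ℂ)}
    (hχ : HasCompactSupport χ) :
    ∫ x, ∑ j, (u x j : ℂ) * (fracPow (4 * Real.pi ^ 2) α (realPart (Ψ j)) x +
      partialD j (realPart χ) x) =
    -((∫ x, ∑ j, ∑ k, F x (j, k) * (partialD k (Ψ j) x).re : ℝ) : ℂ) := by
  have h := hu.2 (fun y => WithLp.toLp 2 fun j => (Ψ j y).re) (fun y => (χ y).re)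
    (contDiff_euclidean.2 fun j => contDiff_re (Ψ j))
    (HasCompactSupport.intro (isCompact_iUnion fun j => (hΨ j).isCompact) fun x hx => by
      ext j
      have : x ∉ tsupport (Ψ j) := fun h => hx (Set.mem_iUnion.2 ⟨j, h⟩)
      simp [image_eq_zero_of_notMem_tsupport this])
    (fun x => by
      simp only [divergence, pderiv_re]
      rw [← Complex.re_sum]
      have := congrArg (fun f : 𝓢(Vec d, ℂ) => f x) hdiv
      simp only [sum_apply, zero_apply] at this
      rw [this]; rfl)
    (contDiff_re χ) (hχ.comp_left (g := Complex.re) rfl)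
  simp only [pderiv_re] at h
  rw [← h]
  refine integral_congr_ae (.of_forall fun x => Finset.sum_congr rfl fun j _ => ?_)
  rw [fracLaplacian_eq_fracPow, partialD_realPart]
  rfl

/-! ### Differences of very weak solutions -/

lemma exists_pairBound_difference {α : ℝ} {F : Vec d → Tensor d} {u v : Vec d → Vec d}
    (hu : IsVeryWeakSolution α F u) (hv : IsVeryWeakSolution α F v) (j : Fin d) :
    ∃ A B, PairBound (fun x => (v x j : ℂ) - u x j) A B := by
  obtain ⟨A, B, h⟩ := exists_pairBound_component hu.1 j
  obtain ⟨A', B', h'⟩ := exists_pairBound_component hv.1 j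
  exact ⟨_, _, h'.sub h⟩

section Difference

variable [NeZero d] {α : ℝ} {F : Vec d → Tensor d} {u v : Vec d → Vec d}

/-- The source term does not involve the solution, so it cancels on subtraction. -/
lemma difference_apply_realPart (hα : 0 < α) (hu : IsVeryWeakSolution α F u)
    (hv : IsVeryWeakSolution α F v) {Ψ : Fin d → 𝓢(Vec d, ℂ)}
    (hΨ : ∀ j, HasCompactSupport (Ψ j)) (hdiv : ∑ j, partialD j (Ψ j) = 0) {χ : 𝓢(Vec d, ℂ)}
    (hχ : HasCompactSupport χ) :
    (∑ j, ∫ x, ((v x j : ℂ) - u x j) * fracPow (4 * Real.pi ^ 2) α (realPart (Ψ j)) x) +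
      ∑ j, ∫ x, ((v x j : ℂ) - u x j) * partialD j (realPart χ) x = 0 := by
  have hr : 0 < 4 * Real.pi ^ 2 := by positivity
  have hsum : ∀ {w : Vec d → Vec d}, IsVeryWeakSolution α F w →
      (∀ j, Integrable fun x => (w x j : ℂ) * fracPow (4 * Real.pi ^ 2) α (realPart (Ψ j)) x) ∧
      (∀ j, Integrable fun x => (w x j : ℂ) * partialD j (realPart χ) x) := by
    intro w hw
    refine ⟨fun j => ?_, fun j => ?_⟩ <;> obtain ⟨A, B, hP⟩ := exists_pairBound_component hw.1 j
    · exact hP.integrable_fracPow hr hα _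
    · exact hP.integrable_schwartz _
  have hsplit : ∀ {w : Vec d → Vec d}, IsVeryWeakSolution α F w →
      ∫ x, ∑ j, (w x j : ℂ) * (fracPow (4 * Real.pi ^ 2) α (realPart (Ψ j)) x +
        partialD j (realPart χ) x) =
      (∑ j, ∫ x, (w x j : ℂ) * fracPow (4 * Real.pi ^ 2) α (realPart (Ψ j)) x) +
        ∑ j, ∫ x, (w x j : ℂ) * partialD j (realPart χ) x := by
    intro w hw
    obtain ⟨h1, h2⟩ := hsum hw
    simp_rw [mul_add]
    have h12 : ∀ j, Integrable fun x => (w x j : ℂ) *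
        fracPow (4 * Real.pi ^ 2) α (realPart (Ψ j)) x + (w x j : ℂ) * partialD j (realPart χ) x :=
      fun j => (h1 j).add (h2 j)
    rw [integral_finsetSum _ fun j _ => h12 j, ← Finset.sum_add_distrib]
    exact Finset.sum_congr rfl fun j _ => integral_add (h1 j) (h2 j)
  have e := (hsplit hv).symm.trans ((hv.apply_realPart hΨ hdiv hχ).trans
    ((hu.apply_realPart hΨ hdiv hχ).symm.trans (hsplit hu)))
  simp_rw [sub_mul]
  rw [Finset.sum_congr rfl fun j _ => integral_sub ((hsum hv).1 j) ((hsum hu).1 j),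
    Finset.sum_congr rfl fun j _ => integral_sub ((hsum hv).2 j) ((hsum hu).2 j),
    Finset.sum_sub_distrib, Finset.sum_sub_distrib]
  linear_combination e

lemma difference_fracPow_of_compactSupport (hα : 0 < α) (hu : IsVeryWeakSolution α F u)
    (hv : IsVeryWeakSolution α F v) {Ψ : Fin d → 𝓢(Vec d, ℂ)}
    (hΨ : ∀ j, HasCompactSupport (Ψ j)) (hdiv : ∑ j, partialD j (Ψ j) = 0) :
    ∑ j, ∫ x, ((v x j : ℂ) - u x j) * fracPow (4 * Real.pi ^ 2) α (Ψ j) x = 0 := by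
  have hr : 0 < 4 * Real.pi ^ 2 := by positivity
  have h0 : HasCompactSupport ((0 : 𝓢(Vec d, ℂ)) : Vec d → ℂ) := HasCompactSupport.zero
  have hz : realPart (0 : 𝓢(Vec d, ℂ)) = 0 := by ext x; simp [realPart_apply]
  have h1 := difference_apply_realPart hα hu hv hΨ hdiv h0
  have h2 := difference_apply_realPart hα hu hv (Ψ := fun j => (-Complex.I) • Ψ j)
    (fun j => (hΨ j).smul_left (f := fun _ => -Complex.I)) (by
      simp_rw [map_smul]; rw [← Finset.smul_sum, hdiv, smul_zero]) h0
  simp only [hz, map_zero, zero_apply, mul_zero, integral_zero,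
    Finset.sum_const_zero, add_zero] at h1 h2
  have h3 : ∀ j, ∫ x, ((v x j : ℂ) - u x j) * fracPow (4 * Real.pi ^ 2) α (Ψ j) x =
      (∫ x, ((v x j : ℂ) - u x j) * fracPow (4 * Real.pi ^ 2) α (realPart (Ψ j)) x) +
      Complex.I * ∫ x, ((v x j : ℂ) - u x j) *
        fracPow (4 * Real.pi ^ 2) α (realPart ((-Complex.I) • Ψ j)) x := by
    intro j
    obtain ⟨A, B, hP⟩ := exists_pairBound_difference hu hv j
    rw [← integral_const_mul, ← integral_add (hP.integrable_fracPow hr hα _)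
      ((hP.integrable_fracPow hr hα _).const_mul _)]
    refine integral_congr_ae (.of_forall fun x => ?_)
    simp only
    conv_lhs => rw [eq_realPart_add (Ψ j), fracPow_add hr hα, fracPow_smul hr hα]
    ring
  simp_rw [h3]
  rw [Finset.sum_add_distrib, ← Finset.mul_sum, h1, h2]
  simp

lemma difference_partialD_of_compactSupport (hα : 0 < α) (hu : IsVeryWeakSolution α F u)
    (hv : IsVeryWeakSolution α F v) {χ : 𝓢(Vec d, ℂ)} (hχ : HasCompactSupport χ) :
    ∑ j, ∫ x, ((v x j : ℂ) - u x j) * partialD j χ x = 0 := by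
  have hr : 0 < 4 * Real.pi ^ 2 := by positivity
  have h0 : HasCompactSupport ((0 : 𝓢(Vec d, ℂ)) : Vec d → ℂ) := HasCompactSupport.zero
  have hz : realPart (0 : 𝓢(Vec d, ℂ)) = 0 := by ext x; simp [realPart_apply]
  have hf : ∀ x : Vec d, fracPow (4 * Real.pi ^ 2) α (0 : 𝓢(Vec d, ℂ)) x = 0 := fun x => by
    simpa using fracPow_smul hr hα 0 (0 : 𝓢(Vec d, ℂ)) x
  have h1 := difference_apply_realPart hα hu hv (Ψ := fun _ => 0) (fun _ => h0) (by simp) hχ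
  have h2 := difference_apply_realPart hα hu hv (Ψ := fun _ => 0) (fun _ => h0) (by simp)
    (χ := (-Complex.I) • χ) (hχ.smul_left (f := fun _ => -Complex.I))
  simp only [hz, hf, mul_zero, integral_zero, Finset.sum_const_zero, zero_add] at h1 h2
  have h3 : ∀ j, ∫ x, ((v x j : ℂ) - u x j) * partialD j χ x =
      (∫ x, ((v x j : ℂ) - u x j) * partialD j (realPart χ) x) +
      Complex.I * ∫ x, ((v x j : ℂ) - u x j) * partialD j (realPart ((-Complex.I) • χ)) x := by
    intro j
    obtain ⟨A, B, hP⟩ := exists_pairBound_difference hu hv j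
    rw [← integral_const_mul, ← integral_add (hP.integrable_schwartz _)
      ((hP.integrable_schwartz _).const_mul _)]
    refine integral_congr_ae (.of_forall fun x => ?_)
    simp only
    conv_lhs => rw [eq_realPart_add χ, map_add, map_smul, add_apply, smul_apply, smul_eq_mul]
    ring
  simp_rw [h3]
  rw [Finset.sum_add_distrib, ← Finset.mul_sum, h1, h2]
  simp

lemma difference_partialD (hα : 0 < α) (hu : IsVeryWeakSolution α F u)
    (hv : IsVeryWeakSolution α F v) (χ : 𝓢(Vec d, ℂ)) :
    ∑ j, ∫ x, ((v x j : ℂ) - u x j) * partialD j χ x = 0 := by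
  refine eq_zero_of_forall_compactSupport (L := fun χ => ∑ j, ∫ x, ((v x j : ℂ) - u x j) *
    partialD j χ x) ?_ (fun χ hχ => difference_partialD_of_compactSupport hα hu hv hχ) χ
  refine continuous_finsetSum _ fun j _ => ?_
  obtain ⟨A, B, hP⟩ := exists_pairBound_difference hu hv j
  exact hP.continuous (partialD j)

/-- D_j commutes with Bessel potentials. Thus each term of the expansion is the weak divergence of v
- u tested on the Schwartz function `besOp (4 * Real.pi ^ 2) (α - n) χ`, and it vanishes. -/
lemma difference_fracPow_partialD (hα : 0 < α) (hu : IsVeryWeakSolution α F u)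
    (hv : IsVeryWeakSolution α F v) (χ : 𝓢(Vec d, ℂ)) :
    ∑ j, ∫ x, ((v x j : ℂ) - u x j) * fracPow (4 * Real.pi ^ 2) α (partialD j χ) x = 0 := by
  have hr : 0 < 4 * Real.pi ^ 2 := by positivity
  have h : ∀ j : Fin d, HasSum (fun n : ℕ => (binomCoeff α n : ℂ) *
      ∫ x, ((v x j : ℂ) - u x j) * partialD j (besOp (4 * Real.pi ^ 2) (α - n) χ) x)
      (∫ x, ((v x j : ℂ) - u x j) * fracPow (4 * Real.pi ^ 2) α (partialD j χ) x) := by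
    intro j
    obtain ⟨A, B, hP⟩ := exists_pairBound_difference hu hv j
    refine hasSum_of_eq (hP.hasSum_fracPow hr hα (partialD j χ)) fun n => ?_
    rw [partialD_eq, partialD_eq, besOp_lineDeriv hr]
  refine (hasSum_sum fun j _ => h j).unique (hasSum_of_eq hasSum_zero fun n => ?_)
  rw [← Finset.mul_sum, difference_partialD hα hu hv, mul_zero]

end Difference

/-! ### The projected Laplacian -/

/-- The Laplacian on Schwartz functions. -/
def lap : 𝓢(Vec d, ℂ) →L[ℂ] 𝓢(Vec d, ℂ) := ∑ i, (partialD i).comp (partialD i)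

lemma lap_eq (χ : 𝓢(Vec d, ℂ)) : lap χ = ∑ i, partialD i (partialD i χ) := by
  simp [lap]

lemma fourierInv_lap (χ : 𝓢(Vec d, ℂ)) (ξ : Vec d) :
    𝓕⁻ (lap χ : Vec d → ℂ) ξ = -((4 * Real.pi ^ 2 * ‖ξ‖ ^ 2 : ℝ) : ℂ) * 𝓕⁻ (χ : Vec d → ℂ) ξ := by
  have h1 : 𝓕⁻ (lap χ) = ∑ i, 𝓕⁻ (partialD i (partialD i χ)) := by
    rw [lap_eq]
    exact map_sum (FourierTransform.fourierInvCLM ℂ 𝓢(Vec d, ℂ)) _ _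
  have h2 := congrArg (fun f : 𝓢(Vec d, ℂ) => f ξ) h1
  simp only [sum_apply, SchwartzMap.fourierInv_coe, fourierInv_partialD] at h2
  rw [h2, EuclideanSpace.norm_sq_eq]
  simp only [Real.norm_eq_abs, sq_abs]
  push_cast
  rw [Finset.mul_sum, ← Finset.sum_neg_distrib, Finset.sum_mul]
  refine Finset.sum_congr rfl fun i _ => ?_
  linear_combination (4 * Real.pi ^ 2 * (ξ i : ℂ) ^ 2 * 𝓕⁻ (χ : Vec d → ℂ) ξ) * Complex.I_sq

/-- The `(j, k)` entry of `Δ - ∇ div`. -/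
def projLap (j k : Fin d) : 𝓢(Vec d, ℂ) →L[ℂ] 𝓢(Vec d, ℂ) :=
  (if j = k then lap else 0) - (partialD j).comp (partialD k)

/-- Unlike the Leray projection, Δ - ∇ div is local. Applied to a compactly supported χ, its columns
are thus both compactly supported and divergence-free, as admissible test fields must be. -/
lemma sum_partialD_projLap (k : Fin d) (χ : 𝓢(Vec d, ℂ)) :
    ∑ j, partialD j (projLap j k χ) = 0 := by
  have h : ∀ j, partialD j (projLap j k χ) =
      (if j = k then partialD j (lap χ) else 0) - partialD j (partialD j (partialD k χ)) := by
    intro j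
    rw [projLap]
    split_ifs <;> simp
  simp_rw [h]
  rw [Finset.sum_sub_distrib, Finset.sum_ite_eq' Finset.univ k, if_pos (Finset.mem_univ k),
    lap_eq, map_sum, sub_eq_zero]
  refine Finset.sum_congr rfl fun j _ => ?_
  rw [partialD_comm k j, partialD_comm k j]

lemma partialD_eq_zero {K : Set (Vec d)} (hK : IsClosed K) {χ : 𝓢(Vec d, ℂ)}
    (h : ∀ x ∉ K, χ x = 0) (c : Fin d) : ∀ x ∉ K, partialD c χ x = 0 := by
  intro x hx
  have : (χ : Vec d → ℂ) =ᶠ[𝓝 x] fun _ => 0 := by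
    filter_upwards [hK.isOpen_compl.mem_nhds hx] with y hy using h y hy
  rw [partialD_apply, this.fderiv_eq]
  simp

lemma hasCompactSupport_projLap (j k : Fin d) {χ : 𝓢(Vec d, ℂ)} (hχ : HasCompactSupport χ) :
    HasCompactSupport (projLap j k χ) := by
  have hK : IsClosed (tsupport χ) := isClosed_tsupport _
  have h0 : ∀ x ∉ tsupport χ, χ x = 0 := fun x hx => image_eq_zero_of_notMem_tsupport hx
  refine HasCompactSupport.intro hχ.isCompact fun x hx => ?_
  have h1 : ∀ i l, partialD i (partialD l χ) x = 0 := fun i l =>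
    partialD_eq_zero hK (partialD_eq_zero hK h0 l) i x hx
  rw [projLap]
  split_ifs <;> simp [lap_eq, h1]

/-- Δ has symbol -4π²|ξ|², and a change of r only costs a constant. The vanishing of pairings with
Λ^(2α)Δχ thus passes to every scale r, as the Liouville argument requires. -/
lemma fracPow_lap {r α : ℝ} (hr : 0 < r) (hα : 0 < α) (χ : 𝓢(Vec d, ℂ)) (x : Vec d) :
    fracPow r (α + 1) χ x =
      (-((r / (4 * Real.pi ^ 2)) ^ (α + 1) : ℝ) : ℂ) * fracPow (4 * Real.pi ^ 2) α (lap χ) x := by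
  rw [fracPow, fracPow, Real.fourierInv_eq', Real.fourierInv_eq', ← integral_const_mul]
  refine integral_congr_ae (.of_forall fun ξ => ?_)
  have h1 : 𝓕 (lap χ : Vec d → ℂ) ξ =
      -((4 * Real.pi ^ 2 * ‖ξ‖ ^ 2 : ℝ) : ℂ) * 𝓕 (χ : Vec d → ℂ) ξ := by
    have := fourierInv_lap χ (-ξ)
    rwa [fourierInv_eq_fourier_neg', fourierInv_eq_fourier_neg', neg_neg, norm_neg] at this
  have h2 : (r * ‖ξ‖ ^ 2) ^ (α + 1) = (r / (4 * Real.pi ^ 2)) ^ (α + 1) *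
      ((4 * Real.pi ^ 2 * ‖ξ‖ ^ 2) ^ α * (4 * Real.pi ^ 2 * ‖ξ‖ ^ 2)) := by
    rw [← Real.rpow_add_one' (by positivity) (by linarith), ← Real.mul_rpow (by positivity)
      (by positivity)]
    congr 1
    field_simp
  simp only [smul_eq_mul]
  rw [h1, h2]
  push_cast
  ring

variable [NeZero d]

/-- Test with column k of (Δ - ∇ div)χ. The part coming from ∇ div drops out by
`difference_fracPow_partialD`, and only the component k of the difference survives. -/
lemma difference_fracPow_lap {α : ℝ} {F : Vec d → Tensor d} {u v : Vec d → Vec d} (hα : 0 < α)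
    (hu : IsVeryWeakSolution α F u) (hv : IsVeryWeakSolution α F v) (k : Fin d)
    (χ : 𝓢(Vec d, ℂ)) :
    ∫ x, ((v x k : ℂ) - u x k) * fracPow (4 * Real.pi ^ 2) α (lap χ) x = 0 := by
  have hr : 0 < 4 * Real.pi ^ 2 := by positivity
  have h1 : ∑ j, ∫ x, ((v x j : ℂ) - u x j) * fracPow (4 * Real.pi ^ 2) α (projLap j k χ) x = 0 := by
    refine eq_zero_of_forall_compactSupport (L := fun χ => ∑ j, ∫ x, ((v x j : ℂ) - u x j) *
      fracPow (4 * Real.pi ^ 2) α (projLap j k χ) x) ?_ (fun χ hχ =>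
        difference_fracPow_of_compactSupport hα hu hv (fun j => hasCompactSupport_projLap j k hχ)
          (sum_partialD_projLap k χ)) χ
    refine continuous_finsetSum _ fun j _ => ?_
    obtain ⟨A, B, hP⟩ := exists_pairBound_difference hu hv j
    exact hP.continuous_fracPow hr hα (projLap j k)
  have h2 := difference_fracPow_partialD hα hu hv (partialD k χ)
  have h3 : ∀ j, ∫ x, ((v x j : ℂ) - u x j) * fracPow (4 * Real.pi ^ 2) α (projLap j k χ) x =
      (if j = k then ∫ x, ((v x j : ℂ) - u x j) * fracPow (4 * Real.pi ^ 2) α (lap χ) x else 0) -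
      ∫ x, ((v x j : ℂ) - u x j) * fracPow (4 * Real.pi ^ 2) α (partialD j (partialD k χ)) x := by
    intro j
    obtain ⟨A, B, hP⟩ := exists_pairBound_difference hu hv j
    by_cases hjk : j = k
    · have e : projLap j k χ = lap χ - partialD j (partialD k χ) := by simp [projLap, hjk]
      rw [if_pos hjk, ← integral_sub (hP.integrable_fracPow hr hα _)
        (hP.integrable_fracPow hr hα _)]
      simp_rw [e, fracPow_sub hr hα, mul_sub]
    · have e : projLap j k χ = (-1 : ℂ) • partialD j (partialD k χ) := by simp [projLap, hjk]
      rw [if_neg hjk, zero_sub, ← integral_neg]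
      simp_rw [e, fracPow_smul hr hα]
      congr 1; ext x; ring
  simp_rw [h3] at h1
  rw [Finset.sum_sub_distrib, h2, Finset.sum_ite_eq' Finset.univ k,
    if_pos (Finset.mem_univ k), sub_zero] at h1
  exact h1

end

section

open Filter Topology

variable {d : ℕ}

/-! ### A Liouville theorem for fractional powers of the Laplacian -/

lemma norm_besOp_neg_one_le_integral {r : ℝ} (hr : 0 < r) (η : 𝓢(Vec d, ℂ)) (x : Vec d) :
    ‖besOp r (-1) η x‖ ≤ ∫ ξ, bes r (-1) ξ * ‖𝓕 (η : Vec d → ℂ) ξ‖ := by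
  rw [besOp_eq_fourierInv hr, Real.fourierInv_eq']
  refine (norm_integral_le_integral_norm _).trans (le_of_eq ?_)
  refine integral_congr_ae (.of_forall fun ξ => ?_)
  simp only [norm_smul, Complex.norm_exp_ofReal_mul_I, one_mul, norm_mul, Complex.norm_real,
    Real.norm_eq_abs, abs_of_pos (bes_pos hr.le _ ξ)]

lemma tendsto_integral_bes_neg_one [NeZero d] (η : 𝓢(Vec d, ℂ)) :
    Tendsto (fun N : ℕ => ∫ ξ, bes ((N : ℝ) + 1) (-1) ξ * ‖𝓕 (η : Vec d → ℂ) ξ‖) atTop (𝓝 0) := by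
  have hi : Integrable (𝓕 (η : Vec d → ℂ)) := by
    rw [← SchwartzMap.fourier_coe]; exact SchwartzMap.integrable _
  have hm : ∀ r : ℝ, 0 < r → AEStronglyMeasurable (bes (d := d) r (-1)) volume := fun r hr =>
    (hasTemperateGrowth_bes hr (-1)).1.continuous.aestronglyMeasurable
  have h := tendsto_integral_of_dominated_convergence
    (F := fun (N : ℕ) ξ => bes ((N : ℝ) + 1) (-1) ξ * ‖𝓕 (η : Vec d → ℂ) ξ‖) (f := fun _ => 0)
    (μ := volume) (fun ξ => ‖𝓕 (η : Vec d → ℂ) ξ‖)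
    (fun N => (hm _ (by positivity)).mul hi.norm.1) hi.norm
    (fun N => .of_forall fun ξ => ?_) ?_
  · simpa using h
  · have h0 : (0 : ℝ) ≤ N + 1 := by positivity
    rw [Real.norm_eq_abs, abs_of_nonneg (mul_nonneg (bes_pos h0 _ ξ).le (norm_nonneg _))]
    exact mul_le_of_le_one_left (norm_nonneg _) (bes_neg_one_le h0 ξ)
  · have hne : ∀ᵐ ξ : Vec d, ξ ≠ 0 := by
      have : Nontrivial (Vec d) := inferInstance
      exact Measure.ae_ne volume 0
    filter_upwards [hne] with ξ hξ
    have h1 : Tendsto (fun N : ℕ => 1 + ((N : ℝ) + 1) * ‖ξ‖ ^ 2) atTop atTop :=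
      tendsto_atTop_add_const_left _ _ ((tendsto_atTop_add_const_right _ _
        tendsto_natCast_atTop_atTop).atTop_mul_const (by positivity))
    have h2 := (tendsto_inv_atTop_zero.comp h1).mul_const ‖𝓕 (η : Vec d → ℂ) ξ‖
    rw [zero_mul] at h2
    refine h2.congr fun N => ?_
    simp only [Function.comp_apply, bes, Real.rpow_neg_one]

/-- If `w` is a sum of an integrable and an arbitrarily small bounded function and all the
`w`-pairings with `Λ^{2a}χ` vanish, then `w` pairs to zero with all Schwartz functions. -/
lemma integral_mul_eq_zero_of_fracPow [NeZero d] {w : Vec d → ℂ}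
    (hw : ∀ c : ℝ, 0 < c → ∃ A, PairBound w A c) {a : ℝ} (ha : 0 < a)
    (h : ∀ r : ℝ, 0 < r → ∀ χ : 𝓢(Vec d, ℂ), ∫ x, w x * fracPow r a χ x = 0)
    (η : 𝓢(Vec d, ℂ)) : ∫ x, w x * η x = 0 := by
  set K := ∑' n, |binomCoeff a (n + 1)| with hK
  have hKs : Summable fun n => |binomCoeff a (n + 1)| :=
    (summable_nat_add_iff 1).2 (summable_abs_binomCoeff ha)
  have hK0 : 0 ≤ K := tsum_nonneg fun _ => abs_nonneg _
  -- The constant A depends on c. For fixed c the limit r → ∞ removes the A term; c → 0 is taken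
  -- afterwards.
  have key : ∀ c : ℝ, 0 < c → ‖∫ x, w x * η x‖ ≤ K * (c * ∫ x, ‖η x‖) := by
    intro c hc
    obtain ⟨A, hA⟩ := hw c hc
    have hlim : Tendsto (fun N : ℕ => K * (A * (∫ ξ, bes ((N : ℝ) + 1) (-1) ξ *
        ‖𝓕 (η : Vec d → ℂ) ξ‖) + c * ∫ x, ‖η x‖)) atTop
        (𝓝 (K * (A * 0 + c * ∫ x, ‖η x‖))) :=
      (((tendsto_integral_bes_neg_one η).const_mul A).add_const _).const_mul K
    rw [mul_zero, zero_add] at hlim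
    refine ge_of_tendsto' hlim fun N => ?_
    set r : ℝ := (N : ℝ) + 1
    have hr : 0 < r := by positivity
    set S := ∫ ξ, bes r (-1) ξ * ‖𝓕 (η : Vec d → ℂ) ξ‖
    -- With χ = `besOp r (-a) η` the expansion reads ∑ c_n `besOp r (-n) η`. Its term n = 0 is η
    -- itself and its sum pairs to 0 with w, so ∫ w η is minus the sum over n ≥ 1.
    have hs := hA.hasSum_fracPow hr ha (besOp r (-a) η)
    rw [h r hr] at hs
    have e : ∀ n : ℕ, besOp r (a - n) (besOp r (-a) η) = besOp r (0 - n) η := fun n => by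
      rw [besOp_besOp hr, show a - n + -a = 0 - n by ring]
    simp_rw [e] at hs
    have hs1 := (hasSum_nat_add_iff' 1).2 hs
    simp only [Finset.sum_range_one, binomCoeff_zero, Nat.cast_zero, zero_sub, neg_zero,
      besOp_zero, Complex.ofReal_one, one_mul] at hs1
    have hb : ∀ n : ℕ, ‖(binomCoeff a (n + 1) : ℂ) *
        ∫ x, w x * besOp r (-((n + 1 : ℕ) : ℝ)) η x‖ ≤
        |binomCoeff a (n + 1)| * (A * S + c * ∫ x, ‖η x‖) := by
      intro n
      rw [norm_mul, Complex.norm_real, Real.norm_eq_abs]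
      refine mul_le_mul_of_nonneg_left ?_ (abs_nonneg _)
      -- One unit of order yields the bound S, which tends to 0 as r → ∞; the other n units are
      -- contractions.
      have e1 : -((n + 1 : ℕ) : ℝ) = -1 - n := by push_cast; ring
      refine (hA.norm_integral_le (S := S) (SchwartzMap.integrable _) fun x => ?_).trans ?_
      · rw [e1]
        exact norm_besOp_sub_nat_le hr (-1) η (norm_besOp_neg_one_le_integral hr η) n x
      · have hI := integral_norm_besOp_sub_nat_le hr 0 η (n + 1)
        rw [zero_sub, besOp_zero] at hI
        exact add_le_add le_rfl (mul_le_mul_of_nonneg_left hI hc.le)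
    have := tsum_of_norm_bounded (hKs.mul_right (A * S + c * ∫ x, ‖η x‖)).hasSum hb
    rw [hs1.tsum_eq, norm_neg, tsum_mul_right] at this
    exact this
  have hlim : Tendsto (fun N : ℕ => K * (1 / ((N : ℝ) + 1) * ∫ x, ‖η x‖)) atTop
      (𝓝 (K * (0 * ∫ x, ‖η x‖))) :=
    (tendsto_one_div_add_atTop_nhds_zero_nat.mul_const _).const_mul K
  rw [zero_mul, mul_zero] at hlim
  exact norm_le_zero_iff.1 (ge_of_tendsto' hlim fun N => key _ (by positivity))

lemma PairBound.ae_eq_zero {w : Vec d → ℂ} {A B : ℝ} (hw : PairBound w A B)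
    (h : ∀ η : 𝓢(Vec d, ℂ), ∫ x, w x * η x = 0) : ∀ᵐ x, w x = 0 := by
  have hl : LocallyIntegrable w volume := by
    rw [locallyIntegrable_iff]
    intro K hK
    have hi : Integrable (K.indicator fun _ => (1 : ℂ)) :=
      (integrable_indicator_iff hK.measurableSet).2 (integrableOn_const hK.measure_lt_top.ne)
    have := hw.integrable (S := 1) hi fun x => by
      by_cases hx : x ∈ K <;> simp [hx]
    rw [← integrable_indicator_iff hK.measurableSet]
    refine this.congr (.of_forall fun x => ?_)
    by_cases hx : x ∈ K <;> simp [hx]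
  refine ae_eq_zero_of_integral_contDiff_smul_eq_zero hl fun g hg hgc => ?_
  have hc : HasCompactSupport fun x => (g x : ℂ) := hgc.comp_left (g := Complex.ofReal) rfl
  rw [← h (hc.toSchwartzMap (Complex.ofRealCLM.contDiff.comp hg))]
  refine integral_congr_ae (.of_forall fun x => ?_)
  change g x • w x = w x * (g x : ℂ)
  rw [Complex.real_smul, mul_comm]

/-- Very weak solutions in weak Lebesgue spaces are unique. -/
theorem IsVeryWeakSolution.ae_eq [NeZero d] {α p : ℝ} {F : Vec d → Tensor d} {u v : Vec d → Vec d}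
    (hα : 0 < α) (hp : 1 < p) (hu : IsVeryWeakSolution α F u) (hv : IsVeryWeakSolution α F v)
    (hup : MemWeakLp p u) (hvp : MemWeakLp p v) : v =ᵐ[volume] u := by
  have hk : ∀ k, ∀ᵐ x, (v x k : ℂ) - u x k = 0 := by
    intro k
    have hP : ∀ c : ℝ, 0 < c → ∃ A, PairBound (fun x => (v x k : ℂ) - u x k) A c := by
      intro c hc
      obtain ⟨A, hA⟩ := exists_pairBound_of_memWeakLp hp hvp k (half_pos hc)
      obtain ⟨A', hA'⟩ := exists_pairBound_of_memWeakLp hp hup k (half_pos hc)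
      have := hA.sub hA'
      rw [add_halves] at this
      exact ⟨_, this⟩
    obtain ⟨A, hA⟩ := hP 1 one_pos
    -- The exponent is α + 1 because Λ^(2α)Δ = -Λ^(2(α+1)).
    refine hA.ae_eq_zero (integral_mul_eq_zero_of_fracPow hP (a := α + 1) (by linarith) ?_)
    intro r hr χ
    simp_rw [fracPow_lap hr hα, mul_left_comm]
    rw [integral_const_mul, difference_fracPow_lap hα hu hv, mul_zero]
  filter_upwards [ae_all_iff.2 hk] with x hx
  ext k
  exact_mod_cast sub_eq_zero.1 (hx k)

end

section

open Filter Topology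

variable {d : ℕ}

/-! ### The weak-type estimate for Riesz potentials -/

lemma volume_lt_norm_rpow_le [NeZero d] {β : ℝ} (hβ : 0 < β) (y : Vec d) {t : ℝ} (ht : 0 < t) :
    volume {x : Vec d | t < ‖x - y‖ ^ (-β)} ≤
      ENNReal.ofReal (t ^ (-(d : ℝ) / β)) * volume (Metric.ball (0 : Vec d) 1) := by
  have hsub : {x : Vec d | t < ‖x - y‖ ^ (-β)} ⊆ Metric.ball y (t ^ (-1 / β)) := by
    intro x hx
    have hx' : t < ‖x - y‖ ^ (-β) := hx
    have h0 : 0 < ‖x - y‖ := by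
      refine (norm_nonneg _).lt_of_ne fun h => ?_
      rw [← h, Real.zero_rpow (by linarith)] at hx'
      linarith
    rw [mem_ball_iff_norm]
    have h1 := Real.rpow_lt_rpow_of_neg ht hx' (z := -1 / β) (by
      rw [neg_div]; exact neg_neg_of_pos (by positivity))
    rwa [← Real.rpow_mul h0.le, show -β * (-1 / β) = 1 by field_simp, Real.rpow_one] at h1
  have : Nontrivial (Vec d) := inferInstance
  refine (measure_mono hsub).trans_eq ?_
  rw [Measure.addHaar_ball volume y (by positivity), finrank_euclideanSpace_fin,
    ← Real.rpow_natCast, ← Real.rpow_mul ht.le]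
  congr 3
  ring

/-- Layer cake, split at T = |E|^(-β/d), where the two bounds balance: below T the level set has
measure at most |E|, and above T it lies in a ball of volume κ t^(-d/β), integrable at infinity
since β < d. Both parts are multiples of |E|^(1-β/d). -/
lemma exists_setLIntegral_rpow_le [NeZero d] {β : ℝ} (hβ : 0 < β) (hβd : β < d) :
    ∃ C : ℝ≥0, ∀ (y : Vec d) (E : Set (Vec d)), volume E ≠ ⊤ →
      ∫⁻ x in E, ENNReal.ofReal (‖x - y‖ ^ (-β)) ≤ C * volume E ^ (1 - β / d) := by
  have hd : (0 : ℝ) < d := hβ.trans hβd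
  set κ := volume (Metric.ball (0 : Vec d) 1) with hκ
  have hκt : κ ≠ ⊤ := measure_ball_lt_top.ne
  have hp : 1 < (d : ℝ) / β := by rwa [one_lt_div hβ]
  have hp' : -(d : ℝ) / β < -1 := by rw [neg_div]; linarith
  refine ⟨1 + Real.toNNReal (((d : ℝ) / β - 1)⁻¹) * κ.toNNReal, fun y E hE => ?_⟩
  rcases eq_or_ne (volume E) 0 with h0 | h0
  · rw [setLIntegral_measure_zero _ _ h0]; exact zero_le
  set V := (volume E).toReal with hV
  have hVe : volume E = ENNReal.ofReal V := (ENNReal.ofReal_toReal hE).symm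
  have hV0 : 0 < V := ENNReal.toReal_pos h0 hE
  set T := V ^ (-β / d) with hT
  have hT0 : 0 < T := Real.rpow_pos_of_pos hV0 _
  have hm : Measurable fun x : Vec d => ‖x - y‖ ^ (-β) := by fun_prop
  rw [lintegral_eq_lintegral_meas_lt _ (.of_forall fun x => by positivity) hm.aemeasurable,
    ← Set.Ioc_union_Ioi_eq_Ioi hT0.le, lintegral_union measurableSet_Ioi
    (Set.Ioc_disjoint_Ioi le_rfl)]
  have e1 : V * T = V ^ (1 - β / d) := by
    rw [hT, ← Real.rpow_one_add' hV0.le (by rw [neg_div, ← sub_eq_add_neg, sub_ne_zero]; exact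
      ((div_lt_one hd).2 hβd).ne')]
    congr 1; ring
  have h1 : ∫⁻ t in Set.Ioc 0 T, (volume.restrict E) {x | t < ‖x - y‖ ^ (-β)} ≤
      ENNReal.ofReal (V ^ (1 - β / d)) := by
    calc _ ≤ ∫⁻ t in Set.Ioc 0 T, volume E := by
          refine lintegral_mono fun t => ?_
          exact (measure_mono (Set.subset_univ _)).trans_eq (Measure.restrict_apply_univ E)
      _ = _ := by
          rw [setLIntegral_const, Real.volume_Ioc, sub_zero, hVe, ← ENNReal.ofReal_mul hV0.le, e1]
  have e2 : T ^ (-(d : ℝ) / β + 1) = V ^ (1 - β / d) := by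
    rw [hT, ← Real.rpow_mul hV0.le]
    congr 1
    field_simp
    ring
  have h2 : ∫⁻ t in Set.Ioi T, (volume.restrict E) {x | t < ‖x - y‖ ^ (-β)} ≤
      ENNReal.ofReal ((d / β - 1)⁻¹ * V ^ (1 - β / d)) * κ := by
    calc _ ≤ ∫⁻ t in Set.Ioi T, ENNReal.ofReal (t ^ (-(d : ℝ) / β)) * κ := by
          refine setLIntegral_mono (by fun_prop) fun t ht => ?_
          exact (Measure.restrict_apply_le _ _).trans (volume_lt_norm_rpow_le hβ y (hT0.trans ht))
      _ = _ := by
          rw [lintegral_mul_const _ (by fun_prop), ← ofReal_integral_eq_lintegral_ofReal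
            (integrableOn_Ioi_rpow_of_lt hp' hT0)
            ((ae_restrict_iff' measurableSet_Ioi).2 (.of_forall fun t ht =>
              Real.rpow_nonneg (hT0.trans ht).le _)),
            integral_Ioi_rpow_of_lt hp' hT0, e2]
          congr 2
          rw [show -(d : ℝ) / β + 1 = -((d : ℝ) / β - 1) by ring, neg_div_neg_eq, div_eq_inv_mul]
  refine (add_le_add h1 h2).trans_eq ?_
  have hrp : volume E ^ (1 - β / d) = ENNReal.ofReal (V ^ (1 - β / d)) := by
    rw [hVe, ENNReal.ofReal_rpow_of_pos hV0]
  rw [hrp, ENNReal.ofReal_mul (by have : 0 < (d : ℝ) / β - 1 := by linarith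
                                  positivity)]
  push_cast
  rw [ENNReal.coe_toNNReal hκt]
  change _ = (1 + ENNReal.ofReal _ * κ) * _
  ring

/-- The potential `∫ |x - y|^{-β} |f(y)| dy`. -/
def potential {E : Type*} [NormedAddCommGroup E] (β : ℝ) (f : Vec d → E) (x : Vec d) : ℝ≥0∞ :=
  ∫⁻ y, ENNReal.ofReal (‖x - y‖ ^ (-β)) * ‖f y‖ₑ

section Potential

variable {E : Type*} [NormedAddCommGroup E] {β : ℝ} {f : Vec d → E}

lemma potential_eq (x : Vec d) :
    potential β f x = ∫⁻ t, ENNReal.ofReal (‖t‖ ^ (-β)) * ‖f (x - t)‖ₑ := by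
  rw [potential, ← lintegral_sub_left_eq_self _ x]
  simp

lemma aemeasurable_potential_integrand (hf : AEStronglyMeasurable f volume)
    (μ : Measure (Vec d)) [SFinite μ] :
    AEMeasurable (fun p : Vec d × Vec d => ENNReal.ofReal (‖p.1 - p.2‖ ^ (-β)) * ‖f p.2‖ₑ)
      (μ.prod volume) :=
  AEMeasurable.mul (Measurable.aemeasurable (by fun_prop)) hf.comp_snd.enorm

lemma aemeasurable_potential (hf : AEStronglyMeasurable f volume) :
    AEMeasurable (potential β f) volume :=
  (aemeasurable_potential_integrand hf volume).lintegral_prod_right'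

lemma setLIntegral_potential_le {C : ℝ≥0∞} {S : Set (Vec d)} (hf : AEStronglyMeasurable f volume)
    (h : ∀ y, ∫⁻ x in S, ENNReal.ofReal (‖x - y‖ ^ (-β)) ≤ C) :
    ∫⁻ x in S, potential β f x ≤ C * eLpNorm f 1 volume := by
  unfold potential
  rw [lintegral_lintegral_swap (aemeasurable_potential_integrand hf _),
    eLpNorm_one_eq_lintegral_enorm, ← lintegral_const_mul'' _ hf.enorm]
  refine lintegral_mono fun y => ?_
  rw [lintegral_mul_const _ (by fun_prop)]
  gcongr
  exact h y

/-- The potential is integrable over every ball, by the preceding estimate and Tonelli. -/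
lemma ae_potential_lt_top [NeZero d] (hβ : 0 < β) (hβd : β < d) (hf : MemLp f 1 volume) :
    ∀ᵐ x, potential β f x < ⊤ := by
  obtain ⟨C, hC⟩ := exists_setLIntegral_rpow_le hβ hβd
  have hn : ∀ n : ℕ, ∀ᵐ x ∂(volume.restrict (Metric.ball (0 : Vec d) n)), potential β f x < ⊤ := by
    intro n
    have ht : volume (Metric.ball (0 : Vec d) n) ≠ ⊤ := measure_ball_lt_top.ne
    refine ae_lt_top' (aemeasurable_potential hf.1).restrict ?_
    refine ((setLIntegral_potential_le hf.1 fun y => hC y _ ht).trans_lt ?_).ne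
    refine ENNReal.mul_lt_top (ENNReal.mul_lt_top ENNReal.coe_lt_top ?_) hf.2
    exact ENNReal.rpow_lt_top_of_nonneg (by rw [sub_nonneg, div_le_one (hβ.trans hβd)]; exact hβd.le) ht
  have := ae_restrict_iUnion_iff (fun n : ℕ => Metric.ball (0 : Vec d) n)
    (fun x => potential β f x < ⊤) |>.2 hn
  rwa [Metric.iUnion_ball_nat, Measure.restrict_univ] at this

/-- Functions dominated by the potential of an integrable function lie in a weak Lebesgue space. -/
lemma exists_weakNorm_le_of_potential [NeZero d] (hβ : 0 < β) (hβd : β < d) (C : ℝ≥0) :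
    ∃ C' : ℝ≥0, ∀ {E G : Type*} [NormedAddCommGroup E] [NormedAddCommGroup G] {f : Vec d → E}
      {u : Vec d → G}, MemLp f 1 volume → AEStronglyMeasurable u volume →
      (∀ x, ‖u x‖ₑ ≤ C * potential β f x) →
      weakNorm ((d : ℝ) / β) u ≤ C' * eLpNorm f 1 volume := by
  have hd : (0 : ℝ) < d := hβ.trans hβd
  have hp : 0 < (d : ℝ) / β := by positivity
  obtain ⟨C₀, hC₀⟩ := exists_setLIntegral_rpow_le hβ hβd
  refine ⟨C * C₀, fun {E G} _ _ {f u} hf hu h => ?_⟩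
  set A : ℝ≥0 := C * C₀ * (eLpNorm f 1 volume).toNNReal with hA
  have hAe : ((C * C₀ : ℝ≥0) : ℝ≥0∞) * eLpNorm f 1 volume = A := by
    rw [hA, ENNReal.coe_mul _ (eLpNorm f 1 volume).toNNReal, ENNReal.coe_toNNReal hf.2.ne]
  rw [hAe]
  refine weakNorm_le_of_distrib_le hp fun s hs => ?_
  -- Integrating |u| over S gives s |S| ≤ A |S|^(1-β/d). Dividing by the power of |S| requires 0 <
  -- |S| < ∞, so the estimate is proved on pieces of finite measure and the superlevel set is
  -- exhausted by such pieces.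
  have key : ∀ S : Set (Vec d), S ⊆ {x | (s : ℝ) < ‖u x‖} → volume S ≠ ⊤ →
      volume S ≤ ((A : ℝ≥0∞) / s) ^ ((d : ℝ) / β) := by
    intro S hS hSt
    rcases eq_or_ne (volume S) 0 with h0 | h0
    · rw [h0]; exact zero_le
    have h1 : s * volume S ≤ A * volume S ^ (1 - β / d) := by
      calc (s : ℝ≥0∞) * volume S
          ≤ ∫⁻ x in S, C * potential β f x := by
            rw [← setLIntegral_const]
            refine setLIntegral_mono_ae ((aemeasurable_potential hf.1).const_mul _).restrict
              (.of_forall fun x hx => ?_)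
            refine le_trans ?_ (h x)
            rw [← ofReal_norm, ← ENNReal.ofReal_coe_nnreal]
            exact ENNReal.ofReal_le_ofReal (hS hx).le
        _ = C * ∫⁻ x in S, potential β f x :=
            lintegral_const_mul'' _ (aemeasurable_potential hf.1).restrict
        _ ≤ C * ((C₀ * volume S ^ (1 - β / d)) * eLpNorm f 1 volume) := by
            gcongr
            exact setLIntegral_potential_le hf.1 fun y => hC₀ y S hSt
        _ = _ := by rw [← hAe]; push_cast; ring
    have h2 : volume S = volume S ^ (β / d) * volume S ^ (1 - β / d) := by
      rw [← ENNReal.rpow_add _ _ h0 hSt]; simp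
    have h3 : volume S ^ (1 - β / d) ≠ 0 := by simp [h0, hSt]
    have h4 : volume S ^ (1 - β / d) ≠ ⊤ := by simp [h0, hSt]
    have h1' : s * volume S ^ (β / d) * volume S ^ (1 - β / d) ≤ A * volume S ^ (1 - β / d) := by
      rwa [mul_assoc, ← h2]
    rw [ENNReal.mul_le_mul_iff_left h3 h4] at h1'
    have h5 : volume S ^ (β / d) ≤ A / s := by
      rw [ENNReal.le_div_iff_mul_le (by simp [hs.ne']) (by simp), mul_comm]; exact h1'
    calc volume S = (volume S ^ (β / d)) ^ ((d : ℝ) / β) := by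
          rw [← ENNReal.rpow_mul, show β / d * ((d : ℝ) / β) = 1 by field_simp, ENNReal.rpow_one]
      _ ≤ _ := ENNReal.rpow_le_rpow h5 hp.le
  rw [distrib, ← Measure.iSup_restrict_spanningSets]
  refine iSup_le fun n => ?_
  rw [Measure.restrict_apply' (measurableSet_spanningSets _ _)]
  exact key _ Set.inter_subset_left
    ((measure_mono Set.inter_subset_right).trans_lt (measure_spanningSets_lt_top _ n)).ne

end Potential

end

section

open Filter Topology

variable {d : ℕ}

/-! ### The convolution `U_α * F` -/

lemma enorm_coord_le {ι : Type*} [Fintype ι] (v : EuclideanSpace ℝ ι) (i : ι) : ‖v i‖ₑ ≤ ‖v‖ₑ := by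
  rw [← ofReal_norm, ← ofReal_norm]
  exact ENNReal.ofReal_le_ofReal (PiLp.norm_apply_le v i)

lemma memLp_coord {ι : Type*} [Fintype ι] {f : Vec d → EuclideanSpace ℝ ι}
    (hf : MemLp f 1 volume) (i : ι) : Integrable (fun x => f x i) :=
  (memLp_one_iff_integrable.1 hf).mono
    ((by fun_prop : Continuous fun v : EuclideanSpace ℝ ι => v i).comp_aestronglyMeasurable hf.1)
    (.of_forall fun x => PiLp.norm_apply_le (f x) i)

lemma enorm_le_sum {ι : Type*} [Fintype ι] [DecidableEq ι] (v : EuclideanSpace ℝ ι) :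
    ‖v‖ₑ ≤ ∑ i, ‖v i‖ₑ := by
  have h : v = ∑ i, EuclideanSpace.single i (v i) := by
    ext j
    simp [Finset.sum_apply, Pi.single_apply]
  conv_lhs => rw [h]
  refine (enorm_sum_le _ _).trans_eq (Finset.sum_congr rfl fun i _ => ?_)
  rw [← ofReal_norm, EuclideanSpace.single, PiLp.norm_single, ofReal_norm]

section KernelConv

variable [NeZero d] {α : ℝ} {F : Vec d → Tensor d}

lemma lintegral_kernel_mul_le {C : ℝ} (hC : ∀ (j k l : Fin d) (x : Vec d), x ≠ 0 →
    |kernel α j k l x| ≤ C * ‖x‖ ^ (-((d : ℝ) + 1 - 2 * α))) (j k l : Fin d) (x : Vec d) :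
    ∫⁻ t, ‖kernel α j k l t * F (x - t) (k, l)‖ₑ ≤
      ENNReal.ofReal C * potential ((d : ℝ) + 1 - 2 * α) F x := by
  rw [potential_eq, ← lintegral_const_mul' _ _ ENNReal.ofReal_ne_top]
  refine lintegral_mono_ae ?_
  filter_upwards [ae_ne_zero] with t ht
  rw [enorm_mul, ← mul_assoc, ← ENNReal.ofReal_mul' (by positivity)]
  refine mul_le_mul' ?_ (enorm_coord_le _ _)
  rw [← ofReal_norm, Real.norm_eq_abs]
  exact ENNReal.ofReal_le_ofReal (hC j k l t ht)

lemma aestronglyMeasurable_kernel_mul (hF : MemLp F 1 volume) (j k l : Fin d) :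
    AEStronglyMeasurable (fun p : Vec d × Vec d => kernel α j k l p.2 * F (p.1 - p.2) (k, l))
      (volume.prod volume) :=
  AEStronglyMeasurable.convolution_integrand (ContinuousLinearMap.mul ℝ ℝ)
    (aestronglyMeasurable_kernel α j k l) (memLp_coord hF (k, l)).1

lemma aestronglyMeasurable_kernelConv (hF : MemLp F 1 volume) :
    AEStronglyMeasurable (kernelConv α F) volume := by
  have h : ∀ j k l : Fin d, AEStronglyMeasurable (convolution (kernel α j k l)
      (fun y => F y (k, l)) (ContinuousLinearMap.mul ℝ ℝ) volume) volume := fun j k l =>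
    (aestronglyMeasurable_kernel_mul hF j k l).integral_prod_right'
  have h2 : AEStronglyMeasurable (fun x (j : Fin d) => ∑ k, ∑ l, convolution (kernel α j k l)
      (fun y => F y (k, l)) (ContinuousLinearMap.mul ℝ ℝ) volume x) volume := by
    refine AEMeasurable.aestronglyMeasurable (aemeasurable_pi_lambda _ fun j => ?_)
    refine Finset.aemeasurable_fun_sum _ fun k _ => Finset.aemeasurable_fun_sum _ fun l _ => ?_
    exact (h j k l).aemeasurable
  exact (PiLp.continuous_toLp 2 (fun _ : Fin d => ℝ)).comp_aestronglyMeasurable h2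

lemma ae_kernelConvExistsAt (hα : 1 / 2 < α) (hα' : α < ((d : ℝ) + 1) / 2)
    (hF : MemLp F 1 volume) : ∀ᵐ x, KernelConvExistsAt α F x := by
  obtain ⟨C, -, hC⟩ := exists_norm_kernel_le hα hα'
  filter_upwards [ae_potential_lt_top (β := (d : ℝ) + 1 - 2 * α) (by linarith) (by linarith) hF]
    with x hx j k l
  have hm : AEStronglyMeasurable (fun t => kernel α j k l t * F (x - t) (k, l)) volume := by
    refine (aestronglyMeasurable_kernel α j k l).mul ?_
    exact (memLp_coord hF (k, l)).1.comp_quasiMeasurePreserving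
      (Measure.measurePreserving_sub_left volume x).quasiMeasurePreserving
  exact ⟨hm, (lintegral_kernel_mul_le hC j k l x).trans_lt
    (ENNReal.mul_lt_top ENNReal.ofReal_lt_top hx)⟩

lemma exists_weakNorm_kernelConv_le (hα : 1 / 2 < α) (hα' : α < ((d : ℝ) + 1) / 2) :
    ∃ C : ℝ≥0, ∀ F : Vec d → Tensor d, MemLp F 1 volume →
      weakNorm ((d : ℝ) / (d + 1 - 2 * α)) (kernelConv α F) ≤ C * eLpNorm F 1 volume := by
  obtain ⟨C, hC0, hC⟩ := exists_norm_kernel_le hα hα'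
  -- One factor d for each of the sums over j, k and l.
  obtain ⟨C', hC'⟩ := exists_weakNorm_le_of_potential (d := d) (β := (d : ℝ) + 1 - 2 * α)
    (by linarith) (by linarith) ((d : ℝ≥0) * (d * (d * C.toNNReal)))
  refine ⟨C', fun F hF => hC' hF (aestronglyMeasurable_kernelConv hF) fun x => ?_⟩
  refine (enorm_le_sum _).trans ?_
  have h1 : ∀ j : Fin d, ‖kernelConv α F x j‖ₑ ≤ ∑ _k : Fin d, ∑ _l : Fin d,
      ENNReal.ofReal C * potential ((d : ℝ) + 1 - 2 * α) F x := fun j => by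
    refine (enorm_sum_le _ _).trans (Finset.sum_le_sum fun k _ => ?_)
    refine (enorm_sum_le _ _).trans (Finset.sum_le_sum fun l _ => ?_)
    exact (enorm_integral_le_lintegral_enorm _).trans (lintegral_kernel_mul_le hC j k l x)
  refine (Finset.sum_le_sum fun j _ => h1 j).trans_eq ?_
  simp only [Finset.sum_const, Finset.card_univ, Fintype.card_fin, nsmul_eq_mul]
  push_cast
  change _ = (d : ℝ≥0∞) * (d * (d * ENNReal.ofReal C)) * _
  ring

end KernelConv

/-! ### Pairing a convolution with a test function -/

section Fubini

variable {K f : Vec d → ℝ} {A B S : ℝ} {η : Vec d → ℂ}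

/-- Integrate in x first. A translation moves y from K onto η, which changes neither the sup norm
nor the L¹ norm of η, so the inner integral is bounded independently of y and f ∈ L¹ finishes the
estimate. -/
lemma integrable_convolution_pairing (hK : PairBound (fun x => (K x : ℂ)) A B) (hf : Integrable f)
    (hη : Integrable η) (hS : ∀ x, ‖η x‖ ≤ S) :
    Integrable (fun p : Vec d × Vec d => ((K (p.1 - p.2) : ℂ) * f p.2) * η p.1)
      (volume.prod volume) := by
  have hm : AEStronglyMeasurable (fun p : Vec d × Vec d => ((K (p.1 - p.2) : ℂ) * f p.2) * η p.1)
      (volume.prod volume) := by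
    refine AEStronglyMeasurable.mul (AEStronglyMeasurable.mul ?_ ?_) hη.1.comp_fst
    · exact hK.1.comp_quasiMeasurePreserving
        (quasiMeasurePreserving_sub_of_right_invariant volume volume)
    · exact (Complex.continuous_ofReal.comp_aestronglyMeasurable hf.1).comp_snd
  have hsh : ∀ y, Integrable (fun x => (K x : ℂ) * η (x + y)) ∧
      ∫ x, ‖(K x : ℂ) * η (x + y)‖ ≤ A * S + B * ∫ x, ‖η x‖ := fun y => by
    have := hK.2 (fun x => η (x + y)) S (hη.comp_add_right y) fun x => hS _
    rwa [integral_add_right_eq_self (fun x => ‖η x‖) y] at this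
  have hsh' : ∀ y, Integrable (fun x => (K (x - y) : ℂ) * η x) := fun y => by
    simpa using (hsh y).1.comp_sub_right y
  have hI : ∀ y, ∫ x, ‖(K (x - y) : ℂ) * η x‖ ≤ A * S + B * ∫ x, ‖η x‖ := fun y => by
    refine le_of_eq_of_le ?_ (hsh y).2
    rw [← integral_sub_right_eq_self (fun x => ‖(K x : ℂ) * η (x + y)‖) y]
    simp
  refine (integrable_prod_iff' hm).2 ⟨.of_forall fun y => ?_, ?_⟩
  · refine ((hsh' y).const_mul (f y : ℂ)).congr (.of_forall fun x => ?_)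
    simp only; ring
  · refine (hf.norm.mul_const (A * S + B * ∫ x, ‖η x‖)).mono' ?_ (.of_forall fun y => ?_)
    · exact hm.norm.prod_swap.integral_prod_right'
    · rw [Real.norm_of_nonneg (by positivity)]
      have e : ∫ x, ‖(K (x - y) : ℂ) * f y * η x‖ = ‖f y‖ * ∫ x, ‖(K (x - y) : ℂ) * η x‖ := by
        rw [← integral_const_mul]
        refine integral_congr_ae (.of_forall fun x => ?_)
        simp only [norm_mul, Complex.norm_real]; ring
      rw [e]
      exact mul_le_mul_of_nonneg_left (hI y) (norm_nonneg _)

lemma integral_convolution_mul (hK : PairBound (fun x => (K x : ℂ)) A B) (hf : Integrable f)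
    (hη : Integrable η) (hS : ∀ x, ‖η x‖ ≤ S) :
    Integrable (fun x => ((convolution K f (ContinuousLinearMap.mul ℝ ℝ) volume x : ℝ) : ℂ) * η x) ∧
    Integrable (fun y => (f y : ℂ) * ∫ x, (K x : ℂ) * η (x + y)) ∧
    ∫ x, ((convolution K f (ContinuousLinearMap.mul ℝ ℝ) volume x : ℝ) : ℂ) * η x =
      ∫ y, (f y : ℂ) * ∫ x, (K x : ℂ) * η (x + y) := by
  have hG := integrable_convolution_pairing hK hf hη hS
  have e1 : ∀ x, ((convolution K f (ContinuousLinearMap.mul ℝ ℝ) volume x : ℝ) : ℂ) * η x =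
      ∫ y, ((K (x - y) : ℂ) * f y) * η x := fun x => by
    rw [convolution_eq_swap, integral_mul_const, ← integral_complex_ofReal]
    simp
  have e2 : ∀ y, (f y : ℂ) * ∫ x, (K x : ℂ) * η (x + y) =
      ∫ x, ((K (x - y) : ℂ) * f y) * η x := fun y => by
    rw [← integral_const_mul,
      ← integral_sub_right_eq_self (fun x => (f y : ℂ) * ((K x : ℂ) * η (x + y))) y]
    refine integral_congr_ae (.of_forall fun x => ?_)
    simp only [sub_add_cancel]; ring
  simp_rw [e1, e2]
  exact ⟨hG.integral_prod_left, hG.integral_prod_right, integral_integral_swap hG⟩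

end Fubini

/-! ### Translations -/

/-- The translate `x ↦ φ (x + y)`. -/
def translate (y : Vec d) : 𝓢(Vec d, ℂ) →L[ℂ] 𝓢(Vec d, ℂ) := SchwartzMap.compSubConstCLM ℂ (-y)

lemma translate_apply (y : Vec d) (φ : 𝓢(Vec d, ℂ)) (x : Vec d) : translate y φ x = φ (x + y) := by
  rw [translate, SchwartzMap.compSubConstCLM_apply, sub_neg_eq_add]

lemma partialD_translate (c : Fin d) (y : Vec d) (φ : 𝓢(Vec d, ℂ)) :
    partialD c (translate y φ) = translate y (partialD c φ) := by
  ext x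
  have e : (translate y φ : Vec d → ℂ) = fun x => φ (x + y) := funext (translate_apply y φ)
  rw [translate_apply, partialD_apply, partialD_apply, e, fderiv_comp_add_right]

lemma fourier_translate (y : Vec d) (φ : 𝓢(Vec d, ℂ)) (ξ : Vec d) :
    𝓕 (translate y φ : Vec d → ℂ) ξ =
      Complex.exp (↑(2 * Real.pi * inner ℝ ξ y) * Complex.I) * 𝓕 (φ : Vec d → ℂ) ξ := by
  rw [Real.fourier_eq', Real.fourier_eq', ← integral_const_mul,
    ← integral_sub_right_eq_self (fun v : Vec d =>
      Complex.exp (↑(-2 * Real.pi * inner ℝ v ξ) * Complex.I) • translate y φ v) y]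
  refine integral_congr_ae (.of_forall fun x => ?_)
  simp only [translate_apply, sub_add_cancel, smul_eq_mul]
  rw [← mul_assoc, ← Complex.exp_add, ← add_mul, ← Complex.ofReal_add, inner_sub_left,
    real_inner_comm y ξ]
  congr 4
  ring

lemma fracPow_translate (r a : ℝ) (y : Vec d) (φ : 𝓢(Vec d, ℂ)) (x : Vec d) :
    fracPow r a (translate y φ) x = fracPow r a φ (x + y) := by
  rw [fracPow, fracPow, Real.fourierInv_eq', Real.fourierInv_eq']
  refine integral_congr_ae (.of_forall fun ξ => ?_)
  simp only [smul_eq_mul]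
  rw [fourier_translate, inner_add_right, mul_add, Complex.ofReal_add, add_mul, Complex.exp_add]
  ring

/-! ### Pairing the kernel with test fields -/

/-- The matrix δ_jk - ξ_j ξ_k / |ξ|² annihilates ξ; in physical space, the kernel is divergence-free
in the index j. -/
lemma sum_symbol_mul_coord {α : ℝ} (k l : Fin d) {ξ : Vec d} (hξ : ξ ≠ 0) :
    ∑ j, symbol α j k l ξ * (ξ j : ℂ) = 0 := by
  have h0 : (‖ξ‖ ^ 2 : ℝ) ≠ 0 := by positivity
  have h : ∑ j, (kron j k - ξ j * ξ k / ‖ξ‖ ^ 2) * ξ j = 0 := by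
    simp_rw [sub_mul, Finset.sum_sub_distrib, kron, ite_mul, one_mul, zero_mul]
    rw [Finset.sum_ite_eq' Finset.univ k, if_pos (Finset.mem_univ k)]
    have e : ∀ j, ξ j * ξ k / ‖ξ‖ ^ 2 * ξ j = ξ j ^ 2 * (ξ k / ‖ξ‖ ^ 2) := fun j => by ring
    simp_rw [e]
    rw [← Finset.sum_mul, ← EuclideanSpace.real_norm_sq_eq]
    field_simp
    ring
  have h' := congrArg (fun t : ℝ => (t : ℂ)) h
  push_cast at h'
  simp_rw [symbol, mul_assoc]
  rw [← Finset.mul_sum]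
  push_cast
  rw [h', mul_zero]

section Pairing

variable [NeZero d]

/-- The defining identity of the inverse transform holds for Schwartz functions, which `fracPow r a
φ` need not be. It is applied to each Bessel potential in the expansion, and both sides are summed.
-/
lemma IsInverseFourier.integral_mul_fracPow {m : Vec d → ℂ} {K : Vec d → ℝ}
    (h : IsInverseFourier m K) {A B : ℝ} (hK : PairBound (fun x => (K x : ℂ)) A B) {r a : ℝ}
    (hr : 0 < r) (ha : 0 < a) (φ : 𝓢(Vec d, ℂ)) :
    Integrable (fun ξ => m ξ * (((r * ‖ξ‖ ^ 2) ^ a : ℝ) * 𝓕⁻ (φ : Vec d → ℂ) ξ)) ∧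
    ∫ x, (K x : ℂ) * fracPow r a φ x =
      ∫ ξ, m ξ * (((r * ‖ξ‖ ^ 2) ^ a : ℝ) * 𝓕⁻ (φ : Vec d → ℂ) ξ) := by
  have hb : ∀ n : ℕ, Integrable (fun ξ => m ξ * (bes r (a - n) ξ * 𝓕⁻ (φ : Vec d → ℂ) ξ)) := by
    intro n
    have := (h.2.2 (besOp r (a - n) φ)).2.1
    simp_rw [fourierInv_besOp hr] at this
    exact this
  have hb0 : Integrable (fun ξ => m ξ * (bes r a ξ * 𝓕⁻ (φ : Vec d → ℂ) ξ)) := by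
    simpa using hb 0
  have hle : ∀ n : ℕ, ∫ ξ, ‖(binomCoeff a n : ℂ) * (m ξ * (bes r (a - n) ξ *
      𝓕⁻ (φ : Vec d → ℂ) ξ))‖ ≤
      |binomCoeff a n| * ∫ ξ, ‖m ξ * (bes r a ξ * 𝓕⁻ (φ : Vec d → ℂ) ξ)‖ := by
    intro n
    rw [← integral_const_mul]
    refine integral_mono ((hb n).const_mul _).norm (hb0.norm.const_mul _) fun ξ => ?_
    simp only [norm_mul, Complex.norm_real, Real.norm_eq_abs, abs_of_pos (bes_pos hr.le _ ξ)]
    gcongr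
    exact bes_sub_nat_le hr.le a n ξ
  have hs := hasSum_integral_of_summable_integral_norm
    (F := fun (n : ℕ) ξ => (binomCoeff a n : ℂ) * (m ξ * (bes r (a - n) ξ *
      𝓕⁻ (φ : Vec d → ℂ) ξ))) (fun n => (hb n).const_mul _)
    (Summable.of_nonneg_of_le (fun n => by positivity) hle
      ((summable_abs_binomCoeff ha).mul_right _))
  have hpt : ∀ᵐ ξ : Vec d, HasSum (fun n : ℕ => (binomCoeff a n : ℂ) * (m ξ * (bes r (a - n) ξ *
      𝓕⁻ (φ : Vec d → ℂ) ξ))) (m ξ * (((r * ‖ξ‖ ^ 2) ^ a : ℝ) * 𝓕⁻ (φ : Vec d → ℂ) ξ)) := by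
    filter_upwards [ae_ne_zero] with ξ hξ
    refine hasSum_of_eq (((Complex.hasSum_ofReal.2 (hasSum_bes hr (a := a) hξ)).mul_right
      (𝓕⁻ (φ : Vec d → ℂ) ξ)).mul_left (m ξ)) fun n => ?_
    push_cast; ring
  have hle' : ∀ ξ : Vec d, (r * ‖ξ‖ ^ 2) ^ a ≤ bes r a ξ := fun ξ =>
    Real.rpow_le_rpow (by positivity) (by linarith) ha.le
  have hmeas : AEStronglyMeasurable (fun ξ => m ξ * (((r * ‖ξ‖ ^ 2) ^ a : ℝ) *
      𝓕⁻ (φ : Vec d → ℂ) ξ)) volume := by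
    refine aestronglyMeasurable_of_tendsto_ae atTop
      (f := fun N : ℕ => fun ξ => ∑ n ∈ Finset.range N, (binomCoeff a n : ℂ) * (m ξ *
        (bes r (a - n) ξ * 𝓕⁻ (φ : Vec d → ℂ) ξ)))
      (fun N => Finset.aestronglyMeasurable_fun_sum _ fun n _ => ((hb n).const_mul _).1) ?_
    filter_upwards [hpt] with ξ hξ using hξ.tendsto_sum_nat
  refine ⟨hb0.mono hmeas (.of_forall fun ξ => ?_), ?_⟩
  · simp only [norm_mul, Complex.norm_real, Real.norm_eq_abs, abs_of_pos (bes_pos hr.le _ ξ)]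
    rw [abs_of_nonneg (by positivity)]
    gcongr
    exact hle' ξ
  · have e : ∫ ξ, m ξ * (((r * ‖ξ‖ ^ 2) ^ a : ℝ) * 𝓕⁻ (φ : Vec d → ℂ) ξ) =
        ∫ ξ, ∑' n : ℕ, (binomCoeff a n : ℂ) * (m ξ * (bes r (a - n) ξ *
          𝓕⁻ (φ : Vec d → ℂ) ξ)) := by
      refine integral_congr_ae ?_
      filter_upwards [hpt] with ξ hξ using hξ.tsum_eq.symm
    rw [e]
    refine (hK.hasSum_fracPow hr ha φ).unique (hasSum_of_eq hs fun n => ?_)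
    rw [integral_const_mul, (h.2.2 (besOp r (a - n) φ)).2.2]
    simp_rw [fourierInv_besOp hr]

variable {α : ℝ}

lemma sum_integral_kernel_partialD (hα : 1 / 2 < α) (hα' : α < ((d : ℝ) + 1) / 2) (k l : Fin d)
    (ψ : 𝓢(Vec d, ℂ)) : ∑ j, ∫ x, (kernel α j k l x : ℂ) * partialD j ψ x = 0 := by
  have h := fun j => (isInverseFourier_kernel hα hα' j k l).2.2 (partialD j ψ)
  rw [Finset.sum_congr rfl fun j _ => (h j).2.2, ← integral_finsetSum _ fun j _ => (h j).2.1]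
  rw [integral_congr_ae (g := fun _ => 0), integral_zero]
  filter_upwards [ae_ne_zero] with ξ hξ
  simp_rw [fourierInv_partialD]
  have e : ∀ j, symbol α j k l ξ * (-(2 * Real.pi * Complex.I) * (ξ j : ℂ) *
      𝓕⁻ (ψ : Vec d → ℂ) ξ) = (symbol α j k l ξ * ξ j) *
        (-(2 * Real.pi * Complex.I) * 𝓕⁻ (ψ : Vec d → ℂ) ξ) := fun j => by ring
  simp_rw [e]
  rw [← Finset.sum_mul, sum_symbol_mul_coord k l hξ, zero_mul]

/-- The fundamental solution property at the origin. On the Fourier side (2π|ξ|)^(2α) cancels the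
denominator of the symbol, and the term with ξ_j ξ_k vanishes because the field is divergence-free.
What remains is -(D_l φ_k)^∨, whose integral over all frequencies is -D_l φ_k(0). -/
lemma sum_integral_kernel_fracPow (hα : 1 / 2 < α) (hα' : α < ((d : ℝ) + 1) / 2) (k l : Fin d)
    {φ : Fin d → 𝓢(Vec d, ℂ)} (hφ : ∑ j, partialD j (φ j) = 0) :
    ∑ j, ∫ x, (kernel α j k l x : ℂ) * fracPow (4 * Real.pi ^ 2) α (φ j) x =
      -partialD l (φ k) 0 := by
  have hr : 0 < 4 * Real.pi ^ 2 := by positivity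
  have ha : 0 < α := by linarith
  choose A B hK using fun j => exists_pairBound_kernel hα hα' j k l
  have h := fun j =>
    (isInverseFourier_kernel hα hα' j k l).integral_mul_fracPow (hK j) hr ha (φ j)
  rw [Finset.sum_congr rfl fun j _ => (h j).2, ← integral_finsetSum _ fun j _ => (h j).1]
  have hdiv : ∀ ξ : Vec d, ∑ j, (ξ j : ℂ) * 𝓕⁻ (φ j : Vec d → ℂ) ξ = 0 := by
    intro ξ
    have h1 : ∑ j, 𝓕⁻ (partialD j (φ j)) = 0 := by
      have := map_sum (FourierTransform.fourierInvCLM ℂ 𝓢(Vec d, ℂ))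
        (fun j => partialD j (φ j)) Finset.univ
      rw [hφ, map_zero] at this
      exact this.symm
    have h2 := congrArg (fun f : 𝓢(Vec d, ℂ) => f ξ) h1
    simp only [sum_apply, SchwartzMap.fourierInv_coe, fourierInv_partialD, mul_assoc,
      ← Finset.mul_sum, zero_apply] at h2
    have hc : -(2 * ((Real.pi : ℂ) * (Complex.I * ∑ j, (ξ j : ℂ) * 𝓕⁻ (φ j : Vec d → ℂ) ξ))) = 0 := by
      rw [← h2]; ring
    simpa [Real.pi_ne_zero] using hc
  have hpt : ∀ᵐ ξ : Vec d, ∑ j, symbol α j k l ξ * (((4 * Real.pi ^ 2 * ‖ξ‖ ^ 2) ^ α : ℝ) *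
      𝓕⁻ (φ j : Vec d → ℂ) ξ) = -𝓕⁻ (partialD l (φ k) : Vec d → ℂ) ξ := by
    filter_upwards [ae_ne_zero] with ξ hξ
    have hp : 0 < (2 * Real.pi * ‖ξ‖) ^ (2 * α) := by positivity
    have e0 : (4 * Real.pi ^ 2 * ‖ξ‖ ^ 2) ^ α = (2 * Real.pi * ‖ξ‖) ^ (2 * α) := by
      rw [Real.rpow_mul (by positivity), Real.rpow_two]
      congr 1; ring
    have hpc : (((2 * Real.pi * ‖ξ‖) ^ (2 * α) : ℝ) : ℂ) ≠ 0 := by exact_mod_cast hp.ne'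
    have e : ∀ j, symbol α j k l ξ * (((4 * Real.pi ^ 2 * ‖ξ‖ ^ 2) ^ α : ℝ) *
        𝓕⁻ (φ j : Vec d → ℂ) ξ) = 2 * Real.pi * Complex.I * (ξ l : ℂ) *
          ((if j = k then 𝓕⁻ (φ j : Vec d → ℂ) ξ else 0) -
            (ξ k / ‖ξ‖ ^ 2 : ℂ) * ((ξ j : ℂ) * 𝓕⁻ (φ j : Vec d → ℂ) ξ)) := by
      intro j
      have hn : (‖ξ‖ : ℂ) ≠ 0 := by exact_mod_cast (norm_pos_iff.2 hξ).ne'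
      rw [e0, symbol, kron]
      by_cases hjk : j = k
      · subst hjk
        rw [if_pos rfl, if_pos rfl]
        push_cast
        field_simp
      · rw [if_neg hjk, if_neg hjk]
        push_cast
        field_simp
        ring
    simp_rw [e]
    rw [← Finset.mul_sum, Finset.sum_sub_distrib, ← Finset.mul_sum, hdiv,
      Finset.sum_ite_eq' Finset.univ k, if_pos (Finset.mem_univ k), fourierInv_partialD]
    ring
  rw [integral_congr_ae hpt, integral_neg]
  congr 1
  have hinv : partialD l (φ k) = 𝓕 (𝓕⁻ (partialD l (φ k))) := by simp
  conv_rhs => rw [hinv, SchwartzMap.fourier_coe, SchwartzMap.fourierInv_coe]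
  rw [Real.fourier_eq']
  simp

end Pairing

end

section

open Filter Topology

variable {d : ℕ}

/-! ### Existence -/

lemma exists_schwartz_ofReal {f : Vec d → ℝ} (hf : ContDiff ℝ ∞ f) (hc : HasCompactSupport f) :
    ∃ φ : 𝓢(Vec d, ℂ), (φ : Vec d → ℂ) = (fun x => (f x : ℂ)) ∧
      ∀ c x, partialD c φ x = (pderiv c f x : ℂ) := by
  have hc' : HasCompactSupport fun x => (f x : ℂ) := hc.comp_left (g := Complex.ofReal) rfl
  refine ⟨hc'.toSchwartzMap (Complex.ofRealCLM.contDiff.comp hf), rfl, fun c x => ?_⟩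
  have h : HasFDerivAt (fun x => (f x : ℂ)) (Complex.ofRealCLM ∘L fderiv ℝ f x) x :=
    Complex.ofRealCLM.hasFDerivAt.comp x (hf.differentiable (by simp) x).hasFDerivAt
  rw [partialD_apply]
  change fderiv ℝ (fun x => (f x : ℂ)) x _ = _
  rw [h.fderiv]
  rfl

variable [NeZero d] {α : ℝ}

/-- Translating the test functions moves the evaluation point from 0 to y; the gradient of χ is
annihilated by the kernel. -/
lemma sum_integral_kernel_shift (hα : 1 / 2 < α) (hα' : α < ((d : ℝ) + 1) / 2) (k l : Fin d)
    {φ : Fin d → 𝓢(Vec d, ℂ)} (hφ : ∑ j, partialD j (φ j) = 0) (χ : 𝓢(Vec d, ℂ)) (y : Vec d) :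
    ∑ j, ∫ x, (kernel α j k l x : ℂ) *
      (fracPow (4 * Real.pi ^ 2) α (φ j) (x + y) + partialD j χ (x + y)) =
    -partialD l (φ k) y := by
  have hr : 0 < 4 * Real.pi ^ 2 := by positivity
  have h : ∀ j, ∫ x, (kernel α j k l x : ℂ) *
      (fracPow (4 * Real.pi ^ 2) α (φ j) (x + y) + partialD j χ (x + y)) =
      (∫ x, (kernel α j k l x : ℂ) * fracPow (4 * Real.pi ^ 2) α (translate y (φ j)) x) +
        ∫ x, (kernel α j k l x : ℂ) * partialD j (translate y χ) x := by
    intro j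
    obtain ⟨A, B, hK⟩ := exists_pairBound_kernel hα hα' j k l
    rw [← integral_add (hK.integrable_fracPow hr (by linarith) _) (hK.integrable_schwartz _)]
    refine integral_congr_ae (.of_forall fun x => ?_)
    simp only [fracPow_translate, partialD_translate, translate_apply, mul_add]
  have hdiv : ∑ j, partialD j (translate y (φ j)) = 0 := by
    simp_rw [partialD_translate]
    rw [← map_sum, hφ, map_zero]
  simp_rw [h]
  rw [Finset.sum_add_distrib, sum_integral_kernel_partialD hα hα', add_zero,
    sum_integral_kernel_fracPow hα hα' k l hdiv, partialD_translate, translate_apply, zero_add]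

/-- Fubini places F outside and the kernel against the shifted test functions; summed over j, the
inner integral is -D_lΦ^k(y). -/
theorem isVeryWeakSolution_kernelConv (hα : 1 / 2 < α) (hα' : α < ((d : ℝ) + 1) / 2)
    {F : Vec d → Tensor d} (hF : MemLp F 1 volume) (hu : MemL1AddLinfty (kernelConv α F)) :
    IsVeryWeakSolution α F (kernelConv α F) := by
  refine ⟨hu, fun Φ ψ hΦ hΦc hdiv hψ hψc => ?_⟩
  have hr : 0 < 4 * Real.pi ^ 2 := by positivity
  have ha : 0 < α := by linarith
  choose φ hφ hφD using fun j => exists_schwartz_ofReal (contDiff_euclidean.1 hΦ j)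
    (hΦc.comp_left (g := fun v : Vec d => v j) rfl)
  obtain ⟨χ, -, hχD⟩ := exists_schwartz_ofReal hψ hψc
  have hφdiv : ∑ j, partialD j (φ j) = 0 := by
    ext x
    simp only [sum_apply, hφD, zero_apply]
    exact_mod_cast hdiv x
  set η : Fin d → Vec d → ℂ := fun j x =>
    fracPow (4 * Real.pi ^ 2) α (φ j) x + partialD j χ x with hη
  have hηi : ∀ j, Integrable (η j) := fun j =>
    (integrable_fracPow hr ha (φ j)).1.add (SchwartzMap.integrable _)
  have hηb : ∀ j, ∃ S, ∀ x, ‖η j x‖ ≤ S := fun j => by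
    obtain ⟨S, hS⟩ := exists_norm_le (besOp (4 * Real.pi ^ 2) α (φ j))
    obtain ⟨S', hS'⟩ := exists_norm_le (partialD j χ)
    exact ⟨_, fun x => (norm_add_le _ _).trans (add_le_add (norm_fracPow_le hr ha _ hS x) (hS' x))⟩
  choose S hS using hηb
  have hf : ∀ k l, Integrable fun y => F y (k, l) := fun k l => memLp_coord hF (k, l)
  choose A B hK using fun j k l => exists_pairBound_kernel hα hα' j k l
  have hconv := fun j k l => integral_convolution_mul (hK j k l) (hf k l) (hηi j) (hS j)
  have e1 : ∀ x, ∑ j, (kernelConv α F x j : ℂ) *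
      (fracLaplacian (2 * α) (fun y => (Φ y j : ℂ)) x + (pderiv j ψ x : ℂ)) =
      ∑ j, ∑ k, ∑ l, ((convolution (kernel α j k l) (fun y => F y (k, l))
        (ContinuousLinearMap.mul ℝ ℝ) volume x : ℝ) : ℂ) * η j x := by
    intro x
    refine Finset.sum_congr rfl fun j _ => ?_
    have e : (fun y => (Φ y j : ℂ)) = φ j := (hφ j).symm
    rw [e, fracLaplacian_eq_fracPow, ← hχD, kernelConv]
    push_cast
    simp_rw [Finset.sum_mul]
    rfl
  have e2 : ∫ x, ∑ j, ∑ k, ∑ l, ((convolution (kernel α j k l) (fun y => F y (k, l))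
      (ContinuousLinearMap.mul ℝ ℝ) volume x : ℝ) : ℂ) * η j x =
      ∑ j, ∑ k, ∑ l, ∫ y, (F y (k, l) : ℂ) * ∫ x, (kernel α j k l x : ℂ) * η j (x + y) := by
    rw [integral_finsetSum _ fun j _ => integrable_finsetSum _ fun k _ =>
      integrable_finsetSum _ fun l _ => (hconv j k l).1]
    refine Finset.sum_congr rfl fun j _ => ?_
    rw [integral_finsetSum _ fun k _ => integrable_finsetSum _ fun l _ => (hconv j k l).1]
    refine Finset.sum_congr rfl fun k _ => ?_
    rw [integral_finsetSum _ fun l _ => (hconv j k l).1]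
    exact Finset.sum_congr rfl fun l _ => (hconv j k l).2.2
  have e3 : ∀ k l, ∑ j, ∫ y, (F y (k, l) : ℂ) * ∫ x, (kernel α j k l x : ℂ) * η j (x + y) =
      -∫ y, ((F y (k, l) * pderiv l (fun y => Φ y k) y : ℝ) : ℂ) := by
    intro k l
    rw [← integral_finsetSum _ fun j _ => (hconv j k l).2.1, ← integral_neg]
    refine integral_congr_ae (.of_forall fun y => ?_)
    simp only [hη]
    rw [← Finset.mul_sum, sum_integral_kernel_shift hα hα' k l hφdiv χ y, hφD]
    push_cast; ring
  have hint : ∀ k l, Integrable fun y => F y (k, l) * pderiv l (fun y => Φ y k) y := by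
    intro k l
    obtain ⟨S', hS'⟩ := exists_norm_le (partialD l (φ k))
    have h1 : ∀ y, pderiv l (fun y => Φ y k) y = (partialD l (φ k) y).re := fun y => by
      rw [hφD]; rfl
    have h2 : (fun y => F y (k, l) * pderiv l (fun y => Φ y k) y) =
        fun y => (partialD l (φ k) y).re * F y (k, l) := by
      ext y; rw [h1, mul_comm]
    rw [h2]
    refine (hf k l).bdd_mul (c := S') (Continuous.aestronglyMeasurable (by fun_prop))
      (.of_forall fun y => ?_)
    exact (Complex.abs_re_le_norm _).trans (hS' y)
  simp_rw [e1]
  -- The index pair of F : ∇Φ is (k, l) here, while j is the component index of the solution; the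
  -- sums are reordered so that j is innermost.
  rw [e2, integral_finsetSum _ fun k _ => integrable_finsetSum _ fun l _ => hint k l,
    Finset.sum_comm]
  push_cast
  rw [← Finset.sum_neg_distrib]
  refine Finset.sum_congr rfl fun k _ => ?_
  rw [Finset.sum_comm, integral_finsetSum _ fun l _ => hint k l]
  push_cast
  rw [← Finset.sum_neg_distrib]
  refine Finset.sum_congr rfl fun l _ => ?_
  rw [e3, integral_complex_ofReal]

end

end FracStokes

end

/-! ### Assembly of parts (i) and (ii) -/

theorem mainTheorem5 (d : ℕ) (hd : 2 ≤ d) (α : ℝ) (hα : 1 / 2 < α) (hα' : α < ((d : ℝ) + 1) / 2) :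
    (∀ j k l : Fin d,
      FracStokes.IsInverseFourier (FracStokes.symbol α j k l) (FracStokes.kernel α j k l)) ∧
    ∃ C : ℝ≥0, ∀ F : FracStokes.Vec d → FracStokes.Tensor d, MemLp F 1 volume →
      ∃ u : FracStokes.Vec d → FracStokes.Vec d,
        FracStokes.MemWeakLp ((d : ℝ) / (d + 1 - 2 * α)) u ∧
        FracStokes.IsVeryWeakSolution α F u ∧
        (∀ v : FracStokes.Vec d → FracStokes.Vec d,
          FracStokes.MemWeakLp ((d : ℝ) / (d + 1 - 2 * α)) v →
          FracStokes.IsVeryWeakSolution α F v → v =ᵐ[volume] u) ∧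
        (∀ᵐ x, FracStokes.KernelConvExistsAt α F x) ∧
        u =ᵐ[volume] FracStokes.kernelConv α F ∧
        FracStokes.weakNorm ((d : ℝ) / (d + 1 - 2 * α)) u ≤ C * eLpNorm F 1 volume := by
  have : NeZero d := ⟨by omega⟩
  have hd0 : (0 : ℝ) < d := by exact_mod_cast (by omega : 0 < d)
  -- With positive denominator, the exponent exceeds 1 exactly when α > 1/2.
  have hp : 1 < (d : ℝ) / (d + 1 - 2 * α) := by
    rw [one_lt_div (by linarith)]; linarith
  obtain ⟨C, hC⟩ := FracStokes.exists_weakNorm_kernelConv_le (d := d) hα hα'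
  refine ⟨FracStokes.isInverseFourier_kernel hα hα', C, fun F hF => ?_⟩
  have hu : FracStokes.MemWeakLp ((d : ℝ) / (d + 1 - 2 * α)) (FracStokes.kernelConv α F) :=
    ⟨FracStokes.aestronglyMeasurable_kernelConv hF,
      (hC F hF).trans_lt (ENNReal.mul_lt_top ENNReal.coe_lt_top hF.2)⟩
  have hw := FracStokes.isVeryWeakSolution_kernelConv hα hα' hF
    (FracStokes.memL1AddLinfty_of_memWeakLp hp hu)
  exact ⟨FracStokes.kernelConv α F, hu, hw,
    fun v hv hvw => hw.ae_eq (by linarith) hp hvw hu hv,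
    FracStokes.ae_kernelConvExistsAt hα hα' hF, Filter.EventuallyEq.rfl, hC F hF⟩
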